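/- Let $(\Omega,\mathcal F,P)$ be a probability space with a filtration $(\mathcal F_t)_{0\le t\le T}$ such that $\mathcal F_0$ contains all $P$-null sets, and let $(S_t)_{0\le t\le T}$ be an adapted $\mathbb R^d$-valued process, $\Delta S_t:=S_t-S_{t-1}$. Let $\Xi_t$ be the set of $\mathcal F_t$-measurable $\mathbb R^d$-valued random variables and $\Phi$ the set of strategies $\phi=(\phi_t)_{1\le t\le T}$ with $\phi_t\in\Xi_{t-1}$; for $c\in\mathbb R$ put $V_t^{c,\phi}:=c+\sum_{i=1}^t\langle\phi_i,\Delta S_i\rangle$. Assume (NA) for every $\phi\in\Phi$: if $V_T^{0,\phi}\ge 0$ a.s., then $V_T^{0,\phi}=0$ a.s. Let $U:\mathbb R\to\mathbb R$ be concave and nondecreasing with $U(0)=0$, and suppose that at least one of the following holds: (a) there are $\tilde x>0$ and $0<\gamma<1$ with $U(\lambda x)\le\lambda^\gamma U(x)$ for all $x\ge\tilde x$, $\lambda\ge1$; (b) there are $\alpha>0$ and $\tilde x\le0$ with $U(\lambda x)\le\lambda^{1+\alpha}U(x)$ for all $x\le\tilde x$, $\lambda\ge1$. Let $B$ be a bounded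 random variable. (An expectation or conditional expectation of a random variable $X$ is understood in the generalized sense, as that of $X^+$ minus that of $X^-$, with values in $[-\infty,\infty]$; it is well defined if these two are not both infinite, almost surely in the conditional case.) Put $U_T(x):=U(x-B)$ and suppose that the random functions $$U_t(x):=\operatorname*{ess\,sup}_{\xi\in\Xi_t}E\bigl(U_{t+1}(x+\langle\xi,\Delta S_{t+1}\rangle)\,\big|\,\mathcal F_t\bigr),\qquad x\in\mathbb R,\ t=T-1,\dots,0,$$ are well defined (all the conditional expectations on the right are well defined, where for $U_{t+1}$, $t+1<T$, one takes a version with almost surely nondecreasing concave paths) and satisfy $U_t(x)<\infty$ a.s. for all $x\in\mathbb R$ and $0\le t<T$, and that $EU_0(x)<\infty$ for all $x\in\mathbb R$. Then for every $c\in\mathbb R$ there is a strategy $\phi^*=\phi^*(c)\in\Phi(U,c,B)$ such that $$u(B,c)=EU\bigl(V_T^{c,\phi^*}-B\bigr),\qquad -\infty<u(B,c)<\infty,$$ where $$u(B,c):=\sup_{\phi\in\Phi(U,c,B)}EU\bigl(V_T^{c,\phi}-B\bigr)$$ and $\Phi(U,c,B)$ is the set of $\phi\in\Phi$ for which the expectation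 $EU(V_T^{c,\phi}-B)$ is well defined. -/

import Mathlib

open MeasureTheory

namespace UtilityMax

/-! ### Generalized expectations and essential suprema -/

section Generalized

variable {Ω : Type*} {mΩ : MeasurableSpace Ω}

/-- The expectation `E X = E X⁺ - E X⁻` is well defined: `E X⁺` and `E X⁻` are not both infinite. -/
def ExpDefined (P : Measure Ω) (X : Ω → ℝ) : Prop :=
  ∫⁻ ω, ENNReal.ofReal (X ω) ∂P ≠ ⊤ ∨ ∫⁻ ω, ENNReal.ofReal (-X ω) ∂P ≠ ⊤

/-- The extended-real expectation `E X = E X⁺ - E X⁻` (meaningful when `ExpDefined P X`). -/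
noncomputable def genExp (P : Measure Ω) (X : Ω → ℝ) : EReal :=
  ((∫⁻ ω, ENNReal.ofReal (X ω) ∂P : ENNReal) : EReal) -
    ((∫⁻ ω, ENNReal.ofReal (-X ω) ∂P : ENNReal) : EReal)

/-- The generalized conditional expectation `E(X | m) = E(X⁺ | m) - E(X⁻ | m)` is well defined:
almost surely, `E(X⁺ | m)` and `E(X⁻ | m)` are not both infinite. -/
def CondExpDefined (P : Measure[mΩ] Ω) (m : MeasurableSpace Ω) (X : Ω → ℝ) : Prop :=
  ∀ᵐ ω ∂P, condLExp m P (fun ω' => ENNReal.ofReal (X ω')) ω ≠ ⊤ ∨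
    condLExp m P (fun ω' => ENNReal.ofReal (-X ω')) ω ≠ ⊤

/-- The generalized (extended-real valued) conditional expectation
`E(X | m) = E(X⁺ | m) - E(X⁻ | m)` (meaningful when `CondExpDefined P m X`). -/
noncomputable def genCondExp (P : Measure[mΩ] Ω) (m : MeasurableSpace Ω) (X : Ω → ℝ) : Ω → EReal :=
  fun ω => ((condLExp m P (fun ω' => ENNReal.ofReal (X ω')) ω : ENNReal) : EReal) -
    ((condLExp m P (fun ω' => ENNReal.ofReal (-X ω')) ω : ENNReal) : EReal)

/-- `Z` is a version of the essential supremum of the family `(f i)` of `m`-measurable extended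
random variables: it is `m`-measurable, it dominates every `f i` almost surely, and it is almost
surely below every random variable with that property. -/
def IsEssSup {ι : Type*} (P : Measure[mΩ] Ω) (m : MeasurableSpace Ω)
    (f : ι → Ω → EReal) (Z : Ω → EReal) : Prop :=
  Measurable[m] Z ∧ (∀ i, f i ≤ᵐ[P] Z) ∧
    ∀ Z' : Ω → EReal, Measurable[mΩ] Z' → (∀ i, f i ≤ᵐ[P] Z') → Z ≤ᵐ[P] Z'

end Generalized

/-! ### The market -/

section Market

variable {Ω : Type*} {mΩ : MeasurableSpace Ω} {d : ℕ}

/-- The set `Ξ_t` of `F_t`-measurable `d`-dimensional random variables. -/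
abbrev Xi (d : ℕ) (F : Filtration ℕ mΩ) (t : ℕ) : Type _ :=
  {ξ : Ω → EuclideanSpace ℝ (Fin d) // Measurable[F t] ξ}

/-- Trading strategies `(φ_t)`, `1 ≤ t ≤ T`: predictability means that `φ_{t+1}` is
`F_t`-measurable for `0 ≤ t < T`. The values of `φ` at other times are irrelevant. -/
def IsStrategy (F : Filtration ℕ mΩ) (T : ℕ) (φ : ℕ → Ω → EuclideanSpace ℝ (Fin d)) : Prop :=
  ∀ t, t < T → Measurable[F t] (φ (t + 1))

/-- The gain `⟨y, ΔS_{t+1}⟩` of a position `y` held from time `t` to time `t + 1`. -/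
noncomputable def gain (S : ℕ → Ω → EuclideanSpace ℝ (Fin d)) (t : ℕ)
    (y : EuclideanSpace ℝ (Fin d)) (ω : Ω) : ℝ :=
  inner ℝ y (S (t + 1) ω - S t ω)

/-- The portfolio value `V_t^{c,φ} = c + ∑_{i=1}^t ⟨φ_i, S_i - S_{i-1}⟩`. -/
noncomputable def wealth (S : ℕ → Ω → EuclideanSpace ℝ (Fin d)) (c : ℝ)
    (φ : ℕ → Ω → EuclideanSpace ℝ (Fin d)) (t : ℕ) (ω : Ω) : ℝ :=
  c + ∑ i ∈ Finset.range t, gain S i (φ (i + 1) ω) ω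

/-- Absence of arbitrage. -/
def NoArbitrage (P : Measure Ω) (F : Filtration ℕ mΩ) (T : ℕ)
    (S : ℕ → Ω → EuclideanSpace ℝ (Fin d)) : Prop :=
  ∀ φ : ℕ → Ω → EuclideanSpace ℝ (Fin d), IsStrategy F T φ →
    (∀ᵐ ω ∂P, 0 ≤ wealth S 0 φ T ω) → ∀ᵐ ω ∂P, wealth S 0 φ T ω = 0

/-! ### The dynamic value functions -/

/-- The family `ξ ↦ E(V(x + ⟨ξ, ΔS_{t+1}⟩) | F_t)`, `ξ ∈ Ξ_t`, for a random function `V`. -/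
noncomputable def condValue (P : Measure Ω) (F : Filtration ℕ mΩ)
    (S : ℕ → Ω → EuclideanSpace ℝ (Fin d)) (t : ℕ) (V : ℝ → Ω → ℝ) (x : ℝ)
    (ξ : Xi d F t) : Ω → EReal :=
  genCondExp P (F t) (fun ω => V (x + gain S t (ξ.1 ω) ω) ω)

/-- `IsValueFunction P F S T UT t V`: the random function `V` is a (regular version of) the value
function `U_t` obtained by backward recursion from the random terminal utility `U_T = UT`:
`U_t(x) = ess sup_{ξ ∈ Ξ_t} E(U_{t+1}(x + ⟨ξ, ΔS_{t+1}⟩) | F_t)` for every `x`.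
Since `U_{t+1}` is evaluated at a random point, versions whose paths are almost surely
nondecreasing and concave (hence continuous) are used; such a version is unique up to a null set.
That such versions exist is nowhere assumed. -/
inductive IsValueFunction (P : Measure Ω) (F : Filtration ℕ mΩ)
    (S : ℕ → Ω → EuclideanSpace ℝ (Fin d)) (T : ℕ) (UT : ℝ → Ω → ℝ) :
    ℕ → (ℝ → Ω → ℝ) → Prop
  | terminal : IsValueFunction P F S T UT T UT
  | step {t : ℕ} {V W : ℝ → Ω → ℝ} (ht : t < T)
      (hV : IsValueFunction P F S T UT (t + 1) V)
      (hreg : ∀ᵐ ω ∂P, Monotone (fun x => W x ω) ∧ ConcaveOn ℝ Set.univ (fun x => W x ω))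
      (hW : ∀ x, IsEssSup P (F t) (condValue P F S t V x) (fun ω => ((W x ω : ℝ) : EReal))) :
      IsValueFunction P F S T UT t W

/-- The value functions with random terminal utility `UT` are well defined and finite: at each
`0 ≤ t < T` and for each `x`, all the conditional expectations
`E(U_{t+1}(x + ⟨ξ, ΔS_{t+1}⟩) | F_t)`, `ξ ∈ Ξ_t`, are well defined and their essential supremum
`U_t(x)` is almost surely `< ∞`; moreover `E U_0(x) < ∞` for each `x`. -/
structure FiniteValueFunctions (P : Measure Ω) (F : Filtration ℕ mΩ)
    (S : ℕ → Ω → EuclideanSpace ℝ (Fin d)) (T : ℕ) (UT : ℝ → Ω → ℝ) : Prop where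
  defined : ∀ (t : ℕ) (V : ℝ → Ω → ℝ), t < T → IsValueFunction P F S T UT (t + 1) V →
    ∀ (x : ℝ) (ξ : Xi d F t), CondExpDefined P (F t) (fun ω => V (x + gain S t (ξ.1 ω) ω) ω)
  finite : ∀ (t : ℕ) (V : ℝ → Ω → ℝ), t < T → IsValueFunction P F S T UT (t + 1) V →
    ∀ (x : ℝ), ∃ Z : Ω → EReal, IsEssSup P (F t) (condValue P F S t V x) Z ∧ ∀ᵐ ω ∂P, Z ω < ⊤
  initial : ∀ V : ℝ → Ω → ℝ, IsValueFunction P F S T UT 0 V →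
    ∀ x : ℝ, ExpDefined P (V x) ∧ genExp P (V x) < ⊤

/-! ### Optimization with a contingent claim -/

/-- The set `Φ(U, c, B)` of the strategies `φ` for which `E U(V_T^{c,φ} - B)` is well defined. -/
def admissible (P : Measure Ω) (F : Filtration ℕ mΩ)
    (S : ℕ → Ω → EuclideanSpace ℝ (Fin d)) (T : ℕ) (U : ℝ → ℝ) (c : ℝ) (B : Ω → ℝ) :
    Set (ℕ → Ω → EuclideanSpace ℝ (Fin d)) :=
  {φ | IsStrategy F T φ ∧ ExpDefined P (fun ω => U (wealth S c φ T ω - B ω))}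

/-- The optimal value `u(B, c) = sup_{φ ∈ Φ(U, c, B)} E U(V_T^{c,φ} - B)`. -/
noncomputable def optimalValue (P : Measure Ω) (F : Filtration ℕ mΩ)
    (S : ℕ → Ω → EuclideanSpace ℝ (Fin d)) (T : ℕ) (U : ℝ → ℝ) (c : ℝ) (B : Ω → ℝ) : EReal :=
  ⨆ φ ∈ admissible P F S T U c B, genExp P (fun ω => U (wealth S c φ T ω - B ω))

end Market

/-! ### Utility functions -/

/-- A concave, nondecreasing utility function with `U(0) = 0`, whose growth at `+∞` is controlled:
`U(λx) ≤ λ^γ U(x)` for all `x ≥ x₀`, `λ ≥ 1`, for some `x₀ > 0` and `0 < γ < 1`. -/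
structure ElasticAtTop (U : ℝ → ℝ) : Prop where
  concave : ConcaveOn ℝ Set.univ U
  mono : Monotone U
  zero : U 0 = 0
  growth : ∃ x₀ : ℝ, 0 < x₀ ∧ ∃ γ : ℝ, 0 < γ ∧ γ < 1 ∧
    ∀ x, x₀ ≤ x → ∀ l : ℝ, 1 ≤ l → U (l * x) ≤ l ^ γ * U x

/-- A concave, nondecreasing utility function with `U(0) = 0`, whose growth at `-∞` is controlled:
`U(λx) ≤ λ^(1+α) U(x)` for all `x ≤ x₀`, `λ ≥ 1`, for some `α > 0` and `x₀ ≤ 0`. -/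
structure ElasticAtBot (U : ℝ → ℝ) : Prop where
  concave : ConcaveOn ℝ Set.univ U
  mono : Monotone U
  zero : U 0 = 0
  growth : ∃ α : ℝ, 0 < α ∧ ∃ x₀ : ℝ, x₀ ≤ 0 ∧
    ∀ x, x ≤ x₀ → ∀ l : ℝ, 1 ≤ l → U (l * x) ≤ l ^ (1 + α) * U x

end UtilityMax

/-!
The proof is backward dynamic programming. For a single period, condition `(a)` gives the growth
exponents `p = γ < q = 1` and condition `(b)` gives `p = 1 < q = 1 + α`, the second one slightly
reduced in order to absorb the bounded claim. Since scaling a position multiplies gains by at most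
`λ^p` and losses by at least `λ^q`, and since absence of arbitrage makes losses possible in every
direction that is not orthogonal to the price increments, the orthogonally projected positions of
a maximizing sequence remain almost surely bounded. A measurable selection of convergent
subsequences and Fatou's lemma then produce an optimal position, and the resulting value function
is again a random utility with the same exponents and constant. So the construction can be iterated
down to time `0`, where gluing the optimal positions of the single periods gives the optimal
strategy.
-/

namespace UtilityMax

/-! ### Conditional expectations of conditionally integrable random variables -/

section CondLExp

open Filter
open scoped ENNReal

variable {Ω : Type*} {m mΩ : MeasurableSpace Ω} {P : Measure Ω} {X Z : Ω → ℝ≥0∞}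

theorem condLExp_mul_left (hm : m ≤ mΩ) [SigmaFinite (P.trim hm)] {r : Ω → ℝ≥0∞}
    (hr : Measurable[m] r) (hX : Measurable X) :
    P⁻[fun ω => r ω * X ω | m] =ᵐ[P] fun ω => r ω * P⁻[X | m] ω := by
  refine (ae_eq_condLExp hm P _ (hr.mul (measurable_condLExp m P X)) fun s hs => ?_).symm
  have htrim : (P.withDensity P⁻[X | m]).trim hm = (P.withDensity X).trim hm := by
    refine @Measure.ext _ m _ _ fun t ht => ?_
    rw [trim_measurableSet_eq hm ht, trim_measurableSet_eq hm ht, withDensity_apply _ (hm t ht),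
      withDensity_apply _ (hm t ht), setLIntegral_condLExp hm P X ht]
  have setLIntegral_mul : ∀ Y : Ω → ℝ≥0∞, Measurable Y → ∫⁻ ω in s, r ω * Y ω ∂P =
      ∫⁻ ω, s.indicator r ω ∂((P.withDensity Y).trim hm) := by
    intro Y hY
    rw [lintegral_trim hm (hr.indicator hs), lintegral_withDensity_eq_lintegral_mul _ hY
      ((hr.indicator hs).mono hm le_rfl), ← lintegral_indicator (hm s hs)]
    refine lintegral_congr fun ω => ?_
    by_cases h : ω ∈ s <;> simp [h, mul_comm]
  exact (setLIntegral_mul _ (measurable_condLExp' m P X)).trans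
    (by rw [setLIntegral_mul _ hX, htrim])

theorem condLExp_le_of_setLIntegral_le (hm : m ≤ mΩ) [SigmaFinite (P.trim hm)]
    (hZ : Measurable[m] Z)
    (h : ∀ s, MeasurableSet[m] s → ∫⁻ ω in s, X ω ∂P ≤ ∫⁻ ω in s, Z ω ∂P) :
    P⁻[X | m] ≤ᵐ[P] Z := by
  refine ae_le_of_ae_le_trim (hm := hm) (ae_le_of_forall_setLIntegral_le_of_sigmaFinite
    (measurable_condLExp m P X) fun s hs _ => ?_)
  rw [setLIntegral_condLExp_trim hm _ _ hs, setLIntegral_trim hm hZ hs]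
  exact h s hs

theorem condLExp_liminf_le (hm : m ≤ mΩ) [SigmaFinite (P.trim hm)] {u : ℕ → Ω → ℝ≥0∞}
    (hu : ∀ n, Measurable (u n)) (hZ : Measurable[m] Z)
    (hle : ∀ᶠ n in atTop, P⁻[u n | m] ≤ᵐ[P] Z) :
    P⁻[fun ω => liminf (fun n => u n ω) atTop | m] ≤ᵐ[P] Z := by
  refine condLExp_le_of_setLIntegral_le hm hZ fun s hs => (lintegral_liminf_le hu).trans ?_
  refine liminf_le_of_frequently_le' (Eventually.frequently ?_)
  filter_upwards [hle] with n hn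
  rw [← setLIntegral_condLExp hm P (u n) hs]
  exact lintegral_mono_ae (ae_restrict_of_ae hn)

theorem condLExp_congr_on (hm : m ≤ mΩ) [SigmaFinite (P.trim hm)] (hX : Measurable X)
    (hZ : Measurable Z) {A : Set Ω} (hA : MeasurableSet[m] A)
    (h : ∀ᵐ ω ∂P, ω ∈ A → X ω = Z ω) :
    ∀ᵐ ω ∂P, ω ∈ A → P⁻[X | m] ω = P⁻[Z | m] ω := by
  have hr : Measurable[m] (A.indicator fun _ => (1 : ℝ≥0∞)) := measurable_const.indicator hA
  have hXZ : (fun ω => A.indicator (fun _ => (1 : ℝ≥0∞)) ω * X ω) =ᵐ[P]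
      fun ω => A.indicator (fun _ => (1 : ℝ≥0∞)) ω * Z ω := by
    filter_upwards [h] with ω h
    by_cases hω : ω ∈ A
    · simp [hω, h hω]
    · simp [hω]
  filter_upwards [condLExp_mul_left (P := P) hm hr hX, condLExp_mul_left (P := P) hm hr hZ,
    condLExp_congr_ae (mΩ := m) hXZ] with ω hX hZ hXZ hω
  simpa [hω] using hX.symm.trans (hXZ.trans hZ)

theorem ae_lt_top_of_condLExp_lt_top [IsFiniteMeasure P] (hm : m ≤ mΩ) (hX : Measurable X)
    (h : ∀ᵐ ω ∂P, P⁻[X | m] ω < ⊤) : ∀ᵐ ω ∂P, X ω < ⊤ := by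
  have lt_top_on_level : ∀ n : ℕ, ∀ᵐ ω ∂P, P⁻[X | m] ω ≤ n → X ω < ⊤ := by
    intro n
    have hs : MeasurableSet[m] {ω | P⁻[X | m] ω ≤ n} :=
      measurableSet_le (measurable_condLExp m P X) measurable_const
    have hint : ∫⁻ ω in {ω | P⁻[X | m] ω ≤ n}, X ω ∂P ≠ ⊤ := by
      rw [← setLIntegral_condLExp hm P X hs]
      refine ne_top_of_le_ne_top (b := ∫⁻ _, (n : ℝ≥0∞) ∂P)
        (by simp [ENNReal.mul_eq_top]) ?_
      exact (setLIntegral_mono measurable_const fun _ hω => hω).trans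
        (setLIntegral_le_lintegral _ _)
    have hae := ae_lt_top hX hint
    rwa [ae_restrict_iff' (hm _ hs)] at hae
  filter_upwards [h, ae_all_iff.2 lt_top_on_level] with ω hω hlevel
  obtain ⟨n, hn⟩ := ENNReal.exists_nat_gt hω.ne
  exact hlevel n hn.le

end CondLExp

section CondMean

open Filter
open scoped ENNReal

variable {Ω : Type*} {m mΩ : MeasurableSpace Ω} {P : Measure Ω} {f g : Ω → ℝ}

/-- `f` is a random variable with `E(|f| | m) < ∞` almost surely; `f` need not be integrable. -/
structure CondIntegrable {mΩ : MeasurableSpace Ω} (P : Measure[mΩ] Ω) (m : MeasurableSpace Ω)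
    (f : Ω → ℝ) : Prop where
  measurable : Measurable[mΩ] f
  lt_top : ∀ᵐ ω ∂P, P⁻[fun ω => ENNReal.ofReal |f ω| | m] ω < ⊤

/-- The conditional expectation `E(f⁺ | m) - E(f⁻ | m)` of a conditionally integrable random
variable `f`, as a real random variable. -/
noncomputable def condMean {mΩ : MeasurableSpace Ω} (P : Measure[mΩ] Ω) (m : MeasurableSpace Ω)
    (f : Ω → ℝ) : Ω → ℝ :=
  fun ω => (P⁻[fun ω => ENNReal.ofReal (f ω) | m] ω).toReal -
    (P⁻[fun ω => ENNReal.ofReal (-f ω) | m] ω).toReal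

theorem measurable_condMean (P : Measure[mΩ] Ω) (m : MeasurableSpace Ω) (f : Ω → ℝ) :
    Measurable[m] (condMean P m f) :=
  (measurable_condLExp m P _).ennreal_toReal.sub (measurable_condLExp m P _).ennreal_toReal

theorem condMean_neg (f : Ω → ℝ) (ω : Ω) : condMean P m (fun ω => -f ω) ω = -condMean P m f ω := by
  simp [condMean]

theorem condMean_congr (h : f =ᵐ[P] g) : condMean P m f =ᵐ[P] condMean P m g := by
  have hpos : (fun ω => ENNReal.ofReal (f ω)) =ᵐ[P] fun ω => ENNReal.ofReal (g ω) :=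
    h.fun_comp ENNReal.ofReal
  have hneg : (fun ω => ENNReal.ofReal (-f ω)) =ᵐ[P] fun ω => ENNReal.ofReal (-g ω) :=
    h.fun_comp fun x => ENNReal.ofReal (-x)
  filter_upwards [condLExp_congr_ae (mΩ := m) hpos, condLExp_congr_ae (mΩ := m) hneg]
    with ω hω₁ hω₂
  simp only [condMean, hω₁, hω₂]

theorem condMean_of_measurable (hm : m ≤ mΩ) [SigmaFinite (P.trim hm)] (hf : Measurable[m] f) :
    condMean P m f = f := by
  ext ω
  rw [condMean, condLExp_eq_self hm P (by fun_prop), condLExp_eq_self hm P (by fun_prop),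
    ENNReal.toReal_ofReal', ENNReal.toReal_ofReal', max_zero_sub_max_neg_zero_eq_self]

theorem condLExp_ofReal_mono (h : ∀ᵐ ω ∂P, f ω ≤ g ω) :
    P⁻[fun ω => ENNReal.ofReal (f ω) | m] ≤ᵐ[P] P⁻[fun ω => ENNReal.ofReal (g ω) | m] :=
  condLExp_mono (h.mono fun _ hω => ENNReal.ofReal_le_ofReal hω)

namespace CondIntegrable

theorem condLExp_ofReal_lt_top (hf : CondIntegrable P m f) :
    ∀ᵐ ω ∂P, P⁻[fun ω => ENNReal.ofReal (f ω) | m] ω < ⊤ := by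
  filter_upwards [hf.lt_top, condLExp_ofReal_mono (m := m) (ae_of_all P fun ω => le_abs_self (f ω))]
    with ω hω hle using hle.trans_lt hω

theorem mono (hg : CondIntegrable P m g) (hf : Measurable f) (h : ∀ᵐ ω ∂P, |f ω| ≤ |g ω|) :
    CondIntegrable P m f := by
  refine ⟨hf, ?_⟩
  filter_upwards [hg.lt_top, condLExp_ofReal_mono (m := m) h] with ω hω hle using hle.trans_lt hω

theorem neg (hf : CondIntegrable P m f) : CondIntegrable P m fun ω => -f ω :=
  ⟨hf.measurable.neg, by simpa only [abs_neg] using hf.lt_top⟩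

theorem abs (hf : CondIntegrable P m f) : CondIntegrable P m fun ω => |f ω| :=
  hf.mono hf.measurable.abs (ae_of_all _ fun ω => (abs_abs (f ω)).le)

theorem add (hf : CondIntegrable P m f) (hg : CondIntegrable P m g) :
    CondIntegrable P m fun ω => f ω + g ω := by
  refine ⟨hf.measurable.add hg.measurable, ?_⟩
  have habs : P⁻[fun ω => ENNReal.ofReal |f ω + g ω| | m] ≤ᵐ[P]
      P⁻[(fun ω => ENNReal.ofReal |f ω|) + fun ω => ENNReal.ofReal |g ω| | m] :=
    condLExp_mono (ae_of_all _ fun ω => (ENNReal.ofReal_le_ofReal (abs_add_le _ _)).trans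
      (ENNReal.ofReal_add (abs_nonneg _) (abs_nonneg _)).le)
  filter_upwards [hf.lt_top, hg.lt_top, habs, condLExp_add_left (mΩ := m)
    (fun ω => ENNReal.ofReal |g ω|) hf.abs.measurable.ennreal_ofReal.aemeasurable]
    with ω hω₁ hω₂ hle hadd
  rw [hadd] at hle
  exact hle.trans_lt (ENNReal.add_lt_top.2 ⟨hω₁, hω₂⟩)

theorem of_measurable (hm : m ≤ mΩ) [SigmaFinite (P.trim hm)] (hf : Measurable[m] f) :
    CondIntegrable P m f := by
  refine ⟨hf.mono hm le_rfl, ?_⟩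
  rw [condLExp_eq_self hm P (by fun_prop)]
  exact ae_of_all _ fun ω => ENNReal.ofReal_lt_top

theorem sum (hm : m ≤ mΩ) [SigmaFinite (P.trim hm)] {ι : Type*} (s : Finset ι) {f : ι → Ω → ℝ}
    (hf : ∀ i ∈ s, CondIntegrable P m (f i)) : CondIntegrable P m fun ω => ∑ i ∈ s, f i ω := by
  induction s using Finset.cons_induction with
  | empty => simpa only [Finset.sum_empty] using of_measurable hm measurable_const
  | cons i s hi ih =>
    simp only [Finset.sum_cons]
    exact (hf i (Finset.mem_cons_self i s)).add
      (ih fun j hj => hf j (Finset.mem_cons_of_mem hj))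

theorem sub (hf : CondIntegrable P m f) (hg : CondIntegrable P m g) :
    CondIntegrable P m fun ω => f ω - g ω := by
  simpa only [sub_eq_add_neg] using hf.add hg.neg

theorem mul_left (hm : m ≤ mΩ) [SigmaFinite (P.trim hm)] {r : Ω → ℝ} (hr : Measurable[m] r)
    (hf : CondIntegrable P m f) : CondIntegrable P m fun ω => r ω * f ω := by
  refine ⟨(hr.mono hm le_rfl).mul hf.measurable, ?_⟩
  simp only [abs_mul, ENNReal.ofReal_mul (abs_nonneg _)]
  filter_upwards [hf.lt_top, condLExp_mul_left (P := P) hm (r := fun ω => ENNReal.ofReal |r ω|)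
    (by fun_prop) hf.abs.measurable.ennreal_ofReal] with ω hω hmul
  rw [hmul]
  exact ENNReal.mul_lt_top ENNReal.ofReal_lt_top hω

theorem of_le_of_le {a b : Ω → ℝ} (hf : Measurable f) (ha : CondIntegrable P m a)
    (hb : CondIntegrable P m b) (haf : ∀ᵐ ω ∂P, a ω ≤ f ω) (hfb : ∀ᵐ ω ∂P, f ω ≤ b ω) :
    CondIntegrable P m f := by
  refine (ha.abs.add hb.abs).mono hf ?_
  filter_upwards [haf, hfb] with ω ha hb
  rw [abs_of_nonneg (add_nonneg (abs_nonneg _) (abs_nonneg (b ω)))]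
  exact abs_le.2 ⟨by linarith [neg_abs_le (a ω), abs_nonneg (b ω)],
    by linarith [le_abs_self (b ω), abs_nonneg (a ω)]⟩

theorem of_condLExp_lt_top (hf : Measurable f)
    (hpos : ∀ᵐ ω ∂P, P⁻[fun ω => ENNReal.ofReal (f ω) | m] ω < ⊤)
    (hneg : ∀ᵐ ω ∂P, P⁻[fun ω => ENNReal.ofReal (-f ω) | m] ω < ⊤) : CondIntegrable P m f := by
  refine ⟨hf, ?_⟩
  have habs : (fun ω => ENNReal.ofReal |f ω|) =
      (fun ω => ENNReal.ofReal (f ω)) + fun ω => ENNReal.ofReal (-f ω) := by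
    ext ω
    rcases le_total 0 (f ω) with h | h
    · simp [abs_of_nonneg h, ENNReal.ofReal_of_nonpos (neg_nonpos.2 h)]
    · simp [abs_of_nonpos h, ENNReal.ofReal_of_nonpos h]
  rw [habs]
  filter_upwards [hpos, hneg, condLExp_add_left (mΩ := m) (fun ω => ENNReal.ofReal (-f ω))
    hf.ennreal_ofReal.aemeasurable] with ω hω₁ hω₂ hadd
  rw [hadd]
  exact ENNReal.add_lt_top.2 ⟨hω₁, hω₂⟩

end CondIntegrable

theorem ofReal_toReal_sub_toReal_add {a b : ℝ≥0∞} (ha : a ≠ ⊤) (hb : b ≠ ⊤) :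
    ENNReal.ofReal (a.toReal - b.toReal) + b = ENNReal.ofReal (-(a.toReal - b.toReal)) + a := by
  rw [← ENNReal.toReal_eq_toReal_iff' (by finiteness) (by finiteness),
    ENNReal.toReal_add (by finiteness) hb, ENNReal.toReal_add (by finiteness) ha,
    ENNReal.toReal_ofReal', ENNReal.toReal_ofReal']
  linarith [max_zero_sub_max_neg_zero_eq_self (a.toReal - b.toReal)]

theorem condMean_toReal_sub_toReal {a b : Ω → ℝ≥0∞} (ha : Measurable a) (hb : Measurable b)
    (ha_top : ∀ ω, a ω ≠ ⊤) (hb_top : ∀ ω, b ω ≠ ⊤) (ha_lt : ∀ᵐ ω ∂P, P⁻[a | m] ω < ⊤)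
    (hb_lt : ∀ᵐ ω ∂P, P⁻[b | m] ω < ⊤) :
    condMean P m (fun ω => (a ω).toReal - (b ω).toReal) =ᵐ[P]
      fun ω => (P⁻[a | m] ω).toReal - (P⁻[b | m] ω).toReal := by
  set f : Ω → ℝ := fun ω => (a ω).toReal - (b ω).toReal
  have hf : Measurable f := ha.ennreal_toReal.sub hb.ennreal_toReal
  have hsum : (fun ω => ENNReal.ofReal (f ω)) + b = (fun ω => ENNReal.ofReal (-f ω)) + a :=
    funext fun ω => ofReal_toReal_sub_toReal_add (ha_top ω) (hb_top ω)
  have hpos_le : P⁻[fun ω => ENNReal.ofReal (f ω) | m] ≤ᵐ[P] P⁻[a | m] :=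
    condLExp_mono (ae_of_all _ fun ω =>
      ENNReal.ofReal_le_of_le_toReal (sub_le_self _ ENNReal.toReal_nonneg))
  have hneg_le : P⁻[fun ω => ENNReal.ofReal (-f ω) | m] ≤ᵐ[P] P⁻[b | m] :=
    condLExp_mono (ae_of_all _ fun ω => ENNReal.ofReal_le_of_le_toReal
      ((neg_sub _ _).trans_le (sub_le_self _ ENNReal.toReal_nonneg)))
  have hadd_b := condLExp_add_left (mΩ := m) (P := P) b hf.ennreal_ofReal.aemeasurable
  have hadd_a := condLExp_add_left (mΩ := m) (P := P) a hf.neg.ennreal_ofReal.aemeasurable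
  rw [hsum] at hadd_b
  filter_upwards [hpos_le, hneg_le, hadd_b, hadd_a, ha_lt, hb_lt] with ω hpos hneg hω₁ hω₂ ha hb
  have heq := congrArg ENNReal.toReal (hω₁.symm.trans hω₂)
  simp only [Pi.add_apply, Pi.neg_apply] at heq
  rw [ENNReal.toReal_add (hpos.trans_lt ha).ne hb.ne,
    ENNReal.toReal_add (hneg.trans_lt hb).ne ha.ne] at heq
  simp only [condMean]
  linarith

theorem condMean_add (hf : CondIntegrable P m f) (hg : CondIntegrable P m g) :
    condMean P m (fun ω => f ω + g ω) =ᵐ[P] fun ω => condMean P m f ω + condMean P m g ω := by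
  have hf_meas := hf.measurable
  have hg_meas := hg.measurable
  have hpos := condLExp_add_left (mΩ := m) (P := P) (X := fun ω => ENNReal.ofReal (f ω))
    (fun ω => ENNReal.ofReal (g ω)) (by fun_prop)
  have hneg := condLExp_add_left (mΩ := m) (P := P) (X := fun ω => ENNReal.ofReal (-f ω))
    (fun ω => ENNReal.ofReal (-g ω)) (by fun_prop)
  have hsplit : (fun ω => f ω + g ω) =
      fun ω => (((fun ω => ENNReal.ofReal (f ω)) + fun ω => ENNReal.ofReal (g ω)) ω).toReal -
        (((fun ω => ENNReal.ofReal (-f ω)) + fun ω => ENNReal.ofReal (-g ω)) ω).toReal := by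
    ext ω
    simp only [Pi.add_apply, ENNReal.toReal_add ENNReal.ofReal_ne_top ENNReal.ofReal_ne_top,
      ENNReal.toReal_ofReal']
    linarith [max_zero_sub_max_neg_zero_eq_self (f ω), max_zero_sub_max_neg_zero_eq_self (g ω)]
  have hmean := condMean_toReal_sub_toReal (P := P) (m := m)
    (a := (fun ω => ENNReal.ofReal (f ω)) + fun ω => ENNReal.ofReal (g ω))
    (b := (fun ω => ENNReal.ofReal (-f ω)) + fun ω => ENNReal.ofReal (-g ω))
    (by fun_prop) (by fun_prop) (fun _ => by simp)
    (fun _ => by simp)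
    (by filter_upwards [hpos, hf.condLExp_ofReal_lt_top, hg.condLExp_ofReal_lt_top]
          with ω hω hf hg using hω ▸ ENNReal.add_lt_top.2 ⟨hf, hg⟩)
    (by filter_upwards [hneg, hf.neg.condLExp_ofReal_lt_top, hg.neg.condLExp_ofReal_lt_top]
          with ω hω hf hg using hω ▸ ENNReal.add_lt_top.2 ⟨hf, hg⟩)
  rw [← hsplit] at hmean
  filter_upwards [hmean, hpos, hneg, hf.condLExp_ofReal_lt_top, hg.condLExp_ofReal_lt_top,
    hf.neg.condLExp_ofReal_lt_top, hg.neg.condLExp_ofReal_lt_top]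
    with ω hω hpos hneg hf_pos hg_pos hf_neg hg_neg
  rw [hω, hpos, hneg, Pi.add_apply, Pi.add_apply, ENNReal.toReal_add hf_pos.ne hg_pos.ne,
    ENNReal.toReal_add hf_neg.ne hg_neg.ne, condMean, condMean]
  ring

theorem condMean_sub (hf : CondIntegrable P m f) (hg : CondIntegrable P m g) :
    condMean P m (fun ω => f ω - g ω) =ᵐ[P] fun ω => condMean P m f ω - condMean P m g ω := by
  filter_upwards [condMean_add hf hg.neg] with ω hω
  simpa only [sub_eq_add_neg, condMean_neg] using hω

theorem condMean_mul_left_of_nonneg (hm : m ≤ mΩ) [SigmaFinite (P.trim hm)] {r : Ω → ℝ}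
    (hr : Measurable[m] r) (hr_nonneg : ∀ ω, 0 ≤ r ω) (hf : Measurable f) :
    condMean P m (fun ω => r ω * f ω) =ᵐ[P] fun ω => r ω * condMean P m f ω := by
  have hpull : ∀ g : Ω → ℝ, Measurable g → ∀ᵐ ω ∂P,
      (P⁻[fun ω => ENNReal.ofReal (r ω * g ω) | m] ω).toReal =
        r ω * (P⁻[fun ω => ENNReal.ofReal (g ω) | m] ω).toReal := by
    intro g hg
    simp only [ENNReal.ofReal_mul (hr_nonneg _)]
    filter_upwards [condLExp_mul_left (P := P) hm hr.ennreal_ofReal hg.ennreal_ofReal] with ω hω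
    rw [hω, ENNReal.toReal_mul, ENNReal.toReal_ofReal (hr_nonneg ω)]
  filter_upwards [hpull f hf, hpull _ hf.neg] with ω hpos hneg
  simp only [Pi.neg_apply] at hneg
  simp only [condMean, ← mul_neg, hpos, hneg, mul_sub]

theorem condMean_mul_left (hm : m ≤ mΩ) [SigmaFinite (P.trim hm)] {r : Ω → ℝ}
    (hr : Measurable[m] r) (hf : CondIntegrable P m f) :
    condMean P m (fun ω => r ω * f ω) =ᵐ[P] fun ω => r ω * condMean P m f ω := by
  have hpos_meas : Measurable[m] fun ω => max (r ω) 0 := hr.max measurable_const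
  have hneg_meas : Measurable[m] fun ω => max (-r ω) 0 := hr.neg.max measurable_const
  have hsplit : (fun ω => r ω * f ω) = fun ω => max (r ω) 0 * f ω - max (-r ω) 0 * f ω := by
    ext ω
    rw [← sub_mul, max_zero_sub_max_neg_zero_eq_self]
  rw [hsplit]
  filter_upwards [condMean_sub (hf.mul_left hm hpos_meas) (hf.mul_left hm hneg_meas),
    condMean_mul_left_of_nonneg hm hpos_meas (fun _ => le_max_right _ _) hf.measurable,
    condMean_mul_left_of_nonneg hm hneg_meas (fun _ => le_max_right _ _) hf.measurable]
    with ω hsub hpos hneg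
  rw [hsub, hpos, hneg, ← sub_mul, max_zero_sub_max_neg_zero_eq_self]

theorem condMean_mono (hf : CondIntegrable P m f) (hg : CondIntegrable P m g)
    (h : ∀ᵐ ω ∂P, f ω ≤ g ω) : ∀ᵐ ω ∂P, condMean P m f ω ≤ condMean P m g ω := by
  filter_upwards [condLExp_ofReal_mono (m := m) h,
    condLExp_ofReal_mono (m := m) (h.mono fun _ => neg_le_neg),
    hg.condLExp_ofReal_lt_top, hf.neg.condLExp_ofReal_lt_top] with ω hpos hneg hg hf
  exact sub_le_sub (ENNReal.toReal_mono hg.ne hpos) (ENNReal.toReal_mono hf.ne hneg)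

theorem condMean_mono_on (hm : m ≤ mΩ) [SigmaFinite (P.trim hm)] (hf : CondIntegrable P m f)
    (hg : CondIntegrable P m g) {A : Set Ω} (hA : MeasurableSet[m] A)
    (h : ∀ᵐ ω ∂P, ω ∈ A → f ω ≤ g ω) :
    ∀ᵐ ω ∂P, ω ∈ A → condMean P m f ω ≤ condMean P m g ω := by
  have hr : Measurable[m] (A.indicator fun _ => (1 : ℝ)) := measurable_const.indicator hA
  have hle : ∀ᵐ ω ∂P, A.indicator (fun _ => (1 : ℝ)) ω * f ω ≤
      A.indicator (fun _ => (1 : ℝ)) ω * g ω := by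
    filter_upwards [h] with ω h
    by_cases hω : ω ∈ A
    · simpa [hω] using h hω
    · simp [hω]
  filter_upwards [condMean_mul_left hm hr hf, condMean_mul_left hm hr hg,
    condMean_mono (hf.mul_left hm hr) (hg.mul_left hm hr) hle] with ω hω₁ hω₂ hω₃ hω
  rw [hω₁, hω₂] at hω₃
  simpa [hω] using hω₃

theorem condMean_congr_on (hm : m ≤ mΩ) [SigmaFinite (P.trim hm)] (hf : CondIntegrable P m f)
    (hg : CondIntegrable P m g) {A : Set Ω} (hA : MeasurableSet[m] A)
    (h : ∀ᵐ ω ∂P, ω ∈ A → f ω = g ω) :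
    ∀ᵐ ω ∂P, ω ∈ A → condMean P m f ω = condMean P m g ω := by
  filter_upwards [condMean_mono_on hm hf hg hA (h.mono fun ω h hω => (h hω).le),
    condMean_mono_on hm hg hf hA (h.mono fun ω h hω => (h hω).ge)] with ω hle hge hω
  exact le_antisymm (hle hω) (hge hω)

theorem condLExp_ofReal_eq_ofReal_condMean (hf : CondIntegrable P m f)
    (h : ∀ᵐ ω ∂P, 0 ≤ f ω) :
    P⁻[fun ω => ENNReal.ofReal (f ω) | m] =ᵐ[P] fun ω => ENNReal.ofReal (condMean P m f ω) := by
  have hzero : (fun ω => ENNReal.ofReal (-f ω)) =ᵐ[P] 0 := by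
    filter_upwards [h] with ω hω using ENNReal.ofReal_of_nonpos (neg_nonpos.2 hω)
  have hneg : P⁻[fun ω => ENNReal.ofReal (-f ω) | m] =ᵐ[P] 0 := by
    simpa only [condLExp_zero] using condLExp_congr_ae (mΩ := m) hzero
  filter_upwards [hneg, hf.condLExp_ofReal_lt_top] with ω hneg hpos
  simp [condMean, hneg, hpos.ne]

theorem genCondExp_eq_condMean (hf : CondIntegrable P m f) :
    ∀ᵐ ω ∂P, genCondExp P m f ω = (condMean P m f ω : EReal) := by
  filter_upwards [hf.condLExp_ofReal_lt_top, hf.neg.condLExp_ofReal_lt_top] with ω hpos hneg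
  rw [genCondExp, condMean, EReal.coe_sub, EReal.coe_ennreal_toReal hpos.ne,
    EReal.coe_ennreal_toReal hneg.ne]

end CondMean

/-! ### One-period problems -/

section OnePeriod

open Filter Topology
open scoped ENNReal

variable {Ω : Type*} {m mΩ : MeasurableSpace Ω} {P : Measure Ω} {d : ℕ}
  {Y : Ω → EuclideanSpace ℝ (Fin d)} {L : ℝ → ℝ} {p q C : ℝ} {V : ℝ → Ω → ℝ}

theorem continuous_of_concaveOn_univ {f : ℝ → ℝ} (hf : ConcaveOn ℝ Set.univ f) : Continuous f :=
  continuousOn_univ.1 (hf.continuousOn isOpen_univ)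

theorem measurable_eval {m : MeasurableSpace Ω} (hV : ∀ x, Measurable[m] (V x))
    (hc : ∀ ω, Continuous fun x => V x ω) {Z : Ω → ℝ} (hZ : Measurable[m] Z) :
    Measurable[m] fun ω => V (Z ω) ω :=
  (measurable_uncurry_of_continuous_of_measurable (u := V) hc hV).comp (hZ.prodMk measurable_id)

/-- An `m`-measurable random utility function: its paths are nondecreasing and concave, it is
bounded from below by the deterministic function `L`, it tends to `-∞` at `-∞`, and for `λ ≥ 1` it
satisfies both `V(λx) ≤ λ^p (V(x) + C)` and `V(λx) ≤ λ^q (V(x) + C)`. With `p < q`, the two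
powers express at once that gains grow more slowly than losses, whether this comes from the
behaviour of the utility at `+∞` (`p = γ`, `q = 1`) or at `-∞` (`p = 1`, `q = 1 + α`). -/
structure RandomUtility {mΩ : MeasurableSpace Ω} (P : Measure[mΩ] Ω) (m : MeasurableSpace Ω)
    (L : ℝ → ℝ) (p q C : ℝ) (V : ℝ → Ω → ℝ) : Prop where
  measurable : ∀ x, Measurable[m] (V x)
  mono : ∀ ω, Monotone fun x => V x ω
  concave : ∀ ω, ConcaveOn ℝ Set.univ fun x => V x ω
  lower : ∀ᵐ ω ∂P, ∀ x, L x ≤ V x ω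
  growth : ∀ᵐ ω ∂P, ∀ x l : ℝ, 1 ≤ l →
    V (l * x) ω ≤ l ^ p * (V x ω + C) ∧ V (l * x) ω ≤ l ^ q * (V x ω + C)
  tendsto_atBot : ∀ᵐ ω ∂P, Tendsto (fun n : ℕ => V (-n) ω) atTop atBot

namespace RandomUtility

theorem continuous (h : RandomUtility P m L p q C V) (ω : Ω) : Continuous fun x => V x ω :=
  continuous_of_concaveOn_univ (h.concave ω)

theorem measurable_eval (h : RandomUtility P m L p q C V) {Z : Ω → ℝ} (hZ : Measurable[m] Z) :
    Measurable[m] fun ω => V (Z ω) ω :=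
  UtilityMax.measurable_eval h.measurable h.continuous hZ

end RandomUtility

/-- The payoff `V(X + ⟨ξ, Y⟩)` of the position `ξ`, held with initial capital `X` in a market with
price increment `Y`. -/
noncomputable def payoff (V : ℝ → Ω → ℝ) (Y : Ω → EuclideanSpace ℝ (Fin d)) (X : Ω → ℝ)
    (ξ : Ω → EuclideanSpace ℝ (Fin d)) (ω : Ω) : ℝ :=
  V (X ω + inner ℝ (ξ ω) (Y ω)) ω

/-- A one-period optimization problem: an arbitrage-free market with price increment `Y` over the
`σ`-algebra `m` of information, and a random utility `V` of terminal wealth for which unit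
capital and a constant position yield a conditionally finite positive part. -/
structure OnePeriod {mΩ : MeasurableSpace Ω} (P : Measure[mΩ] Ω) (m : MeasurableSpace Ω)
    (Y : Ω → EuclideanSpace ℝ (Fin d)) (L : ℝ → ℝ) (p q C : ℝ) (V : ℝ → Ω → ℝ) : Prop where
  le : m ≤ mΩ
  measurable_increment : Measurable[mΩ] Y
  noArbitrage : ∀ ξ : Ω → EuclideanSpace ℝ (Fin d), Measurable[m] ξ →
    (∀ᵐ ω ∂P, 0 ≤ inner ℝ (ξ ω) (Y ω)) → ∀ᵐ ω ∂P, inner ℝ (ξ ω) (Y ω) = 0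
  continuous_lower : Continuous L
  p_pos : 0 < p
  p_lt_q : p < q
  utility : RandomUtility P mΩ L p q C V
  lt_top : ∀ y : EuclideanSpace ℝ (Fin d),
    ∀ᵐ ω ∂P, P⁻[fun ω => ENNReal.ofReal (V (1 + inner ℝ y (Y ω)) ω) | m] ω < ⊤

/-- The vector with coordinates `±1` according to `s`: a vertex of the cube `[-1, 1]^d`. -/
noncomputable def signVec (s : Fin d → Bool) : EuclideanSpace ℝ (Fin d) :=
  WithLp.toLp 2 fun i => if s i then 1 else -1

theorem exists_norm_le_inner_signVec (y : EuclideanSpace ℝ (Fin d)) :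
    ∃ s, ‖y‖ ≤ inner ℝ (signVec s) y := by
  refine ⟨fun i => decide (0 ≤ y i), ?_⟩
  have hinner : inner ℝ (signVec fun i => decide (0 ≤ y i)) y = ∑ i, |y i| := by
    simp only [PiLp.inner_apply, signVec]
    refine Finset.sum_congr rfl fun i _ => ?_
    by_cases h : 0 ≤ y i
    · simp [h, abs_of_nonneg h]
    · simp [h, abs_of_neg (not_le.1 h)]
  rw [hinner, EuclideanSpace.norm_eq]
  refine Real.sqrt_le_iff.2 ⟨Finset.sum_nonneg fun i _ => abs_nonneg _, ?_⟩
  simp only [Real.norm_eq_abs]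
  exact Finset.sum_sq_le_sq_sum_of_nonneg fun i _ => abs_nonneg _

/-- A random variable that dominates, up to a power of the size of capital and position, the payoff
of every position: the payoffs at the vertices of the cube are enough. -/
noncomputable def dominant (V : ℝ → Ω → ℝ) (Y : Ω → EuclideanSpace ℝ (Fin d)) (C : ℝ) (ω : Ω) :
    ℝ :=
  ∑ s : Fin d → Bool, max (V (1 + inner ℝ (signVec s) (Y ω)) ω) 0 + C

namespace OnePeriod

theorem measurable_payoff (h : OnePeriod P m Y L p q C V) {X : Ω → ℝ}
    {ξ : Ω → EuclideanSpace ℝ (Fin d)} (hX : Measurable X) (hξ : Measurable ξ) :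
    Measurable (payoff V Y X ξ) :=
  h.utility.measurable_eval (hX.add (hξ.inner h.measurable_increment))

theorem payoff_le_dominant (h : OnePeriod P m Y L p q C V) :
    ∀ᵐ ω ∂P, ∀ (r x : ℝ) (y : EuclideanSpace ℝ (Fin d)), 1 ≤ r → x ≤ r → ‖y‖ ≤ r →
      V (x + inner ℝ y (Y ω)) ω ≤ r ^ p * dominant V Y C ω := by
  filter_upwards [h.utility.growth] with ω hω r x y hr hx hy
  obtain ⟨s, hs⟩ := exists_norm_le_inner_signVec (Y ω)
  have hwealth : x + inner ℝ y (Y ω) ≤ r * (1 + inner ℝ (signVec s) (Y ω)) := by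
    calc x + inner ℝ y (Y ω) ≤ r + r * ‖Y ω‖ := by
          gcongr
          exact (real_inner_le_norm _ _).trans (by gcongr)
      _ ≤ r + r * inner ℝ (signVec s) (Y ω) := by gcongr
      _ = r * (1 + inner ℝ (signVec s) (Y ω)) := by ring
  have hvertex : V (1 + inner ℝ (signVec s) (Y ω)) ω ≤
      ∑ s : Fin d → Bool, max (V (1 + inner ℝ (signVec s) (Y ω)) ω) 0 :=
    (le_max_left _ 0).trans (Finset.single_le_sum
      (f := fun s => max (V (1 + inner ℝ (signVec s) (Y ω)) ω) 0)
      (fun _ _ => le_max_right _ _) (Finset.mem_univ s))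
  calc V (x + inner ℝ y (Y ω)) ω ≤ V (r * (1 + inner ℝ (signVec s) (Y ω))) ω :=
        h.utility.mono ω hwealth
    _ ≤ r ^ p * (V (1 + inner ℝ (signVec s) (Y ω)) ω + C) := (hω _ r hr).1
    _ ≤ r ^ p * dominant V Y C ω := by unfold dominant; gcongr

variable [IsFiniteMeasure P]

theorem condIntegrable_dominant (h : OnePeriod P m Y L p q C V) :
    CondIntegrable P m (dominant V Y C) := by
  refine (CondIntegrable.sum h.le _ fun s _ => ?_).add
    (CondIntegrable.of_measurable h.le measurable_const)
  have hmeas : Measurable fun ω => V (1 + inner ℝ (signVec s) (Y ω)) ω :=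
    h.measurable_payoff measurable_const measurable_const
  have hpos (x : ℝ) : ENNReal.ofReal |max x 0| = ENNReal.ofReal x := by
    rw [abs_of_nonneg (le_max_right x 0), ENNReal.ofReal_max, ENNReal.ofReal_zero, max_comm,
      zero_max]
  refine ⟨hmeas.max measurable_const, ?_⟩
  simpa only [hpos] using h.lt_top (signVec s)

theorem condIntegrable_payoff (h : OnePeriod P m Y L p q C V) {X : Ω → ℝ}
    {ξ : Ω → EuclideanSpace ℝ (Fin d)} (hX : Measurable[m] X) (hξ : Measurable[m] ξ)
    {b : Ω → ℝ} (hb : CondIntegrable P m b) (hle : ∀ᵐ ω ∂P, b ω ≤ payoff V Y X ξ ω) :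
    CondIntegrable P m (payoff V Y X ξ) := by
  have hsize : Measurable[m] fun ω => (1 + |X ω| + ‖ξ ω‖) ^ p := by fun_prop
  refine CondIntegrable.of_le_of_le
    (h.measurable_payoff (hX.mono h.le le_rfl) (hξ.mono h.le le_rfl)) hb
    (h.condIntegrable_dominant.mul_left h.le hsize) hle ?_
  filter_upwards [h.payoff_le_dominant] with ω hω
  refine hω _ _ _ ?_ ?_ ?_ <;>
    linarith [abs_nonneg (X ω), le_abs_self (X ω), norm_nonneg (ξ ω)]

theorem condIntegrable_payoff_zero (h : OnePeriod P m Y L p q C V) {X : Ω → ℝ}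
    (hX : Measurable[m] X) : CondIntegrable P m (payoff V Y X 0) := by
  refine h.condIntegrable_payoff hX measurable_const
    (CondIntegrable.of_measurable h.le (h.continuous_lower.measurable.comp hX)) ?_
  filter_upwards [h.utility.lower] with ω hω
  simpa [payoff] using hω (X ω)

end OnePeriod

end OnePeriod

/-! ### Measurable selection -/

section Selection

open Filter Topology
open scoped ENNReal

variable {Ω : Type*}

theorem measurable_eval_nat {_ : MeasurableSpace Ω} {β : Type*} [MeasurableSpace β]
    {u : ℕ → Ω → β} (hu : ∀ n, Measurable (u n)) {τ : Ω → ℕ} (hτ : Measurable τ) :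
    Measurable fun ω => u (τ ω) ω :=
  (measurable_from_prod_countable_right (f := fun z : ℕ × Ω => u z.1 z.2) hu).comp
    (hτ.prodMk measurable_id)

theorem frequently_abs_sub_liminf_lt {u : ℕ → ℝ} {K : ℝ} (hK : ∀ n, |u n| ≤ K) {ε : ℝ}
    (hε : 0 < ε) : ∃ᶠ n in atTop, |u n - liminf u atTop| < ε := by
  have hbelow : IsBoundedUnder (· ≥ ·) atTop u :=
    isBoundedUnder_of ⟨-K, fun n => (abs_le.1 (hK n)).1⟩
  have habove : IsCoboundedUnder (· ≥ ·) atTop u :=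
    IsBoundedUnder.isCoboundedUnder_ge (isBoundedUnder_of ⟨K, fun n => (abs_le.1 (hK n)).2⟩)
  exact (MapClusterPt.liminf habove hbelow).frequently (Metric.ball_mem_nhds _ hε)

theorem exists_measurable_subseq_real {m : MeasurableSpace Ω} {u : ℕ → Ω → ℝ}
    (hu : ∀ n, Measurable (u n)) (hb : ∀ ω, ∃ K, ∀ n, |u n ω| ≤ K) :
    ∃ τ : ℕ → Ω → ℕ, (∀ k, Measurable (τ k)) ∧ (∀ k ω, k ≤ τ k ω) ∧
      ∀ ω, ∃ l, Tendsto (fun k => u (τ k ω) ω) atTop (𝓝 l) := by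
  classical
  let l : Ω → ℝ := fun ω => liminf (fun n => u n ω) atTop
  have hl : Measurable l := Measurable.liminf hu
  have hex (k : ℕ) (ω : Ω) : ∃ n, k ≤ n ∧ |u n ω - l ω| < 1 / ((k : ℝ) + 1) := by
    obtain ⟨K, hK⟩ := hb ω
    exact frequently_atTop.1 (frequently_abs_sub_liminf_lt hK Nat.one_div_pos_of_nat) k
  refine ⟨fun k ω => Nat.find (hex k ω), fun k => measurable_find _ fun n => ?_,
    fun k ω => (Nat.find_spec (hex k ω)).1, fun ω => ⟨l ω, ?_⟩⟩
  · exact (MeasurableSet.const _).inter (measurableSet_lt ((hu n).sub hl).abs measurable_const)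
  · refine tendsto_iff_dist_tendsto_zero.2 (squeeze_zero (fun _ => dist_nonneg) (fun k => ?_)
      tendsto_one_div_add_atTop_nhds_zero_nat)
    exact (Real.dist_eq _ _).trans_le (Nat.find_spec (hex k ω)).2.le

theorem exists_measurable_subseq_pi {m : MeasurableSpace Ω} {ι : Type*}
    {u : ℕ → Ω → ι → ℝ} (hu : ∀ n i, Measurable fun ω => u n ω i)
    (hb : ∀ ω i, ∃ K, ∀ n, |u n ω i| ≤ K) (s : Finset ι) :
    ∃ τ : ℕ → Ω → ℕ, (∀ k, Measurable (τ k)) ∧ (∀ k ω, k ≤ τ k ω) ∧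
      ∀ i ∈ s, ∀ ω, ∃ l, Tendsto (fun k => u (τ k ω) ω i) atTop (𝓝 l) := by
  classical
  induction s using Finset.induction_on with
  | empty => exact ⟨fun k _ => k, fun k => measurable_const, fun _ _ => le_rfl, by simp⟩
  | insert i s _ ih =>
    obtain ⟨τ, hτ, hkτ, hτs⟩ := ih
    obtain ⟨σ, hσ, hkσ, hσi⟩ := exists_measurable_subseq_real (u := fun k ω => u (τ k ω) ω i)
      (fun k => measurable_eval_nat (fun n => hu n i) (hτ k))
      (fun ω => (hb ω i).imp fun _ hK n => hK _)
    refine ⟨fun k ω => τ (σ k ω) ω, fun k => measurable_eval_nat hτ (hσ k),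
      fun k ω => (hkσ k ω).trans (hkτ _ ω), fun j hj ω => ?_⟩
    rcases Finset.mem_insert.1 hj with rfl | hj
    · exact hσi ω
    · obtain ⟨l, hl⟩ := hτs j hj ω
      exact ⟨l, hl.comp (tendsto_atTop_mono (fun k => hkσ k ω) tendsto_id)⟩

/-- A measurable version of the Bolzano-Weierstrass theorem: the subsequence depends on `ω`. -/
theorem exists_measurable_subseq {m : MeasurableSpace Ω} {d : ℕ} {X : ℕ → Ω → ℝ}
    {ξ : ℕ → Ω → EuclideanSpace ℝ (Fin d)} (hX : ∀ n, Measurable (X n))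
    (hξ : ∀ n, Measurable (ξ n)) (hb : ∀ ω, ∃ K, ∀ n, |X n ω| ≤ K ∧ ‖ξ n ω‖ ≤ K) :
    ∃ (τ : ℕ → Ω → ℕ) (x : Ω → ℝ) (η : Ω → EuclideanSpace ℝ (Fin d)),
      (∀ k, Measurable (τ k)) ∧ (∀ k ω, k ≤ τ k ω) ∧ Measurable x ∧ Measurable η ∧
      (∀ ω, Tendsto (fun k => X (τ k ω) ω) atTop (𝓝 (x ω))) ∧
      ∀ ω, Tendsto (fun k => ξ (τ k ω) ω) atTop (𝓝 (η ω)) := by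
  let u : ℕ → Ω → Option (Fin d) → ℝ := fun n ω i => i.elim (X n ω) (ξ n ω)
  have hu : ∀ n i, Measurable fun ω => u n ω i := by
    rintro n (_ | j)
    · exact hX n
    · exact (EuclideanSpace.proj (𝕜 := ℝ) j).continuous.measurable.comp (hξ n)
  have hu_bdd : ∀ ω i, ∃ K, ∀ n, |u n ω i| ≤ K := by
    rintro ω (_ | j) <;> obtain ⟨K, hK⟩ := hb ω
    · exact ⟨K, fun n => (hK n).1⟩
    · exact ⟨K, fun n => (PiLp.norm_apply_le (ξ n ω) j).trans (hK n).2⟩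
  obtain ⟨τ, hτ, hkτ, hlim⟩ := exists_measurable_subseq_pi hu hu_bdd Finset.univ
  choose l hl using fun i => hlim i (Finset.mem_univ i)
  have hη (ω : Ω) : Tendsto (fun k => ξ (τ k ω) ω) atTop
      (𝓝 (WithLp.toLp 2 fun j => l (some j) ω)) :=
    ((PiLp.continuous_toLp 2 _).tendsto _).comp (tendsto_pi_nhds.2 fun j => hl (some j) ω)
  refine ⟨τ, l none, fun ω => WithLp.toLp 2 fun j => l (some j) ω, hτ, hkτ, ?_, ?_, hl none, hη⟩
  · exact measurable_of_tendsto_metrizable (fun k => measurable_eval_nat hX (hτ k))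
      (tendsto_pi_nhds.2 (hl none))
  · exact measurable_of_tendsto_metrizable (fun k => measurable_eval_nat hξ (hτ k))
      (tendsto_pi_nhds.2 hη)

end Selection

/-! ### Positions without gain -/

section NullPositions

open Filter Topology
open scoped ENNReal

/-- The vector `y` scaled into the unit ball. -/
noncomputable def shrink {E : Type*} [NormedAddCommGroup E] [NormedSpace ℝ E] (y : E) : E :=
  (1 + ‖y‖)⁻¹ • y

theorem norm_shrink_le_one {E : Type*} [NormedAddCommGroup E] [NormedSpace ℝ E] (y : E) :
    ‖shrink y‖ ≤ 1 := by
  have hpos : 0 < 1 + ‖y‖ := by positivity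
  rw [shrink, norm_smul, norm_inv, Real.norm_of_nonneg hpos.le, inv_mul_le_one₀ hpos]
  linarith

variable {Ω : Type*} {m mΩ : MeasurableSpace Ω} {P : Measure Ω} {d : ℕ}
  {Y ξ ν : Ω → EuclideanSpace ℝ (Fin d)}

/-- The square-integrable `m`-measurable positions without gain, as a subspace of `L²`. -/
def nullPositions (P : Measure Ω) (hm : m ≤ mΩ) (Y : Ω → EuclideanSpace ℝ (Fin d)) :
    Submodule ℝ (Lp (EuclideanSpace ℝ (Fin d)) 2 (P.trim hm)) where
  carrier := {f | ∀ᵐ ω ∂P, inner ℝ (f ω) (Y ω) = 0}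
  add_mem' {f g} hf hg := by
    filter_upwards [hf, hg, ae_of_ae_trim hm (Lp.coeFn_add f g)] with ω hfω hgω hadd
    rw [hadd, Pi.add_apply, inner_add_left, hfω, hgω, add_zero]
  zero_mem' := by
    filter_upwards [ae_of_ae_trim hm (Lp.coeFn_zero (EuclideanSpace ℝ (Fin d)) 2 (P.trim hm))]
      with ω hzero
    rw [hzero, Pi.zero_apply, inner_zero_left]
  smul_mem' c f hf := by
    filter_upwards [hf, ae_of_ae_trim hm (Lp.coeFn_smul c f)] with ω hfω hsmul
    rw [hsmul, Pi.smul_apply, inner_smul_left, hfω, mul_zero]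

theorem isClosed_nullPositions (hm : m ≤ mΩ) (Y : Ω → EuclideanSpace ℝ (Fin d)) :
    IsClosed (nullPositions P hm Y : Set (Lp (EuclideanSpace ℝ (Fin d)) 2 (P.trim hm))) := by
  refine IsSeqClosed.isClosed fun f g hf hfg => ?_
  obtain ⟨ns, -, hns⟩ := (tendstoInMeasure_of_tendsto_Lp hfg).exists_seq_tendsto_ae
  have hzero : ∀ᵐ ω ∂P, ∀ n, inner ℝ (f (ns n) ω) (Y ω) = 0 := ae_all_iff.2 fun n => hf (ns n)
  change ∀ᵐ ω ∂P, inner ℝ (g ω) (Y ω) = 0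
  filter_upwards [ae_of_ae_trim hm hns, hzero] with ω hlim hω
  refine tendsto_nhds_unique (hlim.inner tendsto_const_nhds) ?_
  simp only [hω, tendsto_const_nhds_iff]

variable [IsFiniteMeasure P]

theorem memLp_shrink (hm : m ≤ mΩ) (hξ : Measurable[m] ξ) :
    MemLp (fun ω => shrink (ξ ω)) 2 (P.trim hm) :=
  have := isFiniteMeasure_trim (μ := P) hm
  .of_bound (C := 1) (Measurable.aestronglyMeasurable (by unfold shrink; fun_prop))
    (ae_of_all _ fun ω => norm_shrink_le_one (ξ ω))

theorem ae_inner_eq_zero_of_mem_orthogonal (hm : m ≤ mΩ)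
    {g : Lp (EuclideanSpace ℝ (Fin d)) 2 (P.trim hm)} (hg : g ∈ (nullPositions P hm Y)ᗮ)
    (hν : Measurable[m] ν) (hνY : ∀ᵐ ω ∂P, inner ℝ (ν ω) (Y ω) = 0) :
    ∀ᵐ ω ∂P, inner ℝ (g ω) (ν ω) = 0 := by
  let s : Ω → ℝ := fun ω => inner ℝ (g ω) (ν ω)
  have hs : Measurable[m] s := (Lp.stronglyMeasurable g).measurable.inner hν
  have htest : MemLp (fun ω => shrink (s ω • ν ω)) 2 (P.trim hm) := memLp_shrink hm (hs.smul hν)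
  have hmem : htest.toLp ∈ nullPositions P hm Y := by
    change ∀ᵐ ω ∂P, _
    filter_upwards [hνY, ae_of_ae_trim hm htest.coeFn_toLp] with ω hω htestω
    rw [htestω, shrink, inner_smul_left, inner_smul_left, hω, mul_zero, mul_zero]
  have hinner : (fun ω => inner ℝ (g ω) (htest.toLp _ ω)) =ᵐ[P.trim hm]
      fun ω => (1 + ‖s ω • ν ω‖)⁻¹ * (s ω * s ω) := by
    filter_upwards [htest.coeFn_toLp] with ω htestω
    rw [htestω, shrink, inner_smul_right, inner_smul_right]
  have hintegral : ∫ ω, inner ℝ (g ω) (htest.toLp _ ω) ∂P.trim hm = 0 :=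
    (L2.inner_def g _).symm.trans ((Submodule.mem_orthogonal' _ _).1 hg _ hmem)
  have hnonneg : 0 ≤ᵐ[P.trim hm] fun ω => inner ℝ (g ω) (htest.toLp _ ω) :=
    EventuallyLE.trans (ae_of_all _ fun ω => mul_nonneg (by positivity) (mul_self_nonneg (s ω)))
      hinner.symm.le
  have hzero := (integral_eq_zero_iff_of_nonneg_ae hnonneg (L2.integrable_inner g _)).1 hintegral
  filter_upwards [ae_of_ae_trim hm (hinner.symm.trans hzero)] with ω hω
  have hinv : (1 + ‖s ω • ν ω‖)⁻¹ ≠ 0 := by positivity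
  exact mul_self_eq_zero.1 ((mul_eq_zero.1 hω).resolve_left hinv)

/-- `ξ` is almost surely orthogonal to every `m`-measurable position whose gain under the price
increment `Y` vanishes; such positions are unambiguous representatives of their gains. -/
def IsNullOrthogonal (P : Measure[mΩ] Ω) (m : MeasurableSpace Ω)
    (Y ξ : Ω → EuclideanSpace ℝ (Fin d)) : Prop :=
  ∀ ν : Ω → EuclideanSpace ℝ (Fin d), Measurable[m] ν →
    (∀ᵐ ω ∂P, inner ℝ (ν ω) (Y ω) = 0) → ∀ᵐ ω ∂P, inner ℝ (ξ ω) (ν ω) = 0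

theorem exists_orthogonal_position (hm : m ≤ mΩ) (hξ : Measurable[m] ξ) :
    ∃ ξ' : Ω → EuclideanSpace ℝ (Fin d), Measurable[m] ξ' ∧
      (∀ᵐ ω ∂P, inner ℝ (ξ' ω) (Y ω) = inner ℝ (ξ ω) (Y ω)) ∧
      IsNullOrthogonal P m Y ξ' := by
  let K := nullPositions P hm Y
  have : CompleteSpace K := (isClosed_nullPositions hm Y).completeSpace_coe
  let f := (memLp_shrink (P := P) hm hξ).toLp
  let g := f - K.starProjection f
  have hg : Measurable[m] g := (Lp.stronglyMeasurable g).measurable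
  have hproj : ∀ᵐ ω ∂P, inner ℝ (K.starProjection f ω) (Y ω) = 0 :=
    K.starProjection_apply_mem f
  refine ⟨fun ω => (1 + ‖ξ ω‖) • g ω, by fun_prop, ?_, fun ν hν hνY => ?_⟩
  · filter_upwards [hproj, ae_of_ae_trim hm (Lp.coeFn_sub f (K.starProjection f)),
      ae_of_ae_trim hm (memLp_shrink hm hξ).coeFn_toLp] with ω hprojω hgω hfω
    have hscale : (1 + ‖ξ ω‖) ≠ 0 := by positivity
    calc inner ℝ ((1 + ‖ξ ω‖) • g ω) (Y ω)
        = (1 + ‖ξ ω‖) * inner ℝ (shrink (ξ ω)) (Y ω) := by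
          rw [real_inner_smul_left, hgω, Pi.sub_apply, inner_sub_left, hprojω, sub_zero, hfω]
      _ = inner ℝ (ξ ω) (Y ω) := by
          rw [shrink, real_inner_smul_left, mul_inv_cancel_left₀ hscale]
  · filter_upwards [ae_inner_eq_zero_of_mem_orthogonal hm
      (K.sub_starProjection_mem_orthogonal f) hν hνY] with ω hω
    rw [real_inner_smul_left, hω, mul_zero]

end NullPositions

/-! ### Limits of positions -/

section Limits

open Filter Topology
open scoped ENNReal

variable {Ω : Type*} {m mΩ : MeasurableSpace Ω} {P : Measure Ω}

theorem CondIntegrable.piecewise {f g : Ω → ℝ} (hf : CondIntegrable P m f)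
    (hg : CondIntegrable P m g) {A : Set Ω} [∀ ω, Decidable (ω ∈ A)] (hA : MeasurableSet A) :
    CondIntegrable P m (A.piecewise f g) := by
  refine (hf.abs.add hg.abs).mono (hf.measurable.piecewise hA hg.measurable)
    (ae_of_all _ fun ω => le_abs.2 (Or.inl ?_))
  by_cases hω : ω ∈ A <;> simp [hω]

theorem condMean_piecewise (hm : m ≤ mΩ) [SigmaFinite (P.trim hm)] {f g : Ω → ℝ}
    (hf : CondIntegrable P m f) (hg : CondIntegrable P m g) {A : Set Ω}
    [∀ ω, Decidable (ω ∈ A)] (hA : MeasurableSet[m] A) :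
    condMean P m (A.piecewise f g) =ᵐ[P] A.piecewise (condMean P m f) (condMean P m g) := by
  have hfg := hf.piecewise hg (hm A hA)
  filter_upwards [
    condMean_congr_on hm hfg hf hA (ae_of_all _ fun ω hω => Set.piecewise_eq_of_mem A f g hω),
    condMean_congr_on hm hfg hg hA.compl
      (ae_of_all _ fun ω hω => Set.piecewise_eq_of_notMem A f g hω)] with ω hmem hnotMem
  by_cases hω : ω ∈ A
  · rw [hmem hω, Set.piecewise_eq_of_mem _ _ _ hω]
  · rw [hnotMem hω, Set.piecewise_eq_of_notMem _ _ _ hω]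

theorem CondIntegrable.random_index (hm : m ≤ mΩ) [SigmaFinite (P.trim hm)] {f : ℕ → Ω → ℝ}
    (hf : ∀ n, CondIntegrable P m (f n)) {τ : Ω → ℕ} (hτ : Measurable[m] τ) :
    CondIntegrable P m fun ω => f (τ ω) ω := by
  have hmeas : Measurable fun ω => f (τ ω) ω :=
    measurable_eval_nat (fun n => (hf n).measurable) (hτ.mono hm le_rfl)
  have hcongr (n : ℕ) := condLExp_congr_on hm hmeas.abs.ennreal_ofReal
    (hf n).measurable.abs.ennreal_ofReal (hτ (measurableSet_singleton n))
    (ae_of_all P fun ω (hω : τ ω = n) => by rw [hω])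
  refine ⟨hmeas, ?_⟩
  filter_upwards [ae_all_iff.2 hcongr, ae_all_iff.2 fun n => (hf n).lt_top] with ω heq hfin
  exact (heq (τ ω) rfl).trans_lt (hfin (τ ω))

theorem condMean_random_index (hm : m ≤ mΩ) [SigmaFinite (P.trim hm)] {f : ℕ → Ω → ℝ}
    (hf : ∀ n, CondIntegrable P m (f n)) {τ : Ω → ℕ} (hτ : Measurable[m] τ) :
    ∀ᵐ ω ∂P, condMean P m (fun ω => f (τ ω) ω) ω = condMean P m (f (τ ω)) ω := by
  have hcongr (n : ℕ) := condMean_congr_on hm (CondIntegrable.random_index hm hf hτ) (hf n)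
    (hτ (measurableSet_singleton n)) (ae_of_all P fun ω (hω : τ ω = n) => by rw [hω])
  filter_upwards [ae_all_iff.2 hcongr] with ω heq
  exact heq (τ ω) rfl

theorem condLExp_liminf_ofReal_sub_le (hm : m ≤ mΩ) [SigmaFinite (P.trim hm)] {f : ℕ → Ω → ℝ}
    {G c : Ω → ℝ} (hf : ∀ n, CondIntegrable P m (f n)) (hG : CondIntegrable P m G)
    (hc : Measurable[m] c) (hle : ∀ n, f n ≤ᵐ[P] G)
    (hcf : ∀ᶠ n in atTop, c ≤ᵐ[P] condMean P m (f n)) :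
    P⁻[fun ω => liminf (fun n => ENNReal.ofReal (G ω - f n ω)) atTop | m] ≤ᵐ[P]
      fun ω => ENNReal.ofReal (condMean P m G ω - c ω) := by
  refine condLExp_liminf_le hm (fun n => (hG.measurable.sub (hf n).measurable).ennreal_ofReal)
    ((measurable_condMean P m G).sub hc).ennreal_ofReal ?_
  filter_upwards [hcf] with n hn
  filter_upwards [condLExp_ofReal_eq_ofReal_condMean (hG.sub (hf n))
    ((hle n).mono fun ω => sub_nonneg.2), condMean_sub hG (hf n), hn] with ω hexp hsub hω
  rw [hexp, hsub]
  exact ENNReal.ofReal_le_ofReal (sub_le_sub_left hω _)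

/-- Upper semicontinuity of conditional expectations along dominated sequences: Fatou's lemma for
`G - f n`. -/
theorem CondIntegrable.of_tendsto (hm : m ≤ mΩ) [SigmaFinite (P.trim hm)] {f : ℕ → Ω → ℝ}
    {g G c : Ω → ℝ} (hf : ∀ n, CondIntegrable P m (f n)) (hG : CondIntegrable P m G)
    (hg : Measurable g) (hc : Measurable[m] c) (hle : ∀ n, f n ≤ᵐ[P] G)
    (hlim : ∀ᵐ ω ∂P, Tendsto (fun n => f n ω) atTop (𝓝 (g ω)))
    (hcf : ∀ᶠ n in atTop, c ≤ᵐ[P] condMean P m (f n)) :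
    CondIntegrable P m g ∧ c ≤ᵐ[P] condMean P m g := by
  have hgG : ∀ᵐ ω ∂P, 0 ≤ G ω - g ω := by
    filter_upwards [hlim, ae_all_iff.2 hle] with ω hlimω hleω
    exact sub_nonneg.2 (le_of_tendsto hlimω (Eventually.of_forall hleω))
  have hliminf : (fun ω => liminf (fun n => ENNReal.ofReal (G ω - f n ω)) atTop) =ᵐ[P]
      fun ω => ENNReal.ofReal (G ω - g ω) := by
    filter_upwards [hlim] with ω hω
    exact (ENNReal.tendsto_ofReal (tendsto_const_nhds.sub hω)).liminf_eq
  have hfatou : P⁻[fun ω => ENNReal.ofReal (G ω - g ω) | m] ≤ᵐ[P]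
      fun ω => ENNReal.ofReal (condMean P m G ω - c ω) :=
    (condLExp_congr_ae (mΩ := m) hliminf).symm.le.trans
      (condLExp_liminf_ofReal_sub_le hm hf hG hc hle hcf)
  have hdiff : CondIntegrable P m fun ω => G ω - g ω := by
    refine ⟨hG.measurable.sub hg, ?_⟩
    have habs : (fun ω => ENNReal.ofReal |G ω - g ω|) =ᵐ[P] fun ω => ENNReal.ofReal (G ω - g ω) :=
      hgG.mono fun ω hω => congrArg ENNReal.ofReal (abs_of_nonneg hω)
    filter_upwards [condLExp_congr_ae (mΩ := m) habs, hfatou] with ω heq hle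
    exact heq.trans_lt (hle.trans_lt ENNReal.ofReal_lt_top)
  have hgi : CondIntegrable P m g := by simpa only [sub_sub_cancel] using hG.sub hdiff
  obtain ⟨n, hn⟩ := hcf.exists
  refine ⟨hgi, ?_⟩
  filter_upwards [hfatou, condLExp_ofReal_eq_ofReal_condMean hdiff hgG, condMean_sub hG hgi, hn,
    condMean_mono (hf n) hG (hle n)] with ω hfatouω hexp hsub hcω hmono
  rw [hexp, ENNReal.ofReal_le_ofReal_iff (sub_nonneg.2 (hcω.trans hmono)), hsub] at hfatouω
  linarith

namespace OnePeriod

variable {d : ℕ} {Y : Ω → EuclideanSpace ℝ (Fin d)} {L : ℝ → ℝ} {p q C : ℝ} {V : ℝ → Ω → ℝ}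

/-- Losses of order `r` cost utility of order `r ^ q`, which outweighs the gains of order
`r ^ p`. -/
theorem tendsto_div_rpow_atBot (h : OnePeriod P m Y L p q C V) :
    ∀ᵐ ω ∂P, ∀ (r z : ℕ → ℝ) (z₀ : ℝ), z₀ < 0 → Tendsto r atTop atTop →
      Tendsto z atTop (𝓝 z₀) → Tendsto (fun k => V (r k * z k) ω / r k ^ p) atTop atBot := by
  filter_upwards [h.utility.growth, h.utility.tendsto_atBot] with ω hgrowth hbot r z z₀ hz₀ hr hz
  obtain ⟨n, hn_pos, hn⟩ := ((eventually_gt_atTop 0).and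
    (hbot.eventually (eventually_le_atBot (-1 - C)))).exists
  let c : ℝ := -z₀ / (2 * n)
  have hc : 0 < c := div_pos (neg_pos.2 hz₀) (by positivity)
  have hbound : ∀ᶠ k in atTop, V (r k * z k) ω / r k ^ p ≤ -(c ^ q * r k ^ (q - p)) := by
    filter_upwards [hr.eventually_gt_atTop 0, hr.eventually_ge_atTop (1 / c),
      hz.eventually (gt_mem_nhds (show z₀ < z₀ / 2 by linarith))] with k hr_pos hrk hzk
    have hscale : 1 ≤ c * r k := (div_le_iff₀' hc).1 hrk
    have hloss : r k * (z₀ / 2) = c * r k * -n := by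
      simp only [c]; field_simp
    rw [div_le_iff₀ (by positivity), neg_mul, mul_assoc, ← Real.rpow_add hr_pos, sub_add_cancel,
      ← Real.mul_rpow hc.le hr_pos.le]
    calc V (r k * z k) ω ≤ V (c * r k * -n) ω :=
          h.utility.mono ω (hloss ▸ mul_le_mul_of_nonneg_left hzk.le hr_pos.le)
      _ ≤ (c * r k) ^ q * (V (-n) ω + C) := (hgrowth _ _ hscale).2
      _ ≤ (c * r k) ^ q * -1 := by gcongr; linarith
      _ = -(c * r k) ^ q := mul_neg_one _
  refine tendsto_atBot_mono' _ hbound (tendsto_neg_atTop_atBot.comp ?_)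
  exact ((tendsto_rpow_atTop (sub_pos.2 h.p_lt_q)).comp hr).const_mul_atTop (by positivity)

theorem tendsto_payoff_div_rpow_atBot (h : OnePeriod P m Y L p q C V) {X r : ℕ → Ω → ℝ}
    {ξ : ℕ → Ω → EuclideanSpace ℝ (Fin d)} {x : Ω → ℝ} {η : Ω → EuclideanSpace ℝ (Fin d)}
    (hr1 : ∀ n ω, 1 ≤ r n ω)
    (hx : ∀ ω, Tendsto (fun n => X n ω / r n ω) atTop (𝓝 (x ω)))
    (hη : ∀ ω, Tendsto (fun n => (r n ω)⁻¹ • ξ n ω) atTop (𝓝 (η ω))) :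
    ∀ᵐ ω ∂P, Tendsto (fun n => r n ω) atTop atTop → x ω + inner ℝ (η ω) (Y ω) < 0 →
      Tendsto (fun n => (r n ω ^ p)⁻¹ * payoff V Y (X n) (ξ n) ω) atTop atBot := by
  filter_upwards [h.tendsto_div_rpow_atBot] with ω hbot hr hneg
  refine (hbot _ _ _ hneg hr ((hx ω).add ((hη ω).inner tendsto_const_nhds))).congr fun n => ?_
  have hr0 : r n ω ≠ 0 := (zero_lt_one.trans_le (hr1 n ω)).ne'
  rw [div_eq_inv_mul, payoff, real_inner_smul_left, mul_add, mul_inv_cancel_left₀ hr0,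
    mul_div_cancel₀ _ hr0]

variable [IsFiniteMeasure P]

theorem nonneg_of_tendsto (h : OnePeriod P m Y L p q C V) {X r : ℕ → Ω → ℝ}
    {ξ : ℕ → Ω → EuclideanSpace ℝ (Fin d)} {M x : Ω → ℝ} {η : Ω → EuclideanSpace ℝ (Fin d)}
    {A : Set Ω} (hM : Measurable[m] M) (hr : ∀ n, Measurable[m] (r n)) (hr1 : ∀ n ω, 1 ≤ r n ω)
    (hXr : ∀ n ω, X n ω ≤ r n ω) (hξr : ∀ n ω, ‖ξ n ω‖ ≤ r n ω)
    (hint : ∀ n, CondIntegrable P m (payoff V Y (X n) (ξ n)))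
    (hle : ∀ n, M ≤ᵐ[P] condMean P m (payoff V Y (X n) (ξ n)))
    (hx : ∀ ω, Tendsto (fun n => X n ω / r n ω) atTop (𝓝 (x ω)))
    (hη : ∀ ω, Tendsto (fun n => (r n ω)⁻¹ • ξ n ω) atTop (𝓝 (η ω)))
    (hA : ∀ ω ∈ A, Tendsto (fun n => r n ω) atTop atTop) :
    ∀ᵐ ω ∂P, ω ∈ A → 0 ≤ x ω + inner ℝ (η ω) (Y ω) := by
  let G := dominant V Y C
  have hG : CondIntegrable P m G := h.condIntegrable_dominant
  let w : ℕ → Ω → ℝ := fun n ω => (r n ω ^ p)⁻¹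
  have hr_pos (n : ℕ) (ω : Ω) : 0 < r n ω ^ p := Real.rpow_pos_of_pos (by linarith [hr1 n ω]) p
  have hw (n : ℕ) : Measurable[m] (w n) := ((hr n).pow_const p).inv
  have hw_le (n : ℕ) (ω : Ω) : w n ω ≤ 1 :=
    inv_le_one_of_one_le₀ (Real.one_le_rpow (hr1 n ω) h.p_pos.le)
  let f : ℕ → Ω → ℝ := fun n ω => w n ω * payoff V Y (X n) (ξ n) ω
  have hf (n : ℕ) : CondIntegrable P m (f n) := (hint n).mul_left h.le (hw n)
  have hfG (n : ℕ) : f n ≤ᵐ[P] G := by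
    filter_upwards [h.payoff_le_dominant] with ω hω
    exact (inv_mul_le_iff₀ (hr_pos n ω)).2 (hω _ _ _ (hr1 n ω) (hXr n ω) (hξr n ω))
  have hMf (n : ℕ) : (fun ω => -|M ω|) ≤ᵐ[P] condMean P m (f n) := by
    filter_upwards [condMean_mul_left h.le (hw n) (hint n), hle n] with ω hmul hω
    calc -|M ω| ≤ w n ω * -|M ω| := by
          linarith [mul_le_mul_of_nonneg_right (hw_le n ω) (abs_nonneg (M ω))]
      _ ≤ w n ω * condMean P m (payoff V Y (X n) (ξ n)) ω :=
          mul_le_mul_of_nonneg_left ((neg_abs_le (M ω)).trans hω) (inv_pos.2 (hr_pos n ω)).le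
      _ = condMean P m (f n) ω := hmul.symm
  have hfatou := condLExp_liminf_ofReal_sub_le h.le hf hG (measurable_abs.comp hM).neg hfG
    (Eventually.of_forall hMf)
  have hliminf_lt_top := ae_lt_top_of_condLExp_lt_top h.le
    (Measurable.liminf fun n => (hG.measurable.sub (hf n).measurable).ennreal_ofReal)
    (hfatou.mono fun ω hω => hω.trans_lt ENNReal.ofReal_lt_top)
  filter_upwards [hliminf_lt_top, h.tendsto_payoff_div_rpow_atBot hr1 hx hη]
    with ω hfin hbot hω
  by_contra! hneg
  have htop : Tendsto (fun n => ENNReal.ofReal (G ω - f n ω)) atTop (𝓝 ⊤) :=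
    ENNReal.tendsto_ofReal_atTop.comp (tendsto_atTop_add_const_left _ _
      (tendsto_neg_atBot_atTop.comp (hbot (hA ω hω) hneg)))
  exact hfin.ne htop.liminf_eq

end OnePeriod

end Limits

/-! ### Existence of optimal positions -/

section Optimizer

open Filter Topology

section Greatest

variable {Ω ι : Type*} {mΩ : MeasurableSpace Ω} {P : Measure Ω}

theorem exists_monotone_seq_of_directed {F : ι → Ω → ℝ} (hdir : Directed (· ≤ᵐ[P] ·) F)
    (a : ℕ → ι) : ∃ b : ℕ → ι, (∀ n, F (a n) ≤ᵐ[P] F (b n)) ∧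
      ∀ᵐ ω ∂P, Monotone fun n => F (b n) ω := by
  choose j hj_left hj_right using hdir
  let b : ℕ → ι := Nat.rec (a 0) fun n i => j i (a (n + 1))
  have hb_succ (n : ℕ) : F (b n) ≤ᵐ[P] F (b (n + 1)) := hj_left (b n) (a (n + 1))
  refine ⟨b, fun n => ?_, ?_⟩
  · cases n with
    | zero => exact EventuallyLE.rfl
    | succ n => exact hj_right (b n) (a (n + 1))
  · filter_upwards [ae_all_iff.2 hb_succ] with ω hω using monotone_nat_of_le_succ hω

variable [IsFiniteMeasure P] {f g : Ω → ℝ}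

theorem integrable_arctan (hf : Measurable f) : Integrable (fun ω => Real.arctan (f ω)) P :=
  .of_bound (Real.measurable_arctan.comp hf).aestronglyMeasurable (Real.pi / 2) <|
    ae_of_all _ fun _ =>
      abs_le.2 ⟨(Real.neg_pi_div_two_lt_arctan _).le, (Real.arctan_lt_pi_div_two _).le⟩

theorem integral_arctan_mono (hf : Measurable f) (hg : Measurable g) (h : f ≤ᵐ[P] g) :
    ∫ ω, Real.arctan (f ω) ∂P ≤ ∫ ω, Real.arctan (g ω) ∂P :=
  integral_mono_ae (integrable_arctan hf) (integrable_arctan hg)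
    (h.mono fun _ hω => Real.arctan_strictMono.monotone hω)

theorem ae_le_of_integral_arctan_le (hf : Measurable f) (hg : Measurable g) (h : f ≤ᵐ[P] g)
    (hint : ∫ ω, Real.arctan (g ω) ∂P ≤ ∫ ω, Real.arctan (f ω) ∂P) : g ≤ᵐ[P] f := by
  have heq := (integral_eq_iff_of_ae_le (integrable_arctan hf) (integrable_arctan hg)
    (h.mono fun _ hω => Real.arctan_strictMono.monotone hω)).1
    ((integral_arctan_mono hf hg h).antisymm hint)
  exact heq.mono fun ω hω => (Real.arctan_injective hω).ge

/-- Maximize the bounded and strictly monotone functional `f ↦ ∫ arctan f`. -/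
theorem exists_ae_greatest [Nonempty ι] {F : ι → Ω → ℝ} (hF : ∀ i, Measurable (F i))
    (hdir : Directed (· ≤ᵐ[P] ·) F)
    (hbound : ∀ u : ℕ → ι, (∀ᵐ ω ∂P, Monotone fun n => F (u n) ω) →
      ∃ i, ∀ n, F (u n) ≤ᵐ[P] F i) :
    ∃ i, ∀ j, F j ≤ᵐ[P] F i := by
  let I : ι → ℝ := fun i => ∫ ω, Real.arctan (F i ω) ∂P
  have hI_bdd : BddAbove (Set.range I) := by
    refine ⟨∫ _, Real.pi / 2 ∂P, Set.forall_mem_range.2 fun i => ?_⟩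
    exact integral_mono (integrable_arctan (hF i)) (integrable_const _)
      fun ω => (Real.arctan_lt_pi_div_two _).le
  obtain ⟨v, -, hv_lim, hv_mem⟩ := exists_seq_tendsto_sSup (Set.range_nonempty I) hI_bdd
  choose a ha using hv_mem
  obtain ⟨b, hab, hb_mono⟩ := exists_monotone_seq_of_directed hdir a
  obtain ⟨i, hi⟩ := hbound b hb_mono
  have hI_max (j : ι) : I j ≤ I i := by
    refine (le_csSup hI_bdd (Set.mem_range_self j)).trans (le_of_tendsto' hv_lim fun n => ?_)
    rw [← ha n]
    exact integral_arctan_mono (hF _) (hF _) ((hab n).trans (hi n))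
  refine ⟨i, fun j => ?_⟩
  obtain ⟨k, hik, hjk⟩ := hdir i j
  exact hjk.trans (ae_le_of_integral_arctan_le (hF i) (hF k) hik (hI_max k))

end Greatest

section Size

variable {E : Type*} [NormedAddCommGroup E]

/-- The scale, at least one, by which a capital `x` and a position `y` are normalized. -/
noncomputable def size (x : ℝ) (y : E) : ℝ :=
  max 1 (max |x| ‖y‖)

theorem one_le_size (x : ℝ) (y : E) : 1 ≤ size x y := le_max_left _ _

theorem size_pos (x : ℝ) (y : E) : 0 < size x y := zero_lt_one.trans_le (one_le_size x y)

theorem abs_le_size (x : ℝ) (y : E) : |x| ≤ size x y :=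
  (le_max_left _ _).trans (le_max_right _ _)

theorem norm_le_size (x : ℝ) (y : E) : ‖y‖ ≤ size x y :=
  (le_max_right _ _).trans (le_max_right _ _)

theorem measurable_size {Ω : Type*} {_ : MeasurableSpace Ω} [MeasurableSpace E] [BorelSpace E]
    {X : Ω → ℝ} {ξ : Ω → E} (hX : Measurable X) (hξ : Measurable ξ) :
    Measurable fun ω => size (X ω) (ξ ω) :=
  measurable_const.max (hX.abs.max hξ.norm)

theorem abs_div_size (x : ℝ) (y : E) : |x / size x y| = |x| / size x y := by
  rw [abs_div, abs_of_pos (size_pos x y)]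

variable [NormedSpace ℝ E]

theorem norm_inv_size_smul (x : ℝ) (y : E) : ‖(size x y)⁻¹ • y‖ = ‖y‖ / size x y := by
  rw [norm_smul, norm_inv, Real.norm_of_nonneg (size_pos x y).le, inv_mul_eq_div]

theorem one_le_max_of_tendsto_size {X : ℕ → ℝ} {ξ : ℕ → E} {x : ℝ} {η : E}
    (hsize : Tendsto (fun k => size (X k) (ξ k)) atTop atTop)
    (hx : Tendsto (fun k => X k / size (X k) (ξ k)) atTop (𝓝 x))
    (hη : Tendsto (fun k => (size (X k) (ξ k))⁻¹ • ξ k) atTop (𝓝 η)) : 1 ≤ max |x| ‖η‖ := by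
  refine ge_of_tendsto (hx.abs.max hη.norm) ?_
  filter_upwards [hsize.eventually_gt_atTop 1] with k hk
  have hlarge : size (X k) (ξ k) ≤ max |X k| ‖ξ k‖ := (le_max_iff.1 le_rfl).resolve_left hk.not_ge
  rwa [abs_div_size, norm_inv_size_smul, max_div_div_right (size_pos _ _).le,
    one_le_div (size_pos _ _)]

end Size

section ExplodingDirection

variable {Ω : Type*} {m : MeasurableSpace Ω}

theorem exists_measurable_index_gt {r : ℕ → Ω → ℝ} (hr : ∀ n, Measurable (r n)) :
    ∃ σ : ℕ → Ω → ℕ, (∀ K, Measurable (σ K)) ∧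
      ∀ (K : ℕ) (ω : Ω), ¬BddAbove (Set.range fun n => r n ω) → (K : ℝ) < r (σ K ω) ω := by
  classical
  have hex (K : ℕ) (ω : Ω) : ∃ n, BddAbove (Set.range fun n => r n ω) ∨ (K : ℝ) < r n ω := by
    by_cases hω : BddAbove (Set.range fun n => r n ω)
    · exact ⟨0, .inl hω⟩
    · obtain ⟨_, ⟨n, rfl⟩, hn⟩ := not_bddAbove_iff.1 hω K
      exact ⟨n, .inr hn⟩
  refine ⟨fun K ω => Nat.find (hex K ω), fun K => measurable_find _ fun n =>
    (measurableSet_bddAbove_range hr).union (measurableSet_lt measurable_const (hr n)),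
    fun K ω hω => (Nat.find_spec (hex K ω)).resolve_left hω⟩

variable {d : ℕ} {X : ℕ → Ω → ℝ} {ξ : ℕ → Ω → EuclideanSpace ℝ (Fin d)}

theorem exists_exploding_direction (hX : ∀ n, Measurable (X n)) (hξ : ∀ n, Measurable (ξ n)) :
    ∃ (τ : ℕ → Ω → ℕ) (x : Ω → ℝ) (η : Ω → EuclideanSpace ℝ (Fin d)),
      (∀ k, Measurable (τ k)) ∧ Measurable x ∧ Measurable η ∧
      (∀ ω, Tendsto (fun k => X (τ k ω) ω / size (X (τ k ω) ω) (ξ (τ k ω) ω)) atTop (𝓝 (x ω))) ∧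
      (∀ ω, Tendsto (fun k => (size (X (τ k ω) ω) (ξ (τ k ω) ω))⁻¹ • ξ (τ k ω) ω) atTop
        (𝓝 (η ω))) ∧
      ∀ ω, ¬BddAbove (Set.range fun n => size (X n ω) (ξ n ω)) →
        Tendsto (fun k => size (X (τ k ω) ω) (ξ (τ k ω) ω)) atTop atTop := by
  let r : ℕ → Ω → ℝ := fun n ω => size (X n ω) (ξ n ω)
  have hr (n : ℕ) : Measurable (r n) := measurable_size (hX n) (hξ n)
  obtain ⟨σ, hσ, hσ_gt⟩ := exists_measurable_index_gt hr
  have hrσ (K : ℕ) : Measurable fun ω => r (σ K ω) ω := measurable_eval_nat hr (hσ K)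
  obtain ⟨ρ, x, η, hρ, hρ_ge, hx_meas, hη_meas, hx, hη⟩ := exists_measurable_subseq
    (X := fun K ω => X (σ K ω) ω / r (σ K ω) ω) (ξ := fun K ω => (r (σ K ω) ω)⁻¹ • ξ (σ K ω) ω)
    (fun K => (measurable_eval_nat hX (hσ K)).div (hrσ K))
    (fun K => (hrσ K).inv.smul (measurable_eval_nat hξ (hσ K)))
    (fun ω => ⟨1, fun K => by
      rw [abs_div_size, norm_inv_size_smul, div_le_one (size_pos _ _), div_le_one (size_pos _ _)]
      exact ⟨abs_le_size _ _, norm_le_size _ _⟩⟩)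
  refine ⟨fun k ω => σ (ρ k ω) ω, x, η, fun k => measurable_eval_nat hσ (hρ k), hx_meas, hη_meas,
    hx, hη, fun ω hω => tendsto_atTop_mono (fun k => ?_) tendsto_natCast_atTop_atTop⟩
  exact (Nat.cast_le.2 (hρ_ge k ω)).trans (hσ_gt (ρ k ω) ω hω).le

end ExplodingDirection

namespace OnePeriod

variable {Ω : Type*} {m mΩ : MeasurableSpace Ω} {P : Measure Ω} {d : ℕ}
  {Y : Ω → EuclideanSpace ℝ (Fin d)} {L : ℝ → ℝ} {p q C : ℝ} {V : ℝ → Ω → ℝ}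

/-- The positions for which the conditional expected utility from initial capital `X` is finite. -/
def positions (P : Measure[mΩ] Ω) (m : MeasurableSpace Ω) (V : ℝ → Ω → ℝ)
    (Y : Ω → EuclideanSpace ℝ (Fin d)) (X : Ω → ℝ) : Set (Ω → EuclideanSpace ℝ (Fin d)) :=
  {ξ | Measurable[m] ξ ∧ CondIntegrable P m (payoff V Y X ξ)}

variable {X : Ω → ℝ}

theorem mem_positions_of_ae_eq (h : OnePeriod P m Y L p q C V) (hX : Measurable[m] X)
    {ξ ξ' : Ω → EuclideanSpace ℝ (Fin d)} (hξ : ξ ∈ positions P m V Y X)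
    (hξ' : Measurable[m] ξ') (heq : payoff V Y X ξ' =ᵐ[P] payoff V Y X ξ) :
    ξ' ∈ positions P m V Y X :=
  ⟨hξ', hξ.2.mono (h.measurable_payoff (hX.mono h.le le_rfl) (hξ'.mono h.le le_rfl))
    (heq.mono fun _ hω => (congrArg abs hω).le)⟩

variable [IsFiniteMeasure P]

theorem zero_mem_positions (h : OnePeriod P m Y L p q C V) (hX : Measurable[m] X) :
    0 ∈ positions P m V Y X :=
  ⟨measurable_const, h.condIntegrable_payoff_zero hX⟩

/-- Where the sequence is unbounded, its rescaled limit `η` would be a gain without risk, hence a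
null position; it is then orthogonal to the `ξ n` and so to itself. -/
theorem ae_bddAbove_size (h : OnePeriod P m Y L p q C V) {X : ℕ → Ω → ℝ}
    {ξ : ℕ → Ω → EuclideanSpace ℝ (Fin d)} {M b : Ω → ℝ} (hM : Measurable[m] M)
    (hX : ∀ n, Measurable[m] (X n)) (hξ : ∀ n, Measurable[m] (ξ n))
    (hXb : ∀ n ω, X n ω ≤ b ω)
    (hint : ∀ n, CondIntegrable P m (payoff V Y (X n) (ξ n)))
    (hle : ∀ n, M ≤ᵐ[P] condMean P m (payoff V Y (X n) (ξ n)))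
    (horth : ∀ n, IsNullOrthogonal P m Y (ξ n)) :
    ∀ᵐ ω ∂P, BddAbove (Set.range fun n => size (X n ω) (ξ n ω)) := by
  obtain ⟨τ, x, η, hτ, -, hη_meas, hx, hη, hexplode⟩ := exists_exploding_direction hX hξ
  let A : Set Ω := {ω | BddAbove (Set.range fun n => size (X n ω) (ξ n ω))}ᶜ
  have hA : MeasurableSet[m] A :=
    (measurableSet_bddAbove_range fun n => measurable_size (hX n) (hξ n)).compl
  have hgain : ∀ᵐ ω ∂P, ω ∈ A → 0 ≤ x ω + inner ℝ (η ω) (Y ω) := by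
    refine h.nonneg_of_tendsto hM
      (fun k => measurable_size (measurable_eval_nat hX (hτ k)) (measurable_eval_nat hξ (hτ k)))
      (fun k ω => one_le_size _ _) (fun k ω => (le_abs_self _).trans (abs_le_size _ _))
      (fun k ω => norm_le_size _ _) (fun k => CondIntegrable.random_index h.le hint (hτ k))
      (fun k => ?_) hx hη hexplode
    filter_upwards [condMean_random_index h.le hint (hτ k), ae_all_iff.2 hle] with ω hτω hleω
    exact (hleω (τ k ω)).trans_eq hτω.symm
  have hx_nonpos : ∀ ω ∈ A, x ω ≤ 0 := fun ω hω =>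
    le_of_tendsto_of_tendsto' (hx ω) (tendsto_const_nhds.div_atTop (hexplode ω hω)) fun k =>
      div_le_div_of_nonneg_right (hXb _ ω) (size_pos _ _).le
  have hnull : ∀ᵐ ω ∂P, inner ℝ (A.indicator η ω) (Y ω) = 0 := by
    refine h.noArbitrage _ (hη_meas.indicator hA) ?_
    filter_upwards [hgain] with ω hω
    by_cases hωA : ω ∈ A
    · rw [Set.indicator_of_mem hωA]
      linarith [hx_nonpos ω hωA, hω hωA]
    · rw [Set.indicator_of_notMem hωA, inner_zero_left]
  filter_upwards [hgain, hnull,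
    ae_all_iff.2 fun n => horth n _ (hη_meas.indicator hA) hnull] with ω hgainω hnullω horthω
  by_contra hωA
  rw [Set.indicator_of_mem hωA] at hnullω
  simp only [Set.indicator_of_mem (show ω ∈ A from hωA)] at horthω
  have hx_zero : x ω = 0 := (hx_nonpos ω hωA).antisymm (by linarith [hgainω hωA])
  have hη_zero : η ω = 0 := inner_self_eq_zero.1 <| tendsto_nhds_unique
    ((hη ω).inner tendsto_const_nhds) <| tendsto_const_nhds.congr fun k => by
      rw [real_inner_smul_left, horthω, mul_zero]
  have hone := one_le_max_of_tendsto_size (hexplode ω hωA) (hx ω) (hη ω)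
  simp [hx_zero, hη_zero] at hone
  linarith

theorem directed_condMean_payoff (h : OnePeriod P m Y L p q C V) :
    Directed (· ≤ᵐ[P] ·) fun ξ : positions P m V Y X => condMean P m (payoff V Y X ξ) := by
  classical
  rintro ⟨ξ, hξ⟩ ⟨ξ', hξ'⟩
  let A : Set Ω := {ω | condMean P m (payoff V Y X ξ') ω ≤ condMean P m (payoff V Y X ξ) ω}
  have hA : MeasurableSet[m] A :=
    measurableSet_le (measurable_condMean _ _ _) (measurable_condMean _ _ _)
  have hpay : payoff V Y X (A.piecewise ξ ξ') =
      A.piecewise (payoff V Y X ξ) (payoff V Y X ξ') := by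
    ext ω
    by_cases hω : ω ∈ A <;> simp [payoff, hω]
  have hmean := condMean_piecewise h.le hξ.2 hξ'.2 hA
  rw [← hpay] at hmean
  refine ⟨⟨A.piecewise ξ ξ', hξ.1.piecewise hA hξ'.1, ?_⟩, ?_, ?_⟩
  · rw [hpay]
    exact hξ.2.piecewise hξ'.2 (h.le A hA)
  · filter_upwards [hmean] with ω hω
    rw [hω]
    by_cases hωA : ω ∈ A
    · rw [Set.piecewise_eq_of_mem _ _ _ hωA]
    · rw [Set.piecewise_eq_of_notMem _ _ _ hωA]
      exact (not_le.1 hωA).le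
  · filter_upwards [hmean] with ω hω
    rw [hω]
    by_cases hωA : ω ∈ A
    · rw [Set.piecewise_eq_of_mem _ _ _ hωA]
      exact hωA
    · rw [Set.piecewise_eq_of_notMem _ _ _ hωA]

theorem exists_orthogonal_mem_positions (h : OnePeriod P m Y L p q C V) (hX : Measurable[m] X)
    {ξ : Ω → EuclideanSpace ℝ (Fin d)} (hξ : ξ ∈ positions P m V Y X) :
    ∃ ξ' ∈ positions P m V Y X,
      condMean P m (payoff V Y X ξ') =ᵐ[P] condMean P m (payoff V Y X ξ) ∧
      IsNullOrthogonal P m Y ξ' := by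
  obtain ⟨ξ', hξ', hinner, horth⟩ := exists_orthogonal_position (P := P) (Y := Y) h.le hξ.1
  have hpay : payoff V Y X ξ' =ᵐ[P] payoff V Y X ξ :=
    hinner.mono fun ω hω => by simp only [payoff, hω]
  exact ⟨ξ', h.mem_positions_of_ae_eq hX hξ hξ' hpay, condMean_congr hpay, horth⟩

theorem exists_bddAbove_positions (h : OnePeriod P m Y L p q C V) (hX : Measurable[m] X)
    {ξ : ℕ → Ω → EuclideanSpace ℝ (Fin d)} (hξ : ∀ n, ξ n ∈ positions P m V Y X)
    (hmono : ∀ᵐ ω ∂P, Monotone fun n => condMean P m (payoff V Y X (ξ n)) ω) :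
    ∃ ζ : ℕ → Ω → EuclideanSpace ℝ (Fin d), (∀ n, ζ n ∈ positions P m V Y X) ∧
      (∀ n, condMean P m (payoff V Y X (ζ n)) =ᵐ[P] condMean P m (payoff V Y X (ξ n))) ∧
      ∀ ω, BddAbove (Set.range fun n => ‖ζ n ω‖) := by
  choose ξ' hξ' hmean horth using fun n => h.exists_orthogonal_mem_positions hX (hξ n)
  have hfirst_le (n : ℕ) :
      condMean P m (payoff V Y X (ξ 0)) ≤ᵐ[P] condMean P m (payoff V Y X (ξ' n)) := by
    filter_upwards [hmono, hmean n] with ω hmonoω hω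
    exact (hmonoω n.zero_le).trans_eq hω.symm
  let N : Set Ω := {ω | BddAbove (Set.range fun n => size (X ω) (ξ' n ω))}
  have hN : MeasurableSet[m] N :=
    measurableSet_bddAbove_range fun n => measurable_size hX (hξ' n).1
  have hN_ae : ∀ᵐ ω ∂P, ω ∈ N := h.ae_bddAbove_size (measurable_condMean _ _ _) (fun _ => hX)
    (fun n => (hξ' n).1) (fun _ _ => le_rfl) (fun n => (hξ' n).2) hfirst_le horth
  have hpay (n : ℕ) : payoff V Y X (N.indicator (ξ' n)) =ᵐ[P] payoff V Y X (ξ' n) :=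
    hN_ae.mono fun ω hω => by simp only [payoff, Set.indicator_of_mem hω]
  refine ⟨fun n => N.indicator (ξ' n), fun n => h.mem_positions_of_ae_eq hX (hξ' n)
    ((hξ' n).1.indicator hN) (hpay n), fun n => (condMean_congr (hpay n)).trans (hmean n),
    fun ω => ?_⟩
  by_cases hω : ω ∈ N
  · simp only [Set.indicator_of_mem hω]
    exact BddAbove.range_mono _ (fun n => norm_le_size _ _) hω
  · simp [Set.indicator_of_notMem hω]

theorem exists_limit_position (h : OnePeriod P m Y L p q C V) (hX : Measurable[m] X)
    {ξ : ℕ → Ω → EuclideanSpace ℝ (Fin d)} (hξ : ∀ n, ξ n ∈ positions P m V Y X)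
    (hmono : ∀ᵐ ω ∂P, Monotone fun n => condMean P m (payoff V Y X (ξ n)) ω) :
    ∃ η ∈ positions P m V Y X, ∀ n,
      condMean P m (payoff V Y X (ξ n)) ≤ᵐ[P] condMean P m (payoff V Y X η) := by
  obtain ⟨ζ, hζ, hmean, hζ_bdd⟩ := h.exists_bddAbove_positions hX hξ hmono
  obtain ⟨τ, -, η, hτ, hτ_ge, -, hη_meas, -, hη⟩ := exists_measurable_subseq
    (X := fun _ _ => 0) (fun _ => measurable_const) (fun n => (hζ n).1) (fun ω => by
      obtain ⟨K, hK⟩ := hζ_bdd ω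
      have hζK (n : ℕ) : ‖ζ n ω‖ ≤ K := hK (Set.mem_range_self n)
      exact ⟨K, fun n => ⟨by simpa using (norm_nonneg _).trans (hζK n), hζK n⟩⟩)
  let R : Ω → ℝ := fun ω => 1 + |X ω| + ⨆ n, ‖ζ n ω‖
  have hR : Measurable[m] R := (measurable_const.add (measurable_abs.comp hX)).add
    (Measurable.iSup fun n => measurable_norm.comp (hζ n).1)
  have hpay_le (k : ℕ) : (fun ω => payoff V Y X (ζ (τ k ω)) ω) ≤ᵐ[P]
      fun ω => R ω ^ p * dominant V Y C ω := by
    filter_upwards [h.payoff_le_dominant] with ω hω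
    have hsup := le_ciSup (hζ_bdd ω) (τ k ω)
    refine hω _ _ _ ?_ ?_ ?_ <;>
      linarith [abs_nonneg (X ω), le_abs_self (X ω), norm_nonneg (ζ (τ k ω) ω)]
  have hlimit (j : ℕ) : CondIntegrable P m (payoff V Y X η) ∧
      condMean P m (payoff V Y X (ξ j)) ≤ᵐ[P] condMean P m (payoff V Y X η) := by
    refine CondIntegrable.of_tendsto h.le
      (fun k => CondIntegrable.random_index h.le (fun n => (hζ n).2) (hτ k))
      (h.condIntegrable_dominant.mul_left h.le (hR.pow_const p))
      (h.measurable_payoff (hX.mono h.le le_rfl) (hη_meas.mono h.le le_rfl))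
      (measurable_condMean _ _ _) hpay_le
      (ae_of_all _ fun ω => ((h.utility.continuous ω).tendsto _).comp
        (tendsto_const_nhds.add ((hη ω).inner tendsto_const_nhds))) ?_
    filter_upwards [eventually_ge_atTop j] with k hk
    filter_upwards [condMean_random_index h.le (fun n => (hζ n).2) (hτ k), hmono,
      ae_all_iff.2 hmean] with ω hτω hmonoω hmeanω
    rw [hτω, hmeanω]
    exact hmonoω (hk.trans (hτ_ge k ω))
  exact ⟨η, ⟨hη_meas, (hlimit 0).1⟩, fun j => (hlimit j).2⟩

theorem exists_optimal_position (h : OnePeriod P m Y L p q C V) (hX : Measurable[m] X) :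
    ∃ ξ ∈ positions P m V Y X, ∀ ξ' ∈ positions P m V Y X,
      condMean P m (payoff V Y X ξ') ≤ᵐ[P] condMean P m (payoff V Y X ξ) := by
  have : Nonempty (positions P m V Y X) := ⟨⟨0, h.zero_mem_positions hX⟩⟩
  obtain ⟨⟨ξ, hξ⟩, hmax⟩ := exists_ae_greatest
    (fun _ => (measurable_condMean _ _ _).mono h.le le_rfl) h.directed_condMean_payoff
    (fun u hu => by simpa using h.exists_limit_position hX (fun n => (u n).2) hu)
  exact ⟨ξ, hξ, fun ξ' hξ' => hmax ⟨ξ', hξ'⟩⟩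

end OnePeriod

end Optimizer

/-! ### Versions with monotone and concave paths -/

section Regularization

open Filter Topology

/-- The function `f` on the rationals is nondecreasing and concave. Concavity is expressed by the
inequality between the values at three points, without division. -/
structure IsMonotoneConcave (f : ℚ → ℝ) : Prop where
  mono : Monotone f
  concave : ∀ x y z : ℚ, x < y → y < z →
    ((z : ℝ) - y) * f x + ((y : ℝ) - x) * f z ≤ ((z : ℝ) - x) * f y

/-- The left-continuous extension to the real line of a nondecreasing function on the rationals. -/
noncomputable def leftExtension (f : ℚ → ℝ) (x : ℝ) : ℝ :=
  ⨆ r : {r : ℚ // (r : ℝ) < x}, f r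

section Deterministic

variable {f : ℚ → ℝ} {c x : ℝ}

theorem le_leftExtension (hf : Monotone f) {r : ℚ} (hr : (r : ℝ) < x) :
    f r ≤ leftExtension f x := by
  obtain ⟨s, hs⟩ := exists_rat_gt x
  refine le_ciSup (f := fun r : {r : ℚ // (r : ℝ) < x} => f r) ⟨f s, ?_⟩ ⟨r, hr⟩
  rintro _ ⟨t, rfl⟩
  exact hf (by exact_mod_cast (t.2.trans hs).le)

theorem leftExtension_le (h : ∀ r : ℚ, (r : ℝ) < x → f r ≤ c) : leftExtension f x ≤ c := by
  obtain ⟨s, hs⟩ := exists_rat_lt x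
  have : Nonempty {r : ℚ // (r : ℝ) < x} := ⟨⟨s, hs⟩⟩
  exact ciSup_le fun r => h r r.2

theorem monotone_leftExtension (hf : Monotone f) : Monotone (leftExtension f) := fun _ _ hxy =>
  leftExtension_le fun _ hr => le_leftExtension hf (hr.trans_le hxy)

theorem tendsto_leftExtension (hf : Monotone f) {u : ℕ → ℚ} (hu : ∀ n, (u n : ℝ) < x)
    (hux : Tendsto (fun n => (u n : ℝ)) atTop (𝓝 x)) :
    Tendsto (fun n => f (u n)) atTop (𝓝 (leftExtension f x)) := by
  refine tendsto_order.2 ⟨fun a ha => ?_, fun a ha => Eventually.of_forall fun n =>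
    (le_leftExtension hf (hu n)).trans_lt ha⟩
  obtain ⟨r, hr, har⟩ : ∃ r : ℚ, (r : ℝ) < x ∧ a < f r := by
    by_contra! hle
    exact absurd (leftExtension_le hle) (not_le.2 ha)
  filter_upwards [hux.eventually (lt_mem_nhds hr)] with n hn
  exact har.trans_le (hf (by exact_mod_cast hn.le))

theorem concaveOn_leftExtension (hf : IsMonotoneConcave f) :
    ConcaveOn ℝ Set.univ (leftExtension f) := by
  have hthree (x y z : ℝ) (hxy : x < y) (hyz : y < z) :
      (z - y) * leftExtension f x + (y - x) * leftExtension f z ≤ (z - x) * leftExtension f y := by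
    obtain ⟨u, -, hu, hux⟩ := Real.exists_seq_rat_strictMono_tendsto x
    obtain ⟨v, -, hv, hvy⟩ := Real.exists_seq_rat_strictMono_tendsto y
    obtain ⟨w, -, hw, hwz⟩ := Real.exists_seq_rat_strictMono_tendsto z
    refine le_of_tendsto_of_tendsto
      (((hwz.sub hvy).mul (tendsto_leftExtension hf.mono hu hux)).add
        ((hvy.sub hux).mul (tendsto_leftExtension hf.mono hw hwz)))
      ((hwz.sub hux).mul (tendsto_leftExtension hf.mono hv hvy)) ?_
    filter_upwards [hux.eventually_lt hvy hxy, hvy.eventually_lt hwz hyz] with n huv hvw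
    exact hf.concave _ _ _ (by exact_mod_cast huv) (by exact_mod_cast hvw)
  refine concaveOn_of_slope_anti_adjacent convex_univ fun {x y z} _ _ hxy hyz => ?_
  rw [div_le_div_iff₀ (sub_pos.2 hyz) (sub_pos.2 hxy)]
  linarith [hthree x y z hxy hyz]

theorem leftExtension_eq (hf : IsMonotoneConcave f) (hlt : ∀ r : ℚ, (r : ℝ) < x → f r ≤ c)
    (hgt : ∀ r : ℚ, x < (r : ℝ) → c ≤ f r) : leftExtension f x = c := by
  refine (leftExtension_le hlt).antisymm ?_
  obtain ⟨u, -, hu, hux⟩ := Real.exists_seq_rat_strictAnti_tendsto x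
  have hcont : Continuous (leftExtension f) :=
    continuous_of_concaveOn_univ (concaveOn_leftExtension hf)
  have hlim : Tendsto (fun n => (u n : ℝ) + ((u n : ℝ) - x)) atTop (𝓝 x) := by
    simpa using hux.add (hux.sub (tendsto_const_nhds (x := x)))
  refine ge_of_tendsto' ((hcont.tendsto x).comp hlim) fun n => (hgt _ (hu n)).trans ?_
  exact le_leftExtension hf.mono (by linarith [hu n])

end Deterministic

variable {Ω : Type*} {m : MeasurableSpace Ω} {w : ℝ → Ω → ℝ}

theorem measurableSet_isMonotoneConcave (hw : ∀ x, Measurable (w x)) :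
    MeasurableSet {ω | IsMonotoneConcave fun r : ℚ => w r ω} := by
  have hset : {ω | IsMonotoneConcave fun r : ℚ => w r ω} =
      (⋂ (x : ℚ) (y : ℚ) (_ : x ≤ y), {ω | w x ω ≤ w y ω}) ∩
        ⋂ (x : ℚ) (y : ℚ) (z : ℚ) (_ : x < y) (_ : y < z),
          {ω | ((z : ℝ) - y) * w x ω + ((y : ℝ) - x) * w z ω ≤ ((z : ℝ) - x) * w y ω} := by
    ext ω
    simp only [Set.mem_inter_iff, Set.mem_iInter, Set.mem_ofPred_eq]
    exact ⟨fun h => ⟨fun _ _ hxy => h.mono hxy, h.concave⟩,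
      fun h => ⟨fun _ _ hxy => h.1 _ _ hxy, h.2⟩⟩
  rw [hset]
  refine .inter (.iInter fun x => .iInter fun y => .iInter fun _ => measurableSet_le (hw x) (hw y))
    (.iInter fun x => .iInter fun y => .iInter fun z => .iInter fun _ => .iInter fun _ =>
      measurableSet_le ?_ ((hw y).const_mul _))
  exact ((hw x).const_mul _).add ((hw z).const_mul _)

variable {mΩ : MeasurableSpace Ω} {P : Measure Ω}

theorem ae_isMonotoneConcave (hmono : ∀ x y, x ≤ y → w x ≤ᵐ[P] w y)
    (hconc : ∀ x y z, x < y → y < z →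
      ∀ᵐ ω ∂P, (z - y) * w x ω + (y - x) * w z ω ≤ (z - x) * w y ω) :
    ∀ᵐ ω ∂P, IsMonotoneConcave fun r : ℚ => w r ω := by
  have hmono_rat : ∀ᵐ ω ∂P, ∀ x y : ℚ, x ≤ y → w x ω ≤ w y ω := by
    simp_rw [ae_all_iff]
    exact fun x y hxy => hmono x y (by exact_mod_cast hxy)
  have hconc_rat : ∀ᵐ ω ∂P, ∀ x y z : ℚ, x < y → y < z →
      ((z : ℝ) - y) * w x ω + ((y : ℝ) - x) * w z ω ≤ ((z : ℝ) - x) * w y ω := by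
    simp_rw [ae_all_iff]
    exact fun x y z hxy hyz => hconc x y z (by exact_mod_cast hxy) (by exact_mod_cast hyz)
  filter_upwards [hmono_rat, hconc_rat] with ω hω_mono hω_conc
    using ⟨fun _ _ => hω_mono _ _, hω_conc⟩

theorem exists_regular_version (hw : ∀ x, Measurable[m] (w x))
    (hmono : ∀ x y, x ≤ y → w x ≤ᵐ[P] w y)
    (hconc : ∀ x y z, x < y → y < z →
      ∀ᵐ ω ∂P, (z - y) * w x ω + (y - x) * w z ω ≤ (z - x) * w y ω) :
    ∃ W : ℝ → Ω → ℝ, (∀ x, Measurable[m] (W x)) ∧ (∀ ω, Monotone fun x => W x ω) ∧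
      (∀ ω, ConcaveOn ℝ Set.univ fun x => W x ω) ∧ ∀ x, W x =ᵐ[P] w x := by
  classical
  let N : Set Ω := {ω | IsMonotoneConcave fun r : ℚ => w r ω}
  refine ⟨fun x => N.indicator fun ω => leftExtension (fun r => w r ω) x, fun x => ?_, fun ω => ?_,
    fun ω => ?_, fun x => ?_⟩
  · exact (Measurable.iSup fun r : {r : ℚ // (r : ℝ) < x} => hw r).indicator
      (measurableSet_isMonotoneConcave hw)
  · by_cases hω : ω ∈ N
    · simpa only [Set.indicator_of_mem hω] using monotone_leftExtension hω.mono
    · simpa only [Set.indicator_of_notMem hω] using monotone_const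
  · by_cases hω : ω ∈ N
    · simpa only [Set.indicator_of_mem hω] using concaveOn_leftExtension hω
    · simpa only [Set.indicator_of_notMem hω] using concaveOn_const 0 convex_univ
  · have hlt : ∀ᵐ ω ∂P, ∀ r : ℚ, (r : ℝ) < x → w r ω ≤ w x ω := by
      simp_rw [ae_all_iff]
      exact fun r hr => hmono r x hr.le
    have hgt : ∀ᵐ ω ∂P, ∀ r : ℚ, x < (r : ℝ) → w x ω ≤ w r ω := by
      simp_rw [ae_all_iff]
      exact fun r hr => hmono x r hr.le
    filter_upwards [ae_isMonotoneConcave hmono hconc, hlt, hgt] with ω hω hω_lt hω_gt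
    rw [Set.indicator_of_mem (show ω ∈ N from hω)]
    exact leftExtension_eq hω hω_lt hω_gt

end Regularization

/-! ### The one-period value function -/

section ValueFunction

open Filter Topology

theorem le_of_forall_rat_le {f g : ℝ → ℝ} (hf : Continuous f) (hg : Continuous g)
    (h : ∀ r : ℚ, f r ≤ g r) (x : ℝ) : f x ≤ g x :=
  Rat.denseRange_cast.induction_on x (isClosed_le hf hg) h

theorem growth_of_forall_rat {f : ℝ → ℝ} (hf : Continuous f) {e C : ℝ}
    (h : ∀ x l : ℚ, 1 ≤ l → f (l * x) ≤ (l : ℝ) ^ e * (f x + C)) (x l : ℝ) (hl : 1 ≤ l) :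
    f (l * x) ≤ l ^ e * (f x + C) := by
  obtain ⟨u, -, hu, hul⟩ := Real.exists_seq_rat_strictAnti_tendsto l
  refine le_of_forall_rat_le (f := fun x => f (l * x)) (g := fun x => l ^ e * (f x + C))
    (by fun_prop) (by fun_prop) (fun r => ?_) x
  refine le_of_tendsto_of_tendsto' ((hf.tendsto _).comp (hul.mul_const (r : ℝ)))
    ((hul.rpow_const (Or.inl (by linarith))).mul_const _) fun n => ?_
  exact h r (u n) (by exact_mod_cast hl.trans (hu n).le)

namespace OnePeriod

variable {Ω : Type*} {m mΩ : MeasurableSpace Ω} {P : Measure Ω} {d : ℕ}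
  {Y : Ω → EuclideanSpace ℝ (Fin d)} {L : ℝ → ℝ} {p q C : ℝ} {V W : ℝ → Ω → ℝ}
  {X Z : Ω → ℝ} {ξ ζ : Ω → EuclideanSpace ℝ (Fin d)}

/-- `W` is a version, with nondecreasing and concave paths, of the value function of the one-period
problem: for every `m`-measurable initial capital `X`, random or not, `W(X)` is the largest
conditional expectation of the payoff, and it is attained. -/
structure IsValue (P : Measure[mΩ] Ω) (m : MeasurableSpace Ω)
    (Y : Ω → EuclideanSpace ℝ (Fin d)) (V W : ℝ → Ω → ℝ) : Prop where
  measurable : ∀ x, Measurable[m] (W x)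
  mono : ∀ ω, Monotone fun x => W x ω
  concave : ∀ ω, ConcaveOn ℝ Set.univ fun x => W x ω
  condMean_le : ∀ X : Ω → ℝ, Measurable[m] X → ∀ ξ ∈ positions P m V Y X, ∀ᵐ ω ∂P,
    condMean P m (payoff V Y X ξ) ω ≤ W (X ω) ω
  attained : ∀ X : Ω → ℝ, Measurable[m] X → ∃ ξ ∈ positions P m V Y X, ∀ᵐ ω ∂P,
    condMean P m (payoff V Y X ξ) ω = W (X ω) ω

theorem IsValue.continuous (hW : IsValue P m Y V W) (ω : Ω) : Continuous fun x => W x ω :=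
  continuous_of_concaveOn_univ (hW.concave ω)

variable [IsFiniteMeasure P]

theorem exists_position_of_le (h : OnePeriod P m Y L p q C V) (hX : Measurable[m] X)
    (hZ : Measurable[m] Z) (hξ : ξ ∈ positions P m V Y X) :
    ∃ ξ' ∈ positions P m V Y Z, ∀ᵐ ω ∂P, X ω ≤ Z ω →
      condMean P m (payoff V Y X ξ) ω ≤ condMean P m (payoff V Y Z ξ') ω := by
  let A : Set Ω := {ω | X ω ≤ Z ω}
  have hA : MeasurableSet[m] A := measurableSet_le hX hZ
  have hmeas : Measurable[m] (A.indicator ξ) := hξ.1.indicator hA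
  have hle (ω : Ω) (hω : ω ∈ A) : payoff V Y X ξ ω ≤ payoff V Y Z (A.indicator ξ) ω := by
    simp only [payoff, Set.indicator_of_mem hω]
    exact h.utility.mono ω (add_le_add_left hω _)
  have hint : CondIntegrable P m (payoff V Y Z (A.indicator ξ)) := by
    refine h.condIntegrable_payoff hZ hmeas
      (hξ.2.abs.add (h.condIntegrable_payoff_zero hZ).abs).neg (ae_of_all _ fun ω => ?_)
    by_cases hω : ω ∈ A
    · linarith [hle ω hω, neg_abs_le (payoff V Y X ξ ω), abs_nonneg (payoff V Y Z 0 ω)]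
    · have hzero : payoff V Y Z (A.indicator ξ) ω = payoff V Y Z 0 ω := by
        simp only [payoff, Set.indicator_of_notMem hω, Pi.zero_apply]
      rw [hzero]
      linarith [neg_abs_le (payoff V Y Z 0 ω), abs_nonneg (payoff V Y X ξ ω)]
  exact ⟨_, ⟨hmeas, hint⟩, condMean_mono_on h.le hξ.2 hint hA (ae_of_all _ hle)⟩

theorem condMean_le_of_optimal (h : OnePeriod P m Y L p q C V) (hX : Measurable[m] X)
    (hZ : Measurable[m] Z) (hξ : ξ ∈ positions P m V Y X)
    (hopt : ∀ ζ' ∈ positions P m V Y Z,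
      condMean P m (payoff V Y Z ζ') ≤ᵐ[P] condMean P m (payoff V Y Z ζ)) :
    ∀ᵐ ω ∂P, X ω ≤ Z ω →
      condMean P m (payoff V Y X ξ) ω ≤ condMean P m (payoff V Y Z ζ) ω := by
  obtain ⟨ξ', hξ', hle⟩ := h.exists_position_of_le hX hZ hξ
  filter_upwards [hle, hopt ξ' hξ'] with ω hω hω_opt hω_le using (hω hω_le).trans hω_opt

theorem exists_position_of_convexCombination (h : OnePeriod P m Y L p q C V)
    (hX : Measurable[m] X) (hZ : Measurable[m] Z) {a b : ℝ} (ha : 0 ≤ a) (hb : 0 ≤ b)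
    (hab : a + b = 1) (hξ : ξ ∈ positions P m V Y X) (hζ : ζ ∈ positions P m V Y Z) :
    ∃ η ∈ positions P m V Y fun ω => a * X ω + b * Z ω, ∀ᵐ ω ∂P,
      a * condMean P m (payoff V Y X ξ) ω + b * condMean P m (payoff V Y Z ζ) ω ≤
        condMean P m (payoff V Y (fun ω => a * X ω + b * Z ω) η) ω := by
  have hle (ω : Ω) : a * payoff V Y X ξ ω + b * payoff V Y Z ζ ω ≤
      payoff V Y (fun ω => a * X ω + b * Z ω) (fun ω => a • ξ ω + b • ζ ω) ω := by
    have hwealth : a * X ω + b * Z ω + inner ℝ (a • ξ ω + b • ζ ω) (Y ω) =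
        a • (X ω + inner ℝ (ξ ω) (Y ω)) + b • (Z ω + inner ℝ (ζ ω) (Y ω)) := by
      simp only [inner_add_left, real_inner_smul_left, smul_eq_mul]
      ring
    simp only [payoff, hwealth]
    exact (h.utility.concave ω).2 (Set.mem_univ _) (Set.mem_univ _) ha hb hab
  have hη : Measurable[m] fun ω => a • ξ ω + b • ζ ω :=
    (hξ.1.const_smul a).add (hζ.1.const_smul b)
  have hξ_int := hξ.2.mul_left h.le (r := fun _ => a) measurable_const
  have hζ_int := hζ.2.mul_left h.le (r := fun _ => b) measurable_const
  have hint := h.condIntegrable_payoff ((hX.const_mul a).add (hZ.const_mul b)) hη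
    (hξ_int.add hζ_int) (ae_of_all _ hle)
  refine ⟨_, ⟨hη, hint⟩, ?_⟩
  filter_upwards [condMean_mono (hξ_int.add hζ_int) hint (ae_of_all _ hle),
    condMean_add hξ_int hζ_int,
    condMean_mul_left h.le (r := fun _ => a) measurable_const hξ.2,
    condMean_mul_left h.le (r := fun _ => b) measurable_const hζ.2] with ω hω_le hω_add hω_ξ hω_ζ
  rwa [hω_add, hω_ξ, hω_ζ] at hω_le

theorem condMean_concave_of_optimal (h : OnePeriod P m Y L p q C V) {x y z : ℝ} (hxy : x < y)
    (hyz : y < z) {η : Ω → EuclideanSpace ℝ (Fin d)}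
    (hξ : ξ ∈ positions P m V Y fun _ => x) (hζ : ζ ∈ positions P m V Y fun _ => z)
    (hopt : ∀ η' ∈ positions P m V Y fun _ => y,
      condMean P m (payoff V Y (fun _ => y) η') ≤ᵐ[P] condMean P m (payoff V Y (fun _ => y) η)) :
    ∀ᵐ ω ∂P, (z - y) * condMean P m (payoff V Y (fun _ => x) ξ) ω +
        (y - x) * condMean P m (payoff V Y (fun _ => z) ζ) ω ≤
      (z - x) * condMean P m (payoff V Y (fun _ => y) η) ω := by
  have hzx : 0 < z - x := by linarith
  have hy : (z - y) / (z - x) * x + (y - x) / (z - x) * z = y := by field_simp; ring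
  obtain ⟨η', hη', hle⟩ := h.exists_position_of_convexCombination measurable_const measurable_const
    (div_nonneg (sub_nonneg.2 hyz.le) hzx.le) (div_nonneg (sub_nonneg.2 hxy.le) hzx.le)
    (by field_simp; ring) hξ hζ
  rw [hy] at hη' hle
  filter_upwards [hle, hopt η' hη'] with ω hω hω_opt
  have hscaled := mul_le_mul_of_nonneg_left (hω.trans hω_opt) hzx.le
  rwa [mul_add, ← mul_assoc, ← mul_assoc, mul_div_cancel₀ _ hzx.ne',
    mul_div_cancel₀ _ hzx.ne'] at hscaled

theorem exists_position_of_scaling (h : OnePeriod P m Y L p q C V) {e : ℝ}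
    (hgrowth : ∀ᵐ ω ∂P, ∀ x l : ℝ, 1 ≤ l → V (l * x) ω ≤ l ^ e * (V x ω + C))
    (hX : Measurable[m] X) {l : ℝ} (hl : 1 ≤ l) (hξ : ξ ∈ positions P m V Y fun ω => l * X ω) :
    ∃ η ∈ positions P m V Y X, ∀ᵐ ω ∂P,
      condMean P m (payoff V Y (fun ω => l * X ω) ξ) ω ≤
        l ^ e * (condMean P m (payoff V Y X η) ω + C) := by
  have hl_pos : 0 < l := zero_lt_one.trans_le hl
  have hpow_pos : 0 < l ^ e := Real.rpow_pos_of_pos hl_pos e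
  have hle : ∀ᵐ ω ∂P, (l ^ e)⁻¹ * payoff V Y (fun ω => l * X ω) ξ ω + -C ≤
      payoff V Y X (fun ω => l⁻¹ • ξ ω) ω := by
    filter_upwards [hgrowth] with ω hω
    have hwealth : l * (X ω + inner ℝ (l⁻¹ • ξ ω) (Y ω)) = l * X ω + inner ℝ (ξ ω) (Y ω) := by
      rw [real_inner_smul_left, mul_add, mul_inv_cancel_left₀ hl_pos.ne']
    have hω_scaled := hω (X ω + inner ℝ (l⁻¹ • ξ ω) (Y ω)) l hl
    rw [hwealth] at hω_scaled
    exact add_neg_le_iff_le_add.2 ((inv_mul_le_iff₀ hpow_pos).2 hω_scaled)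
  have hη : Measurable[m] fun ω => l⁻¹ • ξ ω := hξ.1.const_smul (l⁻¹ : ℝ)
  have hξ_int := hξ.2.mul_left h.le (r := fun _ => (l ^ e)⁻¹) measurable_const
  have hC_int := CondIntegrable.of_measurable (P := P) h.le (f := fun _ => -C) measurable_const
  have hint := h.condIntegrable_payoff hX hη (hξ_int.add hC_int) hle
  refine ⟨_, ⟨hη, hint⟩, ?_⟩
  filter_upwards [condMean_mono (hξ_int.add hC_int) hint hle, condMean_add hξ_int hC_int,
    condMean_mul_left h.le (r := fun _ => (l ^ e)⁻¹) measurable_const hξ.2]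
    with ω hω_le hω_add hω_mul
  rw [hω_add, hω_mul, condMean_of_measurable h.le measurable_const] at hω_le
  exact (inv_mul_le_iff₀ hpow_pos).1 (add_neg_le_iff_le_add.1 hω_le)

/-- Regularize the optimal values at deterministic capital; a random capital is then squeezed
between rational constants. -/
theorem exists_isValue (h : OnePeriod P m Y L p q C V) : ∃ W, IsValue P m Y V W := by
  choose ξ hξ hopt using fun x : ℝ => h.exists_optimal_position (X := fun _ => x) measurable_const
  obtain ⟨W, hW_meas, hW_mono, hW_conc, hW_eq⟩ := exists_regular_version (P := P)
    (w := fun x => condMean P m (payoff V Y (fun _ => x) (ξ x)))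
    (fun x => measurable_condMean _ _ _)
    (fun x y hxy => (h.condMean_le_of_optimal measurable_const measurable_const (hξ x)
      (hopt y)).mono fun _ hω => hω hxy)
    (fun x y z hxy hyz => h.condMean_concave_of_optimal hxy hyz (hξ x) (hξ z) (hopt y))
  have hcont (ω : Ω) : Continuous fun x => W x ω := continuous_of_concaveOn_univ (hW_conc ω)
  have hle (X : Ω → ℝ) (hX : Measurable[m] X) (ζ) (hζ : ζ ∈ positions P m V Y X) :
      ∀ᵐ ω ∂P, condMean P m (payoff V Y X ζ) ω ≤ W (X ω) ω := by
    filter_upwards [ae_all_iff.2 fun r : ℚ =>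
        h.condMean_le_of_optimal hX measurable_const hζ (hopt r),
      ae_all_iff.2 fun r : ℚ => hW_eq r] with ω hω_le hω_eq
    obtain ⟨u, -, hu, hux⟩ := Real.exists_seq_rat_strictAnti_tendsto (X ω)
    refine ge_of_tendsto' (((hcont ω).tendsto _).comp hux) fun n => ?_
    exact (hω_le _ (hu n).le).trans_eq (hω_eq (u n)).symm
  refine ⟨W, hW_meas, hW_mono, hW_conc, hle, fun X hX => ?_⟩
  obtain ⟨ζ, hζ, hζ_opt⟩ := h.exists_optimal_position hX
  refine ⟨ζ, hζ, ?_⟩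
  filter_upwards [hle X hX ζ hζ, ae_all_iff.2 fun r : ℚ =>
      h.condMean_le_of_optimal measurable_const hX (hξ r) hζ_opt,
    ae_all_iff.2 fun r : ℚ => hW_eq r] with ω hω_le hω_ge hω_eq
  refine hω_le.antisymm ?_
  obtain ⟨u, -, hu, hux⟩ := Real.exists_seq_rat_strictMono_tendsto (X ω)
  refine le_of_tendsto' (((hcont ω).tendsto _).comp hux) fun n => ?_
  exact (hω_eq (u n)).trans_le (hω_ge _ (hu n).le)

namespace IsValue

theorem lower (hW : IsValue P m Y V W) (h : OnePeriod P m Y L p q C V) :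
    ∀ᵐ ω ∂P, ∀ x, L x ≤ W x ω := by
  have hlower (x : ℝ) : ∀ᵐ ω ∂P, L x ≤ W x ω := by
    have hL : CondIntegrable P m fun _ => L x := CondIntegrable.of_measurable h.le measurable_const
    have hpayoff : ∀ᵐ ω ∂P, L x ≤ payoff V Y (fun _ => x) 0 ω :=
      h.utility.lower.mono fun ω hω => by
        simpa only [payoff, Pi.zero_apply, inner_zero_left, add_zero] using hω x
    have hzero := h.zero_mem_positions (X := fun _ => x) measurable_const
    filter_upwards [hW.condMean_le _ measurable_const 0 hzero, condMean_mono hL hzero.2 hpayoff]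
      with ω hω_W hω_L
    rw [condMean_of_measurable h.le measurable_const] at hω_L
    exact hω_L.trans hω_W
  filter_upwards [ae_all_iff.2 fun r : ℚ => hlower r] with ω hω
  exact le_of_forall_rat_le h.continuous_lower (hW.continuous ω) hω

theorem growth (hW : IsValue P m Y V W) (h : OnePeriod P m Y L p q C V) {e : ℝ}
    (hgrowth : ∀ᵐ ω ∂P, ∀ x l : ℝ, 1 ≤ l → V (l * x) ω ≤ l ^ e * (V x ω + C)) :
    ∀ᵐ ω ∂P, ∀ x l : ℝ, 1 ≤ l → W (l * x) ω ≤ l ^ e * (W x ω + C) := by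
  have hrat : ∀ᵐ ω ∂P, ∀ x l : ℚ, 1 ≤ l → W (l * x) ω ≤ (l : ℝ) ^ e * (W x ω + C) := by
    simp_rw [ae_all_iff]
    intro x l hl
    have hl_real : (1 : ℝ) ≤ l := by exact_mod_cast hl
    obtain ⟨ξ, hξ, hξW⟩ := hW.attained (fun _ => (l : ℝ) * x) measurable_const
    obtain ⟨η, hη, hle⟩ := h.exists_position_of_scaling hgrowth measurable_const hl_real hξ
    filter_upwards [hξW, hle, hW.condMean_le _ measurable_const η hη] with ω hω_eq hω_le hω_W
    rw [← hω_eq]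
    exact hω_le.trans (by gcongr)
  filter_upwards [hrat] with ω hω using growth_of_forall_rat (hW.continuous ω) hω

/-- On the event that `W` is bounded below by `-M`, orthogonal optimal positions for the capitals
`-n` are bounded together with these capitals, which is absurd. -/
theorem ae_exists_lt (hW : IsValue P m Y V W) (h : OnePeriod P m Y L p q C V) (M : ℝ) :
    ∀ᵐ ω ∂P, ∃ n : ℕ, W (-n) ω < M := by
  let A : Set Ω := ⋂ n : ℕ, {ω | M ≤ W (-n) ω}
  have hA : MeasurableSet[m] A :=
    .iInter fun n => measurableSet_le measurable_const (hW.measurable _)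
  let X : ℕ → Ω → ℝ := fun n => A.indicator fun _ => -(n : ℝ)
  have hX (n : ℕ) : Measurable[m] (X n) := measurable_const.indicator hA
  have hX_le (n : ℕ) (ω : Ω) : X n ω ≤ 0 :=
    Set.indicator_apply_le' (fun _ => neg_nonpos.2 n.cast_nonneg) fun _ => le_rfl
  choose ξ hξ hξW using fun n => hW.attained (X n) (hX n)
  choose ξ' hξ' hmean horth using fun n => h.exists_orthogonal_mem_positions (hX n) (hξ n)
  have hlower (n : ℕ) : (fun ω => min M (W 0 ω)) ≤ᵐ[P] condMean P m (payoff V Y (X n) (ξ' n)) := by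
    filter_upwards [hmean n, hξW n] with ω hω_mean hω_W
    rw [hω_mean, hω_W]
    by_cases hω : ω ∈ A
    · simp only [X, Set.indicator_of_mem hω]
      exact (min_le_left _ _).trans (Set.mem_iInter.1 hω n)
    · simp only [X, Set.indicator_of_notMem hω]
      exact min_le_right _ _
  filter_upwards [h.ae_bddAbove_size (measurable_const.min (hW.measurable 0)) hX
    (fun n => (hξ' n).1) hX_le (fun n => (hξ' n).2) hlower horth] with ω ⟨K, hK⟩
  by_contra! hge
  have hωA : ω ∈ A := Set.mem_iInter.2 hge
  obtain ⟨n, hn⟩ := exists_nat_gt K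
  refine absurd ((abs_le_size (X n ω) (ξ' n ω)).trans (hK (Set.mem_range_self n))) (not_le.2 ?_)
  simpa only [X, Set.indicator_of_mem hωA, abs_neg, Nat.abs_cast] using hn

theorem tendsto_atBot (hW : IsValue P m Y V W) (h : OnePeriod P m Y L p q C V) :
    ∀ᵐ ω ∂P, Tendsto (fun n : ℕ => W (-n) ω) atTop atBot := by
  filter_upwards [ae_all_iff.2 fun M : ℕ => hW.ae_exists_lt h (-M)] with ω hω
  have hanti : Antitone fun n : ℕ => W (-n) ω := fun n k hnk =>
    hW.mono ω (neg_le_neg (Nat.cast_le.2 hnk))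
  refine tendsto_atTop_atBot_of_antitone hanti fun a => ?_
  obtain ⟨M, hM⟩ := exists_nat_gt (-a)
  obtain ⟨n, hn⟩ := hω M
  exact ⟨n, by linarith⟩

theorem randomUtility (hW : IsValue P m Y V W) (h : OnePeriod P m Y L p q C V) :
    RandomUtility P m L p q C W where
  measurable := hW.measurable
  mono := hW.mono
  concave := hW.concave
  lower := hW.lower h
  growth := by
    have hp := hW.growth h (h.utility.growth.mono fun ω hω x l hl => (hω x l hl).1)
    have hq := hW.growth h (h.utility.growth.mono fun ω hω x l hl => (hω x l hl).2)
    filter_upwards [hp, hq] with ω hω_p hω_q x l hl using ⟨hω_p x l hl, hω_q x l hl⟩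
  tendsto_atBot := hW.tendsto_atBot h

end IsValue

end OnePeriod

end ValueFunction

/-! ### Integrability of optimal payoffs -/

section Integrability

open Filter Topology
open scoped ENNReal

section CondMean

variable {Ω : Type*} {m mΩ : MeasurableSpace Ω} {P : Measure Ω} {f G : Ω → ℝ}

theorem integrable_of_lintegral_ofReal_ne_top (hf : AEMeasurable f P)
    (hpos : ∫⁻ ω, ENNReal.ofReal (f ω) ∂P ≠ ⊤) (hneg : ∫⁻ ω, ENNReal.ofReal (-f ω) ∂P ≠ ⊤) :
    Integrable f P := by
  refine ((integrable_toReal_of_lintegral_ne_top hf.ennreal_ofReal hpos).sub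
    (integrable_toReal_of_lintegral_ne_top hf.neg.ennreal_ofReal hneg)).congr
      (ae_of_all _ fun ω => ?_)
  simp only [Pi.sub_apply, Pi.neg_apply, ENNReal.toReal_ofReal', max_zero_sub_max_neg_zero_eq_self]

theorem integrable_toReal_condLExp_ofReal (hm : m ≤ mΩ) [SigmaFinite (P.trim hm)]
    (hf : Integrable f P) :
    Integrable (fun ω => (P⁻[fun ω => ENNReal.ofReal (f ω) | m] ω).toReal) P := by
  refine integrable_toReal_of_lintegral_ne_top (measurable_condLExp' m P _).aemeasurable ?_
  rw [lintegral_condLExp hm]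
  exact hf.lintegral_lt_top.ne

theorem integral_toReal_condLExp_ofReal (hm : m ≤ mΩ) [SigmaFinite (P.trim hm)]
    (hf : Integrable f P) :
    ∫ ω, (P⁻[fun ω => ENNReal.ofReal (f ω) | m] ω).toReal ∂P =
      (∫⁻ ω, ENNReal.ofReal (f ω) ∂P).toReal := by
  have hmeas := (measurable_condLExp' m P fun ω => ENNReal.ofReal (f ω)).aemeasurable (μ := P)
  have hfin : ∫⁻ ω, P⁻[fun ω => ENNReal.ofReal (f ω) | m] ω ∂P ≠ ⊤ := by
    rw [lintegral_condLExp hm]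
    exact hf.lintegral_lt_top.ne
  rw [integral_toReal hmeas (ae_lt_top' hmeas hfin), lintegral_condLExp hm]

theorem integrable_condMean (hm : m ≤ mΩ) [SigmaFinite (P.trim hm)] (hf : Integrable f P) :
    Integrable (condMean P m f) P :=
  (integrable_toReal_condLExp_ofReal hm hf).sub (integrable_toReal_condLExp_ofReal hm hf.neg)

theorem integral_condMean (hm : m ≤ mΩ) [SigmaFinite (P.trim hm)] (hf : Integrable f P) :
    ∫ ω, condMean P m f ω ∂P = ∫ ω, f ω ∂P := by
  rw [integral_eq_lintegral_pos_part_sub_lintegral_neg_part hf,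
    ← integral_toReal_condLExp_ofReal hm hf]
  refine (integral_sub (integrable_toReal_condLExp_ofReal hm hf)
    (integrable_toReal_condLExp_ofReal hm hf.neg)).trans ?_
  exact congrArg _ (integral_toReal_condLExp_ofReal hm hf.neg)

theorem genCondExp_congr_on (hm : m ≤ mΩ) [SigmaFinite (P.trim hm)] (hf : Measurable f)
    (hG : Measurable G) {A : Set Ω} (hA : MeasurableSet[m] A)
    (h : ∀ᵐ ω ∂P, ω ∈ A → f ω = G ω) :
    ∀ᵐ ω ∂P, ω ∈ A → genCondExp P m f ω = genCondExp P m G ω := by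
  have hpos := condLExp_congr_on (P := P) hm hf.ennreal_ofReal hG.ennreal_ofReal hA
    (h.mono fun ω hω hωA => congrArg ENNReal.ofReal (hω hωA))
  have hneg := condLExp_congr_on (P := P) hm hf.neg.ennreal_ofReal hG.neg.ennreal_ofReal hA
    (h.mono fun ω hω hωA => congrArg (fun x => ENNReal.ofReal (-x)) (hω hωA))
  filter_upwards [hpos, hneg] with ω hω_pos hω_neg hωA
  have hω_neg' := hω_neg hωA
  simp only [Pi.neg_apply] at hω_neg'
  simp only [genCondExp, hω_pos hωA, hω_neg']

theorem genCondExp_eq_bot {ω : Ω} (hpos : P⁻[fun ω => ENNReal.ofReal (f ω) | m] ω < ⊤)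
    (hneg : P⁻[fun ω => ENNReal.ofReal (-f ω) | m] ω = ⊤) : genCondExp P m f ω = ⊥ := by
  rw [genCondExp, hneg, EReal.coe_ennreal_top]
  lift P⁻[fun ω => ENNReal.ofReal (f ω) | m] ω to NNReal using hpos.ne with x
  simp

namespace CondIntegrable

theorem max_zero (hf : CondIntegrable P m f) : CondIntegrable P m fun ω => max (f ω) 0 :=
  hf.mono (hf.measurable.max measurable_const) (ae_of_all _ fun ω => by
    rw [abs_of_nonneg (le_max_right _ _)]
    exact max_le (le_abs_self _) (abs_nonneg _))

theorem ofReal_neg_condMean_le (hf : CondIntegrable P m f) :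
    (fun ω => ENNReal.ofReal (-condMean P m f ω)) ≤ᵐ[P]
      P⁻[fun ω => ENNReal.ofReal (-f ω) | m] := by
  filter_upwards [hf.neg.condLExp_ofReal_lt_top] with ω hω
  rw [← ENNReal.ofReal_toReal hω.ne]
  refine ENNReal.ofReal_le_ofReal ?_
  rw [condMean, neg_sub]
  exact sub_le_self _ ENNReal.toReal_nonneg

theorem condLExp_ofReal_le_add (hf : CondIntegrable P m f) :
    P⁻[fun ω => ENNReal.ofReal (f ω) | m] ≤ᵐ[P] fun ω =>
      ENNReal.ofReal (condMean P m f ω) + P⁻[fun ω => ENNReal.ofReal (-f ω) | m] ω := by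
  filter_upwards [hf.condLExp_ofReal_lt_top, hf.neg.condLExp_ofReal_lt_top] with ω hpos hneg
  calc P⁻[fun ω => ENNReal.ofReal (f ω) | m] ω
      = ENNReal.ofReal (condMean P m f ω +
          (P⁻[fun ω => ENNReal.ofReal (-f ω) | m] ω).toReal) := by
        rw [condMean, sub_add_cancel, ENNReal.ofReal_toReal hpos.ne]
    _ ≤ ENNReal.ofReal (condMean P m f ω) + P⁻[fun ω => ENNReal.ofReal (-f ω) | m] ω :=
        ENNReal.ofReal_add_le.trans_eq (by rw [ENNReal.ofReal_toReal hneg.ne])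

theorem integrable_of_condMean_le (hm : m ≤ mΩ) [SigmaFinite (P.trim hm)]
    (hf : CondIntegrable P m f) (hG : Integrable G P) (hle : condMean P m f ≤ᵐ[P] G)
    (hneg : ∫⁻ ω, ENNReal.ofReal (-f ω) ∂P ≠ ⊤) : Integrable f P := by
  refine integrable_of_lintegral_ofReal_ne_top hf.measurable.aemeasurable
    (ne_of_lt ?_) hneg
  calc ∫⁻ ω, ENNReal.ofReal (f ω) ∂P
      = ∫⁻ ω, P⁻[fun ω => ENNReal.ofReal (f ω) | m] ω ∂P := (lintegral_condLExp hm _ _).symm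
    _ ≤ ∫⁻ ω, ENNReal.ofReal (G ω) + P⁻[fun ω => ENNReal.ofReal (-f ω) | m] ω ∂P := by
        refine lintegral_mono_ae ?_
        filter_upwards [hf.condLExp_ofReal_le_add, hle] with ω hω hω_le
        exact hω.trans (by gcongr)
    _ = ∫⁻ ω, ENNReal.ofReal (G ω) ∂P + ∫⁻ ω, ENNReal.ofReal (-f ω) ∂P := by
        rw [lintegral_add_right _ (measurable_condLExp' _ _ _), lintegral_condLExp hm]
    _ < ⊤ := ENNReal.add_lt_top.2 ⟨hG.lintegral_lt_top, hneg.lt_top⟩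

end CondIntegrable

end CondMean

namespace OnePeriod

variable {Ω : Type*} {m mΩ : MeasurableSpace Ω} {P : Measure Ω} {d : ℕ}
  {Y : Ω → EuclideanSpace ℝ (Fin d)} {L : ℝ → ℝ} {p q C : ℝ} {V W : ℝ → Ω → ℝ}
  {X : Ω → ℝ} {ξ : Ω → EuclideanSpace ℝ (Fin d)}

/-- Half of the capital and of the position: gains shrink at most by the factor `2^p`, while
losses shrink at least by the larger factor `2^q`. -/
theorem le_payoff_half (h : OnePeriod P m Y L p q C V) (X : Ω → ℝ)
    (ξ : Ω → EuclideanSpace ℝ (Fin d)) :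
    ∀ᵐ ω ∂P, ((2 ^ p)⁻¹ - (2 ^ q)⁻¹) * max (payoff V Y X ξ ω) 0 +
        ((2 ^ q)⁻¹ * payoff V Y X ξ ω + -C) ≤
      payoff V Y (fun ω => (1 / 2) * X ω) (fun ω => (1 / 2 : ℝ) • ξ ω) ω := by
  filter_upwards [h.utility.growth] with ω hω
  have hwealth : 2 * ((1 / 2) * X ω + inner ℝ ((1 / 2 : ℝ) • ξ ω) (Y ω)) =
      X ω + inner ℝ (ξ ω) (Y ω) := by
    rw [real_inner_smul_left]
    ring
  obtain ⟨hgain, hloss⟩ := hω ((1 / 2) * X ω + inner ℝ ((1 / 2 : ℝ) • ξ ω) (Y ω)) 2 one_le_two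
  rw [hwealth, ← inv_mul_le_iff₀ (by positivity)] at hgain hloss
  simp only [payoff]
  rcases le_total 0 (V (X ω + inner ℝ (ξ ω) (Y ω)) ω) with hsign | hsign
  · rw [max_eq_left hsign]
    linarith
  · rw [max_eq_right hsign]
    linarith

theorem IsValue.half_le (hW : IsValue P m Y V W) (x : ℝ) (ω : Ω) :
    W ((1 / 2) * x) ω ≤ |W x ω| + |W 0 ω| := by
  rcases le_total 0 x with hx | hx
  · exact ((hW.mono ω (by linarith : (1 / 2) * x ≤ x)).trans (le_abs_self _)).trans
      (le_add_of_nonneg_right (abs_nonneg _))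
  · exact ((hW.mono ω (by linarith : (1 / 2) * x ≤ 0)).trans (le_abs_self _)).trans
      (le_add_of_nonneg_left (abs_nonneg _))

variable [IsFiniteMeasure P]

theorem condLExp_payoff_lt_top (h : OnePeriod P m Y L p q C V) (hX : Measurable[m] X)
    (hξ : Measurable[m] ξ) :
    ∀ᵐ ω ∂P, P⁻[fun ω => ENNReal.ofReal (payoff V Y X ξ ω) | m] ω < ⊤ := by
  have hsize : Measurable[m] fun ω => (1 + |X ω| + ‖ξ ω‖) ^ p := by fun_prop
  have hle : ∀ᵐ ω ∂P, payoff V Y X ξ ω ≤ (1 + |X ω| + ‖ξ ω‖) ^ p * dominant V Y C ω := by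
    filter_upwards [h.payoff_le_dominant] with ω hω
    refine hω _ _ _ ?_ ?_ ?_ <;>
      linarith [abs_nonneg (X ω), le_abs_self (X ω), norm_nonneg (ξ ω)]
  filter_upwards [(h.condIntegrable_dominant.mul_left h.le hsize).condLExp_ofReal_lt_top,
    condLExp_ofReal_mono (m := m) hle] with ω hω hω_le using hω_le.trans_lt hω

theorem mem_positions (h : OnePeriod P m Y L p q C V) (hX : Measurable[m] X)
    (hξ : Measurable[m] ξ)
    (hneg : ∀ᵐ ω ∂P, P⁻[fun ω => ENNReal.ofReal (-payoff V Y X ξ ω) | m] ω < ⊤) :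
    ξ ∈ positions P m V Y X :=
  ⟨hξ, .of_condLExp_lt_top (h.measurable_payoff (hX.mono h.le le_rfl) (hξ.mono h.le le_rfl))
    (h.condLExp_payoff_lt_top hX hξ) hneg⟩

theorem indicator_mem_positions (h : OnePeriod P m Y L p q C V) (hX : Measurable[m] X)
    (hξ : Measurable[m] ξ) {A : Set Ω} (hA : MeasurableSet[m] A)
    (hneg : ∀ ω ∈ A, P⁻[fun ω => ENNReal.ofReal (-payoff V Y X ξ ω) | m] ω < ⊤) :
    A.indicator ξ ∈ positions P m V Y X := by
  have hζ : Measurable[m] (A.indicator ξ) := hξ.indicator hA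
  have hmeas {η : Ω → EuclideanSpace ℝ (Fin d)} (hη : Measurable[m] η) :
      Measurable fun ω => ENNReal.ofReal (-payoff V Y X η ω) :=
    (h.measurable_payoff (hX.mono h.le le_rfl) (hη.mono h.le le_rfl)).neg.ennreal_ofReal
  refine h.mem_positions hX hζ ?_
  filter_upwards [condLExp_congr_on (P := P) h.le (hmeas hζ) (hmeas hξ) hA
      (ae_of_all _ fun ω hω => by simp only [payoff, Set.indicator_of_mem hω]),
    condLExp_congr_on (P := P) h.le (hmeas hζ) (hmeas (measurable_const (a := 0))) hA.compl
      (ae_of_all _ fun ω hω => by simp only [payoff, Set.indicator_of_notMem hω]),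
    (h.condIntegrable_payoff_zero hX).neg.condLExp_ofReal_lt_top] with ω hω_mem hω_compl hω_zero
  by_cases hω : ω ∈ A
  · exact (hω_mem hω).trans_lt (hneg ω hω)
  · exact (hω_compl hω).trans_lt hω_zero

namespace IsValue

theorem genCondExp_payoff_le (hW : IsValue P m Y V W) (h : OnePeriod P m Y L p q C V)
    (hX : Measurable[m] X) (hξ : Measurable[m] ξ) :
    ∀ᵐ ω ∂P, genCondExp P m (payoff V Y X ξ) ω ≤ (W (X ω) ω : EReal) := by
  let A : Set Ω := {ω | P⁻[fun ω => ENNReal.ofReal (-payoff V Y X ξ ω) | m] ω < ⊤}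
  have hA : MeasurableSet[m] A := measurableSet_lt (measurable_condLExp _ _ _) measurable_const
  have hmem : A.indicator ξ ∈ positions P m V Y X :=
    h.indicator_mem_positions hX hξ hA fun _ hω => hω
  have hmeas : Measurable (payoff V Y X ξ) :=
    h.measurable_payoff (hX.mono h.le le_rfl) (hξ.mono h.le le_rfl)
  filter_upwards [genCondExp_congr_on h.le hmeas hmem.2.measurable hA
      (ae_of_all _ fun ω hω => by simp only [payoff, Set.indicator_of_mem hω]),
    hW.condMean_le X hX _ hmem, genCondExp_eq_condMean hmem.2,
    h.condLExp_payoff_lt_top hX hξ] with ω hω_congr hω_le hω_mean hω_pos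
  by_cases hω : ω ∈ A
  · rw [hω_congr hω, hω_mean]
    exact_mod_cast hω_le
  · rw [genCondExp_eq_bot hω_pos (not_lt_top_iff.1 hω)]
    exact bot_le

theorem lintegral_ofReal_neg_le (hW : IsValue P m Y V W) (h : OnePeriod P m Y L p q C V)
    (hX : Measurable[m] X) (hξ : ξ ∈ positions P m V Y X) :
    ∫⁻ ω, ENNReal.ofReal (-W (X ω) ω) ∂P ≤ ∫⁻ ω, ENNReal.ofReal (-payoff V Y X ξ ω) ∂P := by
  rw [← lintegral_condLExp h.le P fun ω => ENNReal.ofReal (-payoff V Y X ξ ω)]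
  refine lintegral_mono_ae ?_
  filter_upwards [hW.condMean_le X hX ξ hξ, hξ.2.ofReal_neg_condMean_le] with ω hω_W hω
  exact (ENNReal.ofReal_le_ofReal (neg_le_neg hω_W)).trans hω

theorem integrable_payoff (hW : IsValue P m Y V W) (h : OnePeriod P m Y L p q C V)
    (hX : Measurable[m] X) (hξ : ξ ∈ positions P m V Y X)
    (hneg : ∫⁻ ω, ENNReal.ofReal (-payoff V Y X ξ ω) ∂P ≠ ⊤)
    (hWX : Integrable (fun ω => W (X ω) ω) P) : Integrable (payoff V Y X ξ) P :=
  hξ.2.integrable_of_condMean_le h.le hWX (hW.condMean_le X hX ξ hξ) hneg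

theorem integral_payoff_le (hW : IsValue P m Y V W) (h : OnePeriod P m Y L p q C V)
    (hX : Measurable[m] X) (hξ : ξ ∈ positions P m V Y X) (hint : Integrable (payoff V Y X ξ) P)
    (hWX : Integrable (fun ω => W (X ω) ω) P) :
    ∫ ω, payoff V Y X ξ ω ∂P ≤ ∫ ω, W (X ω) ω ∂P := by
  rw [← integral_condMean h.le hint]
  exact integral_mono_ae (integrable_condMean h.le hint) hWX (hW.condMean_le X hX ξ hξ)

theorem integrable_zero (hW : IsValue P m Y V W) (h : OnePeriod P m Y L p q C V)
    (hW_int : Integrable (W 0) P) : Integrable (V 0) P := by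
  have hzero : payoff V Y (fun _ => 0) 0 = V 0 := by
    ext ω
    simp [payoff]
  rw [← hzero]
  refine hW.integrable_payoff h measurable_const (h.zero_mem_positions measurable_const)
    (ne_top_of_le_ne_top (b := ∫⁻ _, ENNReal.ofReal (-L 0) ∂P)
      (by simp [ENNReal.mul_eq_top]) (lintegral_mono_ae ?_)) hW_int
  filter_upwards [h.utility.lower] with ω hω
  rw [hzero]
  exact ENNReal.ofReal_le_ofReal (neg_le_neg (hω 0))

theorem condMean_max_zero_le_of_optimal (hW : IsValue P m Y V W)
    (h : OnePeriod P m Y L p q C V) (hX : Measurable[m] X) (hξ : ξ ∈ positions P m V Y X)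
    (hopt : ∀ᵐ ω ∂P, condMean P m (payoff V Y X ξ) ω = W (X ω) ω) :
    ∀ᵐ ω ∂P, condMean P m (fun ω => max (payoff V Y X ξ ω) 0) ω ≤
      ((2 ^ p)⁻¹ - (2 ^ q)⁻¹)⁻¹ *
        (W ((1 / 2) * X ω) ω - (2 ^ q)⁻¹ * W (X ω) ω + C) := by
  have hpq : 0 < ((2 : ℝ) ^ p)⁻¹ - (2 ^ q)⁻¹ := sub_pos.2 <| inv_strictAnti₀ (by positivity)
    (Real.rpow_lt_rpow_of_exponent_lt one_lt_two h.p_lt_q)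
  have hgain := hξ.2.max_zero.mul_left h.le (r := fun _ => (2 ^ p)⁻¹ - (2 ^ q)⁻¹) measurable_const
  have hloss := hξ.2.mul_left h.le (r := fun _ => ((2 : ℝ) ^ q)⁻¹) measurable_const
  have hC := CondIntegrable.of_measurable (P := P) h.le (f := fun _ => -C) measurable_const
  have hlower := hgain.add (hloss.add hC)
  have hX_half := hX.const_mul (1 / 2)
  have hξ_half := hξ.1.const_smul (1 / 2 : ℝ)
  have hint := h.condIntegrable_payoff hX_half hξ_half hlower (h.le_payoff_half X ξ)
  filter_upwards [condMean_mono hlower hint (h.le_payoff_half X ξ),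
    condMean_add hgain (hloss.add hC), condMean_add hloss hC,
    condMean_mul_left h.le (r := fun _ => (2 ^ p)⁻¹ - (2 ^ q)⁻¹) measurable_const hξ.2.max_zero,
    condMean_mul_left h.le (r := fun _ => ((2 : ℝ) ^ q)⁻¹) measurable_const hξ.2,
    hW.condMean_le _ hX_half _ ⟨hξ_half, hint⟩, hopt]
    with ω hω_mono hω_add hω_addC hω_gain hω_loss hω_W hω_opt
  rw [hω_add, hω_addC, hω_gain, hω_loss, condMean_of_measurable h.le measurable_const,
    hω_opt] at hω_mono
  rw [le_inv_mul_iff₀ hpq]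
  linarith

theorem integrable_max_zero_payoff_of_optimal (hW : IsValue P m Y V W)
    (h : OnePeriod P m Y L p q C V) (hX : Measurable[m] X) (hξ : ξ ∈ positions P m V Y X)
    (hopt : ∀ᵐ ω ∂P, condMean P m (payoff V Y X ξ) ω = W (X ω) ω)
    (hWX : Integrable (fun ω => W (X ω) ω) P) (hW_int : Integrable (W 0) P) :
    Integrable (fun ω => max (payoff V Y X ξ ω) 0) P := by
  have hpq : 0 ≤ ((2 : ℝ) ^ p)⁻¹ - (2 ^ q)⁻¹ := sub_nonneg.2 <| inv_anti₀ (by positivity)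
    (Real.rpow_le_rpow_of_exponent_le one_le_two h.p_lt_q.le)
  have hbound : Integrable (fun ω => ((2 ^ p)⁻¹ - (2 ^ q)⁻¹)⁻¹ *
      (|W (X ω) ω| + |W 0 ω| - (2 ^ q)⁻¹ * W (X ω) ω + C)) P :=
    (((hWX.abs.add hW_int.abs).sub (hWX.const_mul _)).add (integrable_const C)).const_mul _
  refine hξ.2.max_zero.integrable_of_condMean_le h.le hbound ?_ ?_
  · filter_upwards [hW.condMean_max_zero_le_of_optimal h hX hξ hopt] with ω hω
    refine hω.trans (mul_le_mul_of_nonneg_left ?_ (inv_nonneg.2 hpq))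
    linarith [hW.half_le (X ω) ω]
  · simp only [ENNReal.ofReal_of_nonpos (neg_nonpos.2 (le_max_right _ (0 : ℝ))), lintegral_zero,
      ne_eq, ENNReal.zero_ne_top, not_false_eq_true]

theorem integrable_payoff_of_optimal (hW : IsValue P m Y V W) (h : OnePeriod P m Y L p q C V)
    (hX : Measurable[m] X) (hξ : ξ ∈ positions P m V Y X)
    (hopt : ∀ᵐ ω ∂P, condMean P m (payoff V Y X ξ) ω = W (X ω) ω)
    (hWX : Integrable (fun ω => W (X ω) ω) P) (hW_int : Integrable (W 0) P) :
    Integrable (payoff V Y X ξ) P := by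
  have hpos := hW.integrable_max_zero_payoff_of_optimal h hX hξ hopt hWX hW_int
  have hneg : Integrable (fun ω => -payoff V Y X ξ ω) P := by
    refine hξ.2.neg.integrable_of_condMean_le h.le hWX.neg ?_ ?_
    · filter_upwards [hopt] with ω hω
      exact ((condMean_neg _ ω).trans (congrArg Neg.neg hω)).le
    · refine ne_top_of_le_ne_top hpos.lintegral_lt_top.ne
        (lintegral_mono fun ω => ENNReal.ofReal_le_ofReal ?_)
      rw [neg_neg]
      exact le_max_left _ _
  simpa only [neg_neg] using hneg.fun_neg

theorem integral_payoff_of_optimal (h : OnePeriod P m Y L p q C V)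
    (hint : Integrable (payoff V Y X ξ) P)
    (hopt : ∀ᵐ ω ∂P, condMean P m (payoff V Y X ξ) ω = W (X ω) ω) :
    ∫ ω, payoff V Y X ξ ω ∂P = ∫ ω, W (X ω) ω ∂P :=
  (integral_condMean h.le hint).symm.trans (integral_congr_ae hopt)

end IsValue

end OnePeriod

end Integrability

/-! ### Growth of elastic utility functions -/

section Growth

open Filter Topology

variable {U : ℝ → ℝ}

theorem tendsto_atBot_of_concaveOn (hc : ConcaveOn ℝ Set.univ U) {a b : ℝ} (hab : a < b)
    (hU : U a < U b) : Tendsto U atBot atBot := by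
  let s : ℝ := (U b - U a) / (b - a)
  have hs : 0 < s := div_pos (sub_pos.2 hU) (sub_pos.2 hab)
  have hle : ∀ᶠ y in atBot, U y ≤ U a + s * (y + -a) := by
    filter_upwards [eventually_lt_atBot a] with y hy
    have hslope : s ≤ (U a - U y) / (a - y) :=
      hc.slope_anti_adjacent (Set.mem_univ y) (Set.mem_univ b) hy hab
    rw [le_div_iff₀ (sub_pos.2 hy)] at hslope
    linarith
  refine tendsto_atBot_mono' _ hle (tendsto_atBot_add_const_left _ _ ?_)
  exact (tendsto_atBot_add_const_right _ (-a) tendsto_id).const_mul_atBot hs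

theorem mul_map_le_of_concaveOn (hc : ConcaveOn ℝ Set.univ U) (h0 : 0 ≤ U 0) {r : ℝ} (hr : 0 ≤ r)
    (hr_one : r ≤ 1) (x : ℝ) : r * U x ≤ U (r * x) := by
  have h := hc.2 (Set.mem_univ x) (Set.mem_univ 0) hr (sub_nonneg.2 hr_one) (by ring)
  simp only [smul_eq_mul, mul_zero, add_zero] at h
  linarith [mul_nonneg (sub_nonneg.2 hr_one) h0]

theorem map_add_le_of_concaveOn (hc : ConcaveOn ℝ Set.univ U) (h0 : 0 ≤ U 0) {s t : ℝ}
    (hs : 0 < s) (ht : 0 < t) : U (s + t) ≤ U s + U t := by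
  have hst : 0 < s + t := add_pos hs ht
  have hU_s := mul_map_le_of_concaveOn hc h0 (div_nonneg hs.le hst.le)
    (div_le_one_of_le₀ (by linarith) hst.le) (s + t)
  have hU_t := mul_map_le_of_concaveOn hc h0 (div_nonneg ht.le hst.le)
    (div_le_one_of_le₀ (by linarith) hst.le) (s + t)
  rw [div_mul_cancel₀ _ hst.ne'] at hU_s hU_t
  calc U (s + t) = s / (s + t) * U (s + t) + t / (s + t) * U (s + t) := by field_simp
    _ ≤ U s + U t := add_le_add hU_s hU_t

/-- The growth of `U` under scaling has exponent `e` and constant `C`, uniformly over the shifts of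
`U` by claims of size at most `l`. -/
def HasGrowth (U : ℝ → ℝ) (l e C : ℝ) : Prop :=
  ∀ b, |b| ≤ l → ∀ x t : ℝ, 1 ≤ t → U (t * x - b) ≤ t ^ e * (U (x - b) + C)

theorem HasGrowth.mono_const {l e C C' : ℝ} (h : HasGrowth U l e C) (hC : C ≤ C') :
    HasGrowth U l e C' := fun b hb x t ht =>
  (h b hb x t ht).trans (by gcongr)

theorem hasGrowth_one (hc : ConcaveOn ℝ Set.univ U) (hm : Monotone U) {l : ℝ}
    (h : U (-l) ≤ 0) : HasGrowth U l 1 (-U (-l)) := by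
  intro b hb x t ht
  have ht_pos : 0 < t := one_pos.trans_le ht
  have hconc := hc.2 (Set.mem_univ (t * x - b)) (Set.mem_univ (-b)) (inv_nonneg.2 ht_pos.le)
    (sub_nonneg.2 (inv_le_one_of_one_le₀ ht)) (by ring)
  have hcomb : t⁻¹ • (t * x - b) + (1 - t⁻¹) • (-b) = x - b := by
    simp only [smul_eq_mul]
    field_simp
    ring
  rw [hcomb, smul_eq_mul, smul_eq_mul] at hconc
  have hb_le : U (-l) ≤ U (-b) := hm (neg_le_neg (abs_le.1 hb).2)
  rw [Real.rpow_one]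
  calc U (t * x - b)
      = t * (t⁻¹ * U (t * x - b) + (1 - t⁻¹) * U (-b)) - (t - 1) * U (-b) := by
        field_simp
        ring
    _ ≤ t * U (x - b) - (t - 1) * U (-l) := sub_le_sub
        (mul_le_mul_of_nonneg_left hconc ht_pos.le)
        (mul_le_mul_of_nonneg_left hb_le (sub_nonneg.2 ht))
    _ ≤ t * (U (x - b) + -U (-l)) := by linarith

namespace ElasticAtTop

theorem map_max_add_le (hU : ElasticAtTop U) {l x₀ b : ℝ} (hx₀ : 0 < x₀) (hb : |b| ≤ l)
    (x : ℝ) : U (max x l + l + x₀) ≤ max (U (x - b)) 0 + U (2 * l + x₀) := by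
  obtain ⟨hb_ge, hb_le⟩ := abs_le.1 hb
  rcases le_or_gt x l with hx | hx
  · rw [max_eq_right hx, ← two_mul]
    exact le_add_of_nonneg_left (le_max_right _ _)
  · calc U (max x l + l + x₀) = U ((x - b) + (l + b + x₀)) := by
          rw [max_eq_left hx.le]
          ring_nf
      _ ≤ U (x - b) + U (l + b + x₀) :=
          map_add_le_of_concaveOn hU.concave hU.zero.ge (by linarith) (by linarith)
      _ ≤ max (U (x - b)) 0 + U (2 * l + x₀) :=
          add_le_add (le_max_left _ _) (hU.mono (by linarith))

/-- Where `U (x - b)` is very negative the linear bound is already good enough; elsewhere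
`t * x - b` is at most `t * y` for a point `y ≥ x₀` with `U y` comparable to `U (x - b)`. -/
theorem hasGrowth (hU : ElasticAtTop U) {l x₀ γ : ℝ} (hl : 0 ≤ l) (hx₀ : 0 < x₀) (hγ : γ ≤ 1)
    (hgrowth : ∀ x, x₀ ≤ x → ∀ t : ℝ, 1 ≤ t → U (t * x) ≤ t ^ γ * U x) :
    HasGrowth U l γ (-U (-l) + U (2 * l + x₀)) := by
  intro b hb x t ht
  have ht_pos : 0 < t := one_pos.trans_le ht
  have hpow : 0 < t ^ γ := Real.rpow_pos_of_pos ht_pos γ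
  have hneg : U (-l) ≤ 0 := (hU.mono (neg_nonpos.2 hl)).trans_eq hU.zero
  have hpos : 0 ≤ U (2 * l + x₀) := hU.zero.ge.trans (hU.mono (by positivity))
  rcases le_total (U (x - b) + -U (-l)) 0 with h | h
  · calc U (t * x - b) ≤ t ^ (1 : ℝ) * (U (x - b) + -U (-l)) :=
          hasGrowth_one hU.concave hU.mono hneg b hb x t ht
      _ ≤ t ^ γ * (U (x - b) + -U (-l)) :=
          mul_le_mul_of_nonpos_right (Real.rpow_le_rpow_of_exponent_le ht hγ) h
      _ ≤ t ^ γ * (U (x - b) + (-U (-l) + U (2 * l + x₀))) :=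
          mul_le_mul_of_nonneg_left (by linarith) hpow.le
  · have hx : t * x - b ≤ t * (max x l + l + x₀) := by
      have hmax : t * x ≤ t * max x l := mul_le_mul_of_nonneg_left (le_max_left _ _) ht_pos.le
      have hshift : l ≤ t * l := le_mul_of_one_le_left hl ht
      linarith [(abs_le.1 hb).1, mul_pos ht_pos hx₀]
    have hx₀_le : x₀ ≤ max x l + l + x₀ := by linarith [le_max_right x l]
    calc U (t * x - b) ≤ U (t * (max x l + l + x₀)) := hU.mono hx
      _ ≤ t ^ γ * U (max x l + l + x₀) := hgrowth _ hx₀_le t ht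
      _ ≤ t ^ γ * (U (x - b) + (-U (-l) + U (2 * l + x₀))) := by
          refine mul_le_mul_of_nonneg_left ((hU.map_max_add_le hx₀ hb x).trans ?_) hpow.le
          linarith [max_le (by linarith : U (x - b) ≤ U (x - b) + -U (-l)) h]

theorem exists_hasGrowth (hU : ElasticAtTop U) {l : ℝ} (hl : 0 ≤ l) :
    ∃ p q C : ℝ, 0 < p ∧ p < q ∧ HasGrowth U l p C ∧ HasGrowth U l q C := by
  obtain ⟨x₀, hx₀, γ, hγ_pos, hγ_lt, hgrowth⟩ := hU.growth
  have hneg : U (-l) ≤ 0 := (hU.mono (neg_nonpos.2 hl)).trans_eq hU.zero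
  have hpos : 0 ≤ U (2 * l + x₀) := hU.zero.ge.trans (hU.mono (by positivity))
  exact ⟨γ, 1, _, hγ_pos, hγ_lt, hU.hasGrowth hl hx₀ hγ_lt.le hgrowth,
    (hasGrowth_one hU.concave hU.mono hneg).mono_const (le_add_of_nonneg_right hpos)⟩

end ElasticAtTop

theorem rpow_le_one_add_mul_rpow {t r e : ℝ} (ht : 1 ≤ t) (hr : 0 ≤ r) (hr_one : r ≤ 1)
    (he : 0 ≤ e) : t ^ (r * e) ≤ (1 + r * (t - 1)) ^ e := by
  have hbernoulli : t ^ r ≤ 1 + r * (t - 1) := by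
    simpa only [add_sub_cancel] using rpow_one_add_le_one_add_mul_self (s := t - 1) (by linarith)
      hr hr_one
  rw [Real.rpow_mul (by linarith)]
  exact Real.rpow_le_rpow (Real.rpow_nonneg (by linarith) r) hbernoulli he

namespace ElasticAtBot

theorem map_mul_sub_le (hU : ElasticAtBot U) {x₀ δ e b z t : ℝ} (hδ : 0 < δ) (hδ_one : δ < 1)
    (he : 0 ≤ e) (hgrowth : ∀ x, x ≤ x₀ → ∀ t : ℝ, 1 ≤ t → U (t * x) ≤ t ^ e * U x)
    (hz : z ≤ x₀) (hUz : U z ≤ 0) (hbz : δ * z ≤ -b) (ht : 1 ≤ t) :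
    U (t * (z + b) - b) ≤ t ^ ((1 - δ) * e) * U z := by
  have hr : 1 ≤ 1 + (1 - δ) * (t - 1) :=
    le_add_of_nonneg_right (mul_nonneg (by linarith) (by linarith))
  have hle : t * (z + b) - b ≤ (1 + (1 - δ) * (t - 1)) * z := by
    linarith [mul_le_mul_of_nonneg_left hbz (sub_nonneg.2 ht)]
  calc U (t * (z + b) - b) ≤ U ((1 + (1 - δ) * (t - 1)) * z) := hU.mono hle
    _ ≤ (1 + (1 - δ) * (t - 1)) ^ e * U z := hgrowth z hz _ hr
    _ ≤ t ^ ((1 - δ) * e) * U z := mul_le_mul_of_nonpos_right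
        (rpow_le_one_add_mul_rpow ht (by linarith) (by linarith) he) hUz

/-- Part of the exponent is given up to absorb the shift `b`: this is possible as soon as
`x - b` is so negative that `|b|` is at most the fraction `δ` of it. -/
theorem hasGrowth (hU : ElasticAtBot U) {l x₀ δ e : ℝ} (hl : 0 ≤ l) (hx₀ : x₀ ≤ 0) (hδ : 0 < δ)
    (hδ_one : δ < 1) (he : 1 ≤ (1 - δ) * e)
    (hgrowth : ∀ x, x ≤ x₀ → ∀ t : ℝ, 1 ≤ t → U (t * x) ≤ t ^ e * U x) :
    HasGrowth U l ((1 - δ) * e) (-U (-l) + -U (min x₀ (-(l / δ)))) := by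
  intro b hb x t ht
  have ht_pos : 0 < t := one_pos.trans_le ht
  have hneg : U (-l) ≤ 0 := (hU.mono (neg_nonpos.2 hl)).trans_eq hU.zero
  have hneg_min : U (min x₀ (-(l / δ))) ≤ 0 :=
    (hU.mono ((min_le_left _ _).trans hx₀)).trans_eq hU.zero
  have hlin := ((hasGrowth_one hU.concave hU.mono hneg).mono_const
    (le_add_of_nonneg_right (neg_nonneg.2 hneg_min))) b hb x t ht
  rcases le_or_gt 0 (U (x - b) + (-U (-l) + -U (min x₀ (-(l / δ))))) with h | h
  · exact hlin.trans (mul_le_mul_of_nonneg_right (Real.rpow_le_rpow_of_exponent_le ht he) h)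
  · have hz : x - b < min x₀ (-(l / δ)) := hU.mono.reflect_lt (by linarith)
    have hbz : δ * (x - b) ≤ -b := by
      have hz_l := mul_le_mul_of_nonneg_left (hz.le.trans (min_le_right _ _)) hδ.le
      rw [mul_neg, mul_div_cancel₀ _ hδ.ne'] at hz_l
      exact hz_l.trans (neg_le_neg (abs_le.1 hb).2)
    have he_nonneg : 0 ≤ e := by
      by_contra! he_neg
      linarith [mul_neg_of_pos_of_neg (sub_pos.2 hδ_one) he_neg]
    have hmain := hU.map_mul_sub_le hδ hδ_one he_nonneg hgrowth (hz.le.trans (min_le_left _ _))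
      (by linarith) hbz ht
    rw [sub_add_cancel] at hmain
    exact hmain.trans (mul_le_mul_of_nonneg_left (by linarith)
      (Real.rpow_nonneg ht_pos.le _))

theorem exists_hasGrowth (hU : ElasticAtBot U) {l : ℝ} (hl : 0 ≤ l) :
    ∃ p q C : ℝ, 0 < p ∧ p < q ∧ HasGrowth U l p C ∧ HasGrowth U l q C := by
  obtain ⟨α, hα, x₀, hx₀, hgrowth⟩ := hU.growth
  let δ : ℝ := α / 2 / (1 + α)
  have hδ : 0 < δ := by positivity
  have hδ_one : δ < 1 := (div_lt_one (by positivity)).2 (by linarith)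
  have hexp : (1 - δ) * (1 + α) = 1 + α / 2 := by
    simp only [δ]
    field_simp
    ring
  have hneg : U (-l) ≤ 0 := (hU.mono (neg_nonpos.2 hl)).trans_eq hU.zero
  have hneg_min : U (min x₀ (-(l / δ))) ≤ 0 :=
    (hU.mono ((min_le_left _ _).trans hx₀)).trans_eq hU.zero
  exact ⟨1, (1 - δ) * (1 + α), _, one_pos, by linarith,
    (hasGrowth_one hU.concave hU.mono hneg).mono_const
      (le_add_of_nonneg_right (neg_nonneg.2 hneg_min)),
    hU.hasGrowth hl hx₀ hδ hδ_one (by linarith) hgrowth⟩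

end ElasticAtBot

theorem HasGrowth.randomUtility {Ω : Type*} {mΩ : MeasurableSpace Ω} {P : Measure Ω}
    (hc : ConcaveOn ℝ Set.univ U) (hm : Monotone U) {a b : ℝ} (hab : U a < U b) {B : Ω → ℝ}
    (hB : Measurable B) {l : ℝ} (hBl : ∀ᵐ ω ∂P, |B ω| ≤ l) {p q C : ℝ}
    (hp : HasGrowth U l p C) (hq : HasGrowth U l q C) :
    RandomUtility P mΩ (fun x => U (x - l)) p q C fun x ω => U (x - B ω) where
  measurable _ := hm.measurable.comp (measurable_const.sub hB)
  mono ω _ _ hxy := hm (sub_le_sub_right hxy (B ω))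
  concave ω := by
    simpa only [Set.preimage_univ, Function.comp_def, sub_eq_add_neg]
      using hc.translate_left (-B ω)
  lower := hBl.mono fun ω hω x => hm (sub_le_sub_left (abs_le.1 hω).2 x)
  growth := hBl.mono fun ω hω x t ht => ⟨hp _ hω x t ht, hq _ hω x t ht⟩
  tendsto_atBot := ae_of_all _ fun ω =>
    (tendsto_atBot_of_concaveOn hc (hm.reflect_lt hab) hab).comp
      (tendsto_atBot_add_const_right _ _
        (tendsto_neg_atTop_atBot.comp tendsto_natCast_atTop_atTop))

end Growth

/-! ### Backward recursion -/

section DynamicProgramming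

variable {Ω : Type*} {mΩ : MeasurableSpace Ω} {P : Measure Ω} {d T t : ℕ} {F : Filtration ℕ mΩ}
  {S : ℕ → Ω → EuclideanSpace ℝ (Fin d)} {UT : ℝ → Ω → ℝ} {L : ℝ → ℝ} {p q C : ℝ}
  {V W : ℝ → Ω → ℝ} {X : Ω → ℝ} {φ : ℕ → Ω → EuclideanSpace ℝ (Fin d)}
  {ξ : Ω → EuclideanSpace ℝ (Fin d)}

theorem isStrategy_zero : IsStrategy F T (0 : ℕ → Ω → EuclideanSpace ℝ (Fin d)) :=
  fun _ _ => measurable_const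

theorem IsStrategy.update (hφ : IsStrategy F T φ) (hξ : Measurable[F t] ξ) :
    IsStrategy F T (Function.update φ (t + 1) ξ) := by
  intro s hs
  rcases eq_or_ne s t with rfl | hst
  · rwa [Function.update_self]
  · rw [Function.update_of_ne (by lia)]
    exact hφ s hs

theorem wealth_update_zero (ht : t < T) (ξ : Ω → EuclideanSpace ℝ (Fin d)) (ω : Ω) :
    wealth S 0 (Function.update 0 (t + 1) ξ) T ω = gain S t (ξ ω) ω := by
  rw [wealth, zero_add, Finset.sum_eq_single_of_mem t (Finset.mem_range.2 ht),
    Function.update_self]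
  intro s _ hst
  rw [Function.update_of_ne (by lia), Pi.zero_apply, Pi.zero_apply, gain, inner_zero_left]

theorem NoArbitrage.gain_eq_zero (hNA : NoArbitrage P F T S) (ht : t < T)
    (hξ : Measurable[F t] ξ) (h : ∀ᵐ ω ∂P, 0 ≤ gain S t (ξ ω) ω) :
    ∀ᵐ ω ∂P, gain S t (ξ ω) ω = 0 := by
  simpa only [wealth_update_zero ht] using hNA _ (isStrategy_zero.update hξ)
    (by simpa only [wealth_update_zero ht] using h)

theorem measurable_add_gain (hS : ∀ t, t ≤ T → Measurable[F t] (S t)) (ht : t < T)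
    (hX : Measurable[F t] X) (hξ : Measurable[F t] ξ) :
    Measurable[F (t + 1)] fun ω => X ω + gain S t (ξ ω) ω := by
  have hmono : F t ≤ F (t + 1) := F.mono t.le_succ
  exact Measurable.add (hX.mono hmono le_rfl) (Measurable.inner (hξ.mono hmono le_rfl)
    (Measurable.sub (hS (t + 1) ht) ((hS t ht.le).mono hmono le_rfl)))

theorem genCondExp_eq_top {m : MeasurableSpace Ω} {f : Ω → ℝ} {ω : Ω}
    (hpos : P⁻[fun ω => ENNReal.ofReal (f ω) | m] ω = ⊤)
    (hneg : P⁻[fun ω => ENNReal.ofReal (-f ω) | m] ω < ⊤) : genCondExp P m f ω = ⊤ := by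
  rw [genCondExp, hpos, EReal.coe_ennreal_top]
  lift P⁻[fun ω => ENNReal.ofReal (-f ω) | m] ω to NNReal using hneg.ne with x
  simp

theorem FiniteValueFunctions.condLExp_lt_top (hfin : FiniteValueFunctions P F S T UT) (ht : t < T)
    (hV : IsValueFunction P F S T UT (t + 1) V) (x : ℝ) (ξ : Xi d F t) :
    ∀ᵐ ω ∂P, P⁻[fun ω => ENNReal.ofReal (V (x + gain S t (ξ.1 ω) ω) ω) | F t] ω < ⊤ := by
  obtain ⟨Z, ⟨-, hZ, -⟩, hZ_top⟩ := hfin.finite t V ht hV x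
  filter_upwards [hfin.defined t V ht hV x ξ, hZ ξ, hZ_top] with ω hdefined hle hlt
  by_contra hpos
  rw [not_lt_top_iff] at hpos
  have hneg := (hdefined.resolve_left (not_not.2 hpos)).lt_top
  exact (hle.trans_lt hlt).ne (genCondExp_eq_top hpos hneg)

theorem FiniteValueFunctions.onePeriod (hfin : FiniteValueFunctions P F S T UT)
    (hS : ∀ t, t ≤ T → Measurable[F t] (S t)) (hNA : NoArbitrage P F T S) (hL : Continuous L)
    (hp : 0 < p) (hpq : p < q) (ht : t < T)
    (hV : IsValueFunction P F S T UT (t + 1) V) (hV_utility : RandomUtility P mΩ L p q C V) :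
    OnePeriod P (F t) (fun ω => S (t + 1) ω - S t ω) L p q C V where
  le := F.le t
  measurable_increment :=
    ((hS (t + 1) ht).mono (F.le _) le_rfl).sub ((hS t ht.le).mono (F.le _) le_rfl)
  noArbitrage _ hξ h := hNA.gain_eq_zero ht hξ h
  continuous_lower := hL
  p_pos := hp
  p_lt_q := hpq
  utility := hV_utility
  lt_top y := hfin.condLExp_lt_top ht hV 1 ⟨fun _ => y, measurable_const⟩

/-- The final wealth when the strategy `φ` is followed from time `t` on, starting with the
wealth `X`. -/
noncomputable def terminalWealth (S : ℕ → Ω → EuclideanSpace ℝ (Fin d)) (T t : ℕ) (X : Ω → ℝ)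
    (φ : ℕ → Ω → EuclideanSpace ℝ (Fin d)) (ω : Ω) : ℝ :=
  X ω + ∑ i ∈ Finset.Ico t T, gain S i (φ (i + 1) ω) ω

theorem wealth_eq_terminalWealth (c : ℝ) (φ : ℕ → Ω → EuclideanSpace ℝ (Fin d)) :
    wealth S c φ T = terminalWealth S T 0 (fun _ => c) φ := by
  ext ω
  rw [wealth, terminalWealth, Finset.range_eq_Ico]

theorem terminalWealth_self (X : Ω → ℝ) (φ : ℕ → Ω → EuclideanSpace ℝ (Fin d)) :
    terminalWealth S T T X φ = X := by
  ext ω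
  rw [terminalWealth, Finset.Ico_self, Finset.sum_empty, add_zero]

theorem terminalWealth_succ (ht : t < T) (X : Ω → ℝ) (φ : ℕ → Ω → EuclideanSpace ℝ (Fin d)) :
    terminalWealth S T t X φ =
      terminalWealth S T (t + 1) (fun ω => X ω + gain S t (φ (t + 1) ω) ω) φ := by
  ext ω
  rw [terminalWealth, terminalWealth, Finset.sum_eq_sum_Ico_succ_bot ht, add_assoc]

theorem terminalWealth_update (ht : t < T) (X : Ω → ℝ) (φ : ℕ → Ω → EuclideanSpace ℝ (Fin d))
    (ξ : Ω → EuclideanSpace ℝ (Fin d)) :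
    terminalWealth S T t X (Function.update φ (t + 1) ξ) =
      terminalWealth S T (t + 1) (fun ω => X ω + gain S t (ξ ω) ω) φ := by
  rw [terminalWealth_succ ht, Function.update_self]
  ext ω
  refine congrArg _ (Finset.sum_congr rfl fun i hi => ?_)
  have hi_ne : i + 1 ≠ t + 1 := by have := (Finset.mem_Ico.1 hi).1; lia
  rw [Function.update_of_ne hi_ne]

/-- The dynamic programming principle at time `t`: for every wealth `X` at time `t`, the number
`E V(X)` bounds the expected terminal utilities of the strategies started at time `t` with wealth
`X`, and it is attained. The bound only concerns terminal utilities whose negative part is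
integrable. -/
structure IsDynamicValue (P : Measure Ω) (F : Filtration ℕ mΩ)
    (S : ℕ → Ω → EuclideanSpace ℝ (Fin d)) (T : ℕ) (UT : ℝ → Ω → ℝ) (t : ℕ)
    (V : ℝ → Ω → ℝ) : Prop where
  lintegral_neg_ne_top : ∀ φ, IsStrategy F T φ → ∀ X : Ω → ℝ, Measurable[F t] X →
    ∫⁻ ω, ENNReal.ofReal (-UT (terminalWealth S T t X φ ω) ω) ∂P ≠ ⊤ →
    ∫⁻ ω, ENNReal.ofReal (-V (X ω) ω) ∂P ≠ ⊤
  integral_le : ∀ φ, IsStrategy F T φ → ∀ X : Ω → ℝ, Measurable[F t] X →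
    ∫⁻ ω, ENNReal.ofReal (-UT (terminalWealth S T t X φ ω) ω) ∂P ≠ ⊤ →
    Integrable (fun ω => V (X ω) ω) P →
    Integrable (fun ω => UT (terminalWealth S T t X φ ω) ω) P ∧
      ∫ ω, UT (terminalWealth S T t X φ ω) ω ∂P ≤ ∫ ω, V (X ω) ω ∂P
  attained : ∀ X : Ω → ℝ, Measurable[F t] X → Integrable (fun ω => V (X ω) ω) P →
    Integrable (V 0) P → ∃ φ, IsStrategy F T φ ∧
      Integrable (fun ω => UT (terminalWealth S T t X φ ω) ω) P ∧
      ∫ ω, UT (terminalWealth S T t X φ ω) ω ∂P = ∫ ω, V (X ω) ω ∂P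

theorem isDynamicValue_terminal : IsDynamicValue P F S T UT T UT where
  lintegral_neg_ne_top φ _ X _ h := by rwa [terminalWealth_self] at h
  integral_le φ _ X _ _ h := by
    rw [terminalWealth_self]
    exact ⟨h, le_rfl⟩
  attained X _ h _ := by
    refine ⟨0, isStrategy_zero, ?_⟩
    rw [terminalWealth_self]
    exact ⟨h, rfl⟩

variable [IsFiniteMeasure P]

theorem OnePeriod.IsValue.isValueFunction
    (hW : OnePeriod.IsValue P (F t) (fun ω => S (t + 1) ω - S t ω) V W)
    (h : OnePeriod P (F t) (fun ω => S (t + 1) ω - S t ω) L p q C V) (ht : t < T)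
    (hV : IsValueFunction P F S T UT (t + 1) V) : IsValueFunction P F S T UT t W := by
  refine .step ht hV (ae_of_all _ fun ω => ⟨hW.mono ω, hW.concave ω⟩) fun x => ⟨?_, ?_, ?_⟩
  · exact measurable_coe_real_ereal.comp (hW.measurable x)
  · exact fun ξ => hW.genCondExp_payoff_le h (X := fun _ => x) measurable_const ξ.2
  · intro Z _ hZ
    obtain ⟨ξ, hξ, hξ_opt⟩ := hW.attained (fun _ => x) measurable_const
    filter_upwards [hZ ⟨ξ, hξ.1⟩, genCondExp_eq_condMean hξ.2, hξ_opt] with ω hle hmean hopt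
    rw [← hopt, ← hmean]
    exact hle

theorem OnePeriod.mem_positions_of_lintegral_neg_ne_top {m : MeasurableSpace Ω}
    {Y : Ω → EuclideanSpace ℝ (Fin d)} (h : OnePeriod P m Y L p q C V) (hX : Measurable[m] X)
    (hξ : Measurable[m] ξ) (hneg : ∫⁻ ω, ENNReal.ofReal (-payoff V Y X ξ ω) ∂P ≠ ⊤) :
    ξ ∈ positions P m V Y X :=
  h.mem_positions hX hξ (condLExp_lt_top hneg)

namespace IsDynamicValue

theorem exists_strategy (hV : IsDynamicValue P F S T UT (t + 1) V)
    (hW : OnePeriod.IsValue P (F t) (fun ω => S (t + 1) ω - S t ω) V W)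
    (h : OnePeriod P (F t) (fun ω => S (t + 1) ω - S t ω) L p q C V)
    (hS : ∀ t, t ≤ T → Measurable[F t] (S t)) (ht : t < T) (hX : Measurable[F t] X)
    (hWX : Integrable (fun ω => W (X ω) ω) P) (hW_int : Integrable (W 0) P) :
    ∃ φ, IsStrategy F T φ ∧ Integrable (fun ω => UT (terminalWealth S T t X φ ω) ω) P ∧
      ∫ ω, UT (terminalWealth S T t X φ ω) ω ∂P = ∫ ω, W (X ω) ω ∂P := by
  obtain ⟨ξ, hξ, hξ_opt⟩ := hW.attained X hX
  have hint := hW.integrable_payoff_of_optimal h hX hξ hξ_opt hWX hW_int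
  obtain ⟨φ, hφ, hφ_int, hφ_eq⟩ := hV.attained (fun ω => X ω + gain S t (ξ ω) ω)
    (measurable_add_gain hS ht hX hξ.1) hint (hW.integrable_zero h hW_int)
  refine ⟨Function.update φ (t + 1) ξ, hφ.update hξ.1, ?_⟩
  rw [terminalWealth_update ht]
  exact ⟨hφ_int, hφ_eq.trans (OnePeriod.IsValue.integral_payoff_of_optimal h hint hξ_opt)⟩

theorem step (hV : IsDynamicValue P F S T UT (t + 1) V)
    (hW : OnePeriod.IsValue P (F t) (fun ω => S (t + 1) ω - S t ω) V W)
    (h : OnePeriod P (F t) (fun ω => S (t + 1) ω - S t ω) L p q C V)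
    (hS : ∀ t, t ≤ T → Measurable[F t] (S t)) (ht : t < T) : IsDynamicValue P F S T UT t W where
  lintegral_neg_ne_top φ hφ X hX hneg := by
    rw [terminalWealth_succ ht] at hneg
    have hpayoff := hV.lintegral_neg_ne_top φ hφ _ (measurable_add_gain hS ht hX (hφ t ht)) hneg
    have hmem := h.mem_positions_of_lintegral_neg_ne_top hX (hφ t ht) hpayoff
    exact ne_top_of_le_ne_top hpayoff (hW.lintegral_ofReal_neg_le h hX hmem)
  integral_le φ hφ X hX hneg hWX := by
    rw [terminalWealth_succ ht] at hneg ⊢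
    have hwealth := measurable_add_gain hS ht hX (hφ t ht)
    have hpayoff := hV.lintegral_neg_ne_top φ hφ _ hwealth hneg
    have hmem := h.mem_positions_of_lintegral_neg_ne_top hX (hφ t ht) hpayoff
    have hint := hW.integrable_payoff h hX hmem hpayoff hWX
    obtain ⟨hUT_int, hUT_le⟩ := hV.integral_le φ hφ _ hwealth hneg hint
    exact ⟨hUT_int, hUT_le.trans (hW.integral_payoff_le h hX hmem hint hWX)⟩
  attained X hX hWX hW_int := hV.exists_strategy hW h hS ht hX hWX hW_int

end IsDynamicValue

theorem exists_isDynamicValue (hfin : FiniteValueFunctions P F S T UT)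
    (hS : ∀ t, t ≤ T → Measurable[F t] (S t)) (hNA : NoArbitrage P F T S) (hL : Continuous L)
    (hp : 0 < p) (hpq : p < q) (hUT : RandomUtility P mΩ L p q C UT) (ht : t ≤ T) :
    ∃ V, IsValueFunction P F S T UT t V ∧ RandomUtility P mΩ L p q C V ∧
      IsDynamicValue P F S T UT t V := by
  induction ht using Nat.decreasingInduction with
  | self => exact ⟨UT, .terminal, hUT, isDynamicValue_terminal⟩
  | of_succ t ht ih =>
    obtain ⟨V, hV, hV_utility, hV_dyn⟩ := ih
    have h := hfin.onePeriod hS hNA hL hp hpq ht hV hV_utility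
    obtain ⟨W, hW⟩ := h.exists_isValue
    have hW_utility := hW.randomUtility h
    exact ⟨W, hW.isValueFunction h ht hV,
      { hW_utility with measurable := fun x => (hW_utility.measurable x).mono (F.le t) le_rfl },
      hV_dyn.step hW h hS ht⟩

end DynamicProgramming

/-! ### Optimal strategies -/

section GenExp

variable {Ω : Type*} {mΩ : MeasurableSpace Ω} {P : Measure Ω} {f : Ω → ℝ}

theorem genExp_of_integrable (hf : Integrable f P) :
    genExp P f = ((∫ ω, f ω ∂P : ℝ) : EReal) := by
  have hneg : ∫⁻ ω, ENNReal.ofReal (-f ω) ∂P ≠ ⊤ := hf.neg.lintegral_lt_top.ne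
  rw [integral_eq_lintegral_pos_part_sub_lintegral_neg_part hf, EReal.coe_sub,
    EReal.coe_ennreal_toReal hf.lintegral_lt_top.ne, EReal.coe_ennreal_toReal hneg]
  rfl

theorem genExp_eq_top (hpos : ∫⁻ ω, ENNReal.ofReal (f ω) ∂P = ⊤)
    (hneg : ∫⁻ ω, ENNReal.ofReal (-f ω) ∂P ≠ ⊤) : genExp P f = ⊤ := by
  rw [genExp, hpos, EReal.coe_ennreal_top]
  lift ∫⁻ ω, ENNReal.ofReal (-f ω) ∂P to NNReal using hneg with x
  simp

theorem genExp_eq_bot (hpos : ∫⁻ ω, ENNReal.ofReal (f ω) ∂P ≠ ⊤)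
    (hneg : ∫⁻ ω, ENNReal.ofReal (-f ω) ∂P = ⊤) : genExp P f = ⊥ := by
  rw [genExp, hneg, EReal.coe_ennreal_top]
  lift ∫⁻ ω, ENNReal.ofReal (f ω) ∂P to NNReal using hpos with x
  simp

theorem integrable_of_genExp_lt_top [IsFiniteMeasure P] (hf : AEMeasurable f P)
    (hlt : genExp P f < ⊤) {a : ℝ} (ha : ∀ᵐ ω ∂P, a ≤ f ω) : Integrable f P := by
  have hneg : ∫⁻ ω, ENNReal.ofReal (-f ω) ∂P ≠ ⊤ := by
    refine ne_top_of_le_ne_top (b := ∫⁻ _, ENNReal.ofReal (-a) ∂P)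
      (by simp [ENNReal.mul_eq_top]) (lintegral_mono_ae ?_)
    filter_upwards [ha] with ω hω using ENNReal.ofReal_le_ofReal (neg_le_neg hω)
  exact integrable_of_lintegral_ofReal_ne_top hf (fun hpos => hlt.ne (genExp_eq_top hpos hneg))
    hneg

end GenExp

section Optimization

variable {Ω : Type*} {mΩ : MeasurableSpace Ω} {P : Measure Ω} {d T : ℕ} {F : Filtration ℕ mΩ}
  {S : ℕ → Ω → EuclideanSpace ℝ (Fin d)} {U : ℝ → ℝ} {B : Ω → ℝ} {V : ℝ → Ω → ℝ} {c : ℝ}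

/-- The finite number `v` is the maximum of `E U(V_T^{c,φ} - B)` over `φ ∈ Φ(U, c, B)`. -/
structure IsMaxExpectedUtility (P : Measure Ω) (F : Filtration ℕ mΩ)
    (S : ℕ → Ω → EuclideanSpace ℝ (Fin d)) (T : ℕ) (U : ℝ → ℝ) (c : ℝ) (B : Ω → ℝ)
    (v : ℝ) : Prop where
  le : ∀ φ ∈ admissible P F S T U c B, genExp P (fun ω => U (wealth S c φ T ω - B ω)) ≤ v
  attained : ∃ φ ∈ admissible P F S T U c B, genExp P (fun ω => U (wealth S c φ T ω - B ω)) = v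

theorem IsMaxExpectedUtility.optimalValue_eq {v : ℝ}
    (hv : IsMaxExpectedUtility P F S T U c B v) : optimalValue P F S T U c B = v := by
  refine le_antisymm (iSup₂_le hv.le) ?_
  obtain ⟨φ, hφ, hφ_eq⟩ := hv.attained
  exact hφ_eq.ge.trans
    (le_iSup₂ (f := fun φ _ => genExp P (fun ω => U (wealth S c φ T ω - B ω))) φ hφ)

theorem isMaxExpectedUtility_zero (h : ∀ x, U x = 0) : IsMaxExpectedUtility P F S T U c B 0 := by
  have hgen (φ : ℕ → Ω → EuclideanSpace ℝ (Fin d)) :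
      genExp P (fun ω => U (wealth S c φ T ω - B ω)) = (0 : ℝ) := by
    simp [genExp, h]
  exact ⟨fun φ _ => (hgen φ).le, 0, ⟨isStrategy_zero, Or.inl (by simp [h])⟩, hgen 0⟩

theorem IsDynamicValue.isMaxExpectedUtility
    (hV : IsDynamicValue P F S T (fun x ω => U (x - B ω)) 0 V) (hV_int : ∀ x, Integrable (V x) P) :
    IsMaxExpectedUtility P F S T U c B (∫ ω, V c ω ∂P) where
  le φ hφ := by
    obtain ⟨hφ, hdefined⟩ := hφ
    rw [wealth_eq_terminalWealth] at hdefined ⊢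
    by_cases hneg : ∫⁻ ω, ENNReal.ofReal
        (-U (terminalWealth S T 0 (fun _ => c) φ ω - B ω)) ∂P = ⊤
    · rw [genExp_eq_bot (hdefined.resolve_right (not_not.2 hneg)) hneg]
      exact bot_le
    · obtain ⟨hint, hle⟩ := hV.integral_le φ hφ _ measurable_const hneg (hV_int c)
      rw [genExp_of_integrable hint]
      exact_mod_cast hle
  attained := by
    obtain ⟨φ, hφ, hint, heq⟩ :=
      hV.attained (fun _ => c) measurable_const (hV_int c) (hV_int 0)
    rw [← wealth_eq_terminalWealth] at hint heq
    refine ⟨φ, ⟨hφ, Or.inl hint.lintegral_lt_top.ne⟩, ?_⟩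
    rw [genExp_of_integrable hint, heq]

theorem IsMaxExpectedUtility.exists_optimal {v : ℝ} (hv : IsMaxExpectedUtility P F S T U c B v) :
    ⊥ < optimalValue P F S T U c B ∧ optimalValue P F S T U c B < ⊤ ∧
      ∃ φ ∈ admissible P F S T U c B,
        genExp P (fun ω => U (wealth S c φ T ω - B ω)) = optimalValue P F S T U c B := by
  rw [hv.optimalValue_eq]
  exact ⟨EReal.bot_lt_coe v, EReal.coe_lt_top v, hv.attained⟩

theorem FiniteValueFunctions.exists_isMaxExpectedUtility [IsFiniteMeasure P]
    (hfin : FiniteValueFunctions P F S T fun x ω => U (x - B ω))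
    (hS : ∀ t, t ≤ T → Measurable[F t] (S t)) (hNA : NoArbitrage P F T S) {L : ℝ → ℝ}
    {p q C : ℝ} (hL : Continuous L) (hp : 0 < p) (hpq : p < q)
    (hU : RandomUtility P mΩ L p q C fun x ω => U (x - B ω)) (c : ℝ) :
    ∃ v, IsMaxExpectedUtility P F S T U c B v := by
  obtain ⟨V, hV, hV_utility, hV_dyn⟩ :=
    exists_isDynamicValue hfin hS hNA hL hp hpq hU (Nat.zero_le T)
  exact ⟨_, hV_dyn.isMaxExpectedUtility fun x =>
    integrable_of_genExp_lt_top (hV_utility.measurable x).aemeasurable (hfin.initial V hV x).2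
      (hV_utility.lower.mono fun _ hω => hω x)⟩

end Optimization

end UtilityMax

open UtilityMax in
theorem theorem2p10_general {Ω : Type*} {mΩ : MeasurableSpace Ω} (P : Measure Ω)
    [IsFiniteMeasure P] (d T : ℕ) (F : Filtration ℕ mΩ)
    (S : ℕ → Ω → EuclideanSpace ℝ (Fin d)) (hS : ∀ t, t ≤ T → Measurable[F t] (S t))
    (hNA : NoArbitrage P F T S) (U : ℝ → ℝ) (hU : ElasticAtTop U ∨ ElasticAtBot U)
    (B : Ω → ℝ) (hB : Measurable B) (hBbdd : ∃ l : ℝ, ∀ᵐ ω ∂P, |B ω| ≤ l)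
    (hfin : FiniteValueFunctions P F S T (fun x ω => U (x - B ω))) (c : ℝ) :
    ⊥ < optimalValue P F S T U c B ∧ optimalValue P F S T U c B < ⊤ ∧
      ∃ φ ∈ admissible P F S T U c B,
        genExp P (fun ω => U (wealth S c φ T ω - B ω)) = optimalValue P F S T U c B := by
  have hconcave : ConcaveOn ℝ Set.univ U := hU.elim (·.concave) (·.concave)
  have hmono : Monotone U := hU.elim (·.mono) (·.mono)
  have hzero : U 0 = 0 := hU.elim (·.zero) (·.zero)
  suffices ∃ v, IsMaxExpectedUtility P F S T U c B v from this.elim fun _ hv => hv.exists_optimal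
  by_cases hconst : ∃ a b, U a < U b
  · obtain ⟨a, b, hab⟩ := hconst
    obtain ⟨l, hl⟩ := hBbdd
    obtain ⟨p, q, C, hp_pos, hpq, hp, hq⟩ :=
      hU.elim (·.exists_hasGrowth (abs_nonneg l)) (·.exists_hasGrowth (abs_nonneg l))
    have hcont := continuous_of_concaveOn_univ hconcave
    exact hfin.exists_isMaxExpectedUtility hS hNA (by fun_prop) hp_pos hpq
      (HasGrowth.randomUtility hconcave hmono hab hB (hl.mono fun _ h => h.trans (le_abs_self l))
        hp hq) c
  · push Not at hconst
    exact ⟨0, isMaxExpectedUtility_zero fun x => ((hconst 0 x).antisymm (hconst x 0)).trans hzero⟩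

theorem theorem2p10 {Ω : Type*} {mΩ : MeasurableSpace Ω} (P : Measure Ω) [IsProbabilityMeasure P]
    (d T : ℕ) (F : Filtration ℕ mΩ)
    (hF : ∀ N : Set Ω, P N = 0 → MeasurableSet[F 0] N)
    (S : ℕ → Ω → EuclideanSpace ℝ (Fin d)) (hS : ∀ t, t ≤ T → Measurable[F t] (S t))
    (hNA : UtilityMax.NoArbitrage P F T S)
    (U : ℝ → ℝ) (hU : UtilityMax.ElasticAtTop U ∨ UtilityMax.ElasticAtBot U)
    (B : Ω → ℝ) (hB : Measurable B) (hBbdd : ∃ l : ℝ, ∀ᵐ ω ∂P, |B ω| ≤ l)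
    (hfin : UtilityMax.FiniteValueFunctions P F S T (fun x ω => U (x - B ω))) (c : ℝ) :
    ⊥ < UtilityMax.optimalValue P F S T U c B ∧
      UtilityMax.optimalValue P F S T U c B < ⊤ ∧
      ∃ φ ∈ UtilityMax.admissible P F S T U c B,
        UtilityMax.genExp P (fun ω => U (UtilityMax.wealth S c φ T ω - B ω)) =
          UtilityMax.optimalValue P F S T U c B :=
  theorem2p10_general P d T F S hS hNA U hU B hB hBbdd hfin c
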